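/- **Setting.** Let $V$ be a finite-dimensional non-degenerate quadratic space over $\mathbb{Q}$ with bilinear form $(\cdot,\cdot)$, let $L\subset V$ be an even lattice (finitely generated, $\mathbb{Q}L=V$, $(\lambda,\lambda)\in2\mathbb{Z}$ for $\lambda\in L$) with dual $L^*=\{\nu\in V:(\nu,L)\subseteq\mathbb{Z}\}$, and let $U\subseteq V$ be an isotropic subspace. Put $W=U^\perp/U$ with the induced form, $I=U\cap L$, $I_{L^*}=U\cap L^*$, and let $\Lambda\subset W$ be the image of $L\cap U^\perp$, with dual lattice $\Lambda^*\subset W$ and $\Delta_\Lambda=\Lambda^*/\Lambda$. Write $U^*=\mathrm{Hom}_{\mathbb{Q}}(U,\mathbb{Q})\cong V/U^\perp$, $v\mapsto v^*$, and $I^*=\mathrm{Hom}(I,\mathbb{Z})\subset U^*$. For $\psi\in\mathrm{Hom}_{\mathbb{Q}}(W,U)$ let $\psi^*:U^*\to W^*\cong W$ be its dual. Let $\mathrm{Hom}^{as}_{\mathbb{Q}}(U^*,U)$ be the space of $\eta$ with $f(\eta g)=-g(\eta f)$ for all $f,g\in U^*$, and let $\mathrm{Hom}^{as}(I^*,I)$,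 $\mathrm{Hom}^{as}(I^*,\tfrac12I)$ be the subgroups of those $\eta$ that map $I^*$ into $I$, $\tfrac12I$. Let $\mathrm{Hom}(\Lambda^*,I)$ be the group of $\psi\in\mathrm{Hom}_{\mathbb{Q}}(W,U)$ with $\psi(\Lambda^*)\subseteq I$. Let $\mathcal{P}_U$ be the stabilizer of $U$ in $\mathrm{O}(V)$, with its natural map $\mathcal{P}_U\to\mathrm{GL}(U)\times\mathrm{O}(W)$, and let $\mathcal{W}_U$ be the kernel of this map. Embed $\mathrm{Hom}^{as}_{\mathbb{Q}}(U^*,U)$ as a normal subgroup of $\mathcal{P}_U$ by $\eta\mapsto(v\mapsto v-\eta v^*)$, and put $\overline{\mathcal{P}}_U=\mathcal{P}_U/\mathrm{Hom}^{as}_{\mathbb{Q}}(U^*,U)$. Let $\Gamma_L$ be the group of isometries of $V$ that preserve $L$, act trivially on $L^*/L$, and lie in the identity component $\mathrm{SO}^+(V_{\mathbb{R}})$ of $\mathrm{O}(V_{\mathbb{R}})$; define $\Gamma_\Lambda\subset\mathrm{O}(W)$ in the same way from $\Lambda$. Let $\Gamma_{L,I}$ be the intersection of $\Gamma_L$ with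 the identity component of $\mathcal{P}_{U_{\mathbb{R}}}$, the stabilizer of $U_{\mathbb{R}}$ in $\mathrm{O}(V_{\mathbb{R}})$, and let $\overline\Gamma_{L,I}$ be its image in $\overline{\mathcal{P}}_U$. For a subgroup $J\subseteq U$ let $\mathrm{SL}(J,I)$ be the group of $M\in\mathrm{GL}(U)$ with $MI=I$, $\det M=1$, and $u-Mu\in I$ for all $u\in J$. The integral Heisenberg group $H(\mathrm{Hom}(\Lambda^*,I),\mathrm{Hom}^{as}(I^*,I))$ is the set of pairs $(\psi,\eta)\in\mathrm{Hom}(\Lambda^*,I)\times\mathrm{Hom}^{as}(I^*,\tfrac12I)$ such that $\tfrac12\psi\psi^*+\eta$ maps $I^*$ into $I$, with the product $(\psi,\eta)(\varphi,\rho)=\bigl(\psi+\varphi,\ \eta+\rho+\tfrac12(\psi\varphi^*-\varphi\psi^*)\bigr)$. A *unimodular complement* is a subgroup $\tilde I\subseteq L^*$ for which the pairing induces a bijection $\tilde I\to\mathrm{Hom}(I,\mathbb{Z})$. Given one, put $\tilde U=\mathbb{Q}\tilde I$ and $\tilde W=(U+\tilde U)^\perp$, which maps isomorphically to $W$, so that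 $V=U\oplus\tilde W\oplus\tilde U$, and let $\tilde I_L$ be the group of those elements of $\tilde I$ whose pairing with $I$ coincides with that of some element of $L$. Let $\iota:\tilde I_L\to\Delta_\Lambda$ be the homomorphism such that $\iota\tilde u=w+\Lambda$ whenever $u\in U$, $w\in\tilde W\cong W$, $\tilde u\in\tilde I_L$ and $u+w+\tilde u\in L$. Let $\iota^*:\Delta_\Lambda\to U/I_{L^*}$ be its $\mathbb{Q}/\mathbb{Z}$-dual, so that $u\in\iota^*\delta$ means $(u,\tilde u)\equiv(\delta,\iota\tilde u)$ modulo $\mathbb{Z}$ for all $\tilde u\in\tilde I_L$, and let $I_\iota\subseteq U$ be the group containing $I_{L^*}$ with $I_\iota/I_{L^*}=\iota^*(\Delta_\Lambda)$. **Theorem.** Unimodular complements exist, and the following hold. 1. The map $\mathcal{P}_U\to\mathrm{GL}(U)\times\mathrm{O}(W)$ restricts to a short exact sequence $$1\to H(\mathrm{Hom}(\Lambda^*,I),\mathrm{Hom}^{as}(I^*,I))\to\Gamma_{L,I}\to\mathrm{SL}(I_{L^*},I)\times\Gamma_\Lambda\to1,$$ in which the image of the Heisenberg group is $\Gamma_{L,I}\cap\mathcal{W}_U$.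 For every unimodular complement $\tilde I$ the injection can be taken to send $(\psi,\eta)$ to the element $A$ with $Au=u$ for $u\in U$, $Aw=w-\psi w$ for $w\in\tilde W\cong W$, and $A\tilde u=\tilde u+\psi^*\tilde u^*-(\tfrac12\psi\psi^*+\eta)\tilde u^*$ for $\tilde u\in\tilde U$, where $\psi^*\tilde u^*\in W\cong\tilde W$. 2. The element of $\mathcal{P}_U$ that corresponds to $\eta\in\mathrm{Hom}^{as}_{\mathbb{Q}}(U^*,U)$ lies in $\Gamma_{L,I}$ if and only if $\eta\in\mathrm{Hom}^{as}(I^*,I)$, so that $\overline\Gamma_{L,I}\cong\Gamma_{L,I}/\mathrm{Hom}^{as}(I^*,I)$. The induced map $\overline{\mathcal{P}}_U\to\mathrm{GL}(U)\times\mathrm{O}(W)$ restricts to a short exact sequence $$1\to\mathrm{Hom}(\Lambda^*,I)\to\overline\Gamma_{L,I}\to\mathrm{SL}(I_{L^*},I)\times\Gamma_\Lambda\to1,$$ where $\psi\in\mathrm{Hom}(\Lambda^*,I)$ is sent to the class of those $A\in\mathcal{W}_U$ that satisfy $z-Az=\psi(z+U)$ for all $z\in U^\perp$. 3. For every unimodular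 complement $\tilde I$ the map $\iota$ exists and is unique, $\mathrm{SL}(I_\iota,I)\subseteq\mathrm{SL}(I_{L^*},I)$, and the restriction of the second sequence to the pre-image of $\mathrm{SL}(I_\iota,I)\times\Gamma_\Lambda$ splits: this pre-image is the semi-direct product of $\mathrm{Hom}(\Lambda^*,I)$ and $\mathrm{SL}(I_\iota,I)\times\Gamma_\Lambda$, the latter acting by $(M,\gamma):\psi\mapsto M\psi\gamma^{-1}$, where the subgroup $\mathrm{Hom}(\Lambda^*,I)$ is embedded as in the second sequence, and $(M,\gamma)\in\mathrm{SL}(I_\iota,I)\times\Gamma_\Lambda$ corresponds to the class of those $A\in\mathcal{P}_U$ that map to $(M,\gamma)$ and satisfy $A(U\oplus\tilde U)=U\oplus\tilde U$. -/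

import Mathlib

open LinearMap (BilinForm GeneralLinearGroup)
open scoped TensorProduct

noncomputable section

namespace IntegralParabolic

section General

variable {K X : Type*} [Field K] [AddCommGroup X] [Module K X]

/-- The orthogonal group of a bilinear form, as a subgroup of the general linear group. -/
def orthogonalGroup (B : BilinForm K X) : Subgroup (GeneralLinearGroup K X) where
  carrier := {g | ∀ x y, B (g.1 x) (g.1 y) = B x y}
  one_mem' := fun _ _ => rfl
  mul_mem' := fun {a b} ha hb x y => (ha (b.1 x) (b.1 y)).trans (hb x y)
  inv_mem' := fun {a} ha x y => by
    have h := ha (a⁻¹.1 x) (a⁻¹.1 y)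
    rw [← Module.End.mul_apply, ← Module.End.mul_apply, Units.mul_inv] at h
    exact h.symm

/-- The stabilizer of a subspace `U` in the orthogonal group. -/
def parabolic (B : BilinForm K X) (U : Submodule K X) : Subgroup (GeneralLinearGroup K X) where
  carrier := {g | g ∈ orthogonalGroup B ∧ ∀ x, g.1 x ∈ U ↔ x ∈ U}
  one_mem' := ⟨one_mem _, fun _ => Iff.rfl⟩
  mul_mem' := fun {a b} ha hb =>
    ⟨mul_mem ha.1 hb.1, fun x => (ha.2 (b.1 x)).trans (hb.2 x)⟩
  inv_mem' := fun {a} ha => ⟨inv_mem ha.1, fun x => by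
    have h := ha.2 (a⁻¹.1 x)
    rw [← Module.End.mul_apply, Units.mul_inv] at h
    exact h.symm⟩

end General

section Real

/-- The identity component of a group `G` of automorphisms of a finite-dimensional real vector
space, for the topology that `G` inherits from the canonical (module) topology of the space of
endomorphisms. -/
def identityComponent {X : Type*} [AddCommGroup X] [Module ℝ X] [Module.Finite ℝ X]
    (G : Subgroup (GeneralLinearGroup ℝ X)) : Subgroup (GeneralLinearGroup ℝ X) :=
  letI : TopologicalSpace (Module.End ℝ X) := moduleTopology ℝ (Module.End ℝ X)
  haveI : IsModuleTopology ℝ (Module.End ℝ X) := ⟨rfl⟩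
  haveI : IsTopologicalRing (Module.End ℝ X) := IsModuleTopology.isTopologicalRing ℝ _
  (Subgroup.connectedComponentOfOne G).map G.subtype

/-- Extension of scalars from `ℚ` to `ℝ` for automorphisms. -/
def realGL (X : Type*) [AddCommGroup X] [Module ℚ X] :
    GeneralLinearGroup ℚ X →* GeneralLinearGroup ℝ (ℝ ⊗[ℚ] X) :=
  Units.map (Module.End.baseChangeHom ℚ ℝ X : Module.End ℚ X →* Module.End ℝ (ℝ ⊗[ℚ] X))

variable {X : Type*} [AddCommGroup X] [Module ℚ X]

/-- The rational automorphisms that lie in `SO⁺` of the real quadratic space `ℝ ⊗ X`, i.e. in the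
identity component of its orthogonal group. -/
def specialOrthPlus [FiniteDimensional ℚ X] (B : BilinForm ℚ X) :
    Subgroup (GeneralLinearGroup ℚ X) :=
  (identityComponent (orthogonalGroup (B.baseChange ℝ))).comap (realGL X)

/-- The rational automorphisms that lie in the identity component of the real parabolic group. -/
def parabolicPlus [FiniteDimensional ℚ X] (B : BilinForm ℚ X) (U : Submodule ℚ X) :
    Subgroup (GeneralLinearGroup ℚ X) :=
  (identityComponent (parabolic (B.baseChange ℝ) (U.baseChange ℝ))).comap (realGL X)

/-- The isometries that preserve `L` and act trivially on the quotient of the dual lattice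
by `L`. -/
def stableOrthogonal (B : BilinForm ℚ X) (L : Submodule ℤ X) :
    Subgroup (GeneralLinearGroup ℚ X) where
  carrier := {g | g ∈ orthogonalGroup B ∧ (∀ x, g.1 x ∈ L ↔ x ∈ L) ∧
    ∀ x ∈ B.dualSubmodule L, g.1 x - x ∈ L}
  one_mem' := ⟨one_mem _, fun _ => Iff.rfl, fun x _ => by simp⟩
  mul_mem' := fun {a b} ha hb => by
    refine ⟨mul_mem ha.1 hb.1, fun x => (ha.2.1 (b.1 x)).trans (hb.2.1 x), fun x hx => ?_⟩
    have h1 := (ha.2.1 _).2 (hb.2.2 x hx)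
    have h2 := add_mem h1 (ha.2.2 x hx)
    rw [map_sub, sub_add_sub_cancel] at h2
    exact h2
  inv_mem' := fun {a} ha => by
    have e : ∀ x, a.1 (a⁻¹.1 x) = x := fun x => by
      rw [← Module.End.mul_apply, Units.mul_inv]; rfl
    refine ⟨inv_mem ha.1, fun x => ?_, fun x hx => ?_⟩
    · have h := ha.2.1 (a⁻¹.1 x)
      rw [e] at h
      exact h.symm
    · rw [← ha.2.1, map_sub, e, ← neg_sub]
      exact neg_mem (ha.2.2 x hx)

/-- The discriminant kernel `Γ_L`: the isometries in `SO⁺` that preserve `L` and act trivially on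
the discriminant group. -/
def discriminantKernel [FiniteDimensional ℚ X] (B : BilinForm ℚ X) (L : Submodule ℤ X) :
    Subgroup (GeneralLinearGroup ℚ X) :=
  stableOrthogonal B L ⊓ specialOrthPlus B

end Real

section Heis

variable {X Y : Type*} [AddCommGroup X] [Module ℚ X] [AddCommGroup Y] [Module ℚ Y]

/-- The Heisenberg group of a bilinear map `β : X × X → Y`: the set `X × Y` with the product
`(x, y) (x', y') = (x + x', y + y' + β x x')`. -/
@[ext]
structure Heisenberg (β : X →ₗ[ℚ] X →ₗ[ℚ] Y) where
  fst : X
  snd : Y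

variable (β : X →ₗ[ℚ] X →ₗ[ℚ] Y)

instance : Group (Heisenberg β) where
  mul a b := ⟨a.fst + b.fst, a.snd + b.snd + β a.fst b.fst⟩
  one := ⟨0, 0⟩
  inv a := ⟨-a.fst, -a.snd + β a.fst a.fst⟩
  mul_assoc a b c := by
    apply Heisenberg.ext
    · exact add_assoc _ _ _
    · change a.snd + b.snd + β a.fst b.fst + c.snd + β (a.fst + b.fst) c.fst =
        a.snd + (b.snd + c.snd + β b.fst c.fst) + β a.fst (b.fst + c.fst)
      simp only [map_add, LinearMap.add_apply]
      abel
  one_mul a := by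
    apply Heisenberg.ext
    · exact zero_add _
    · change 0 + a.snd + β 0 a.fst = a.snd
      simp
  mul_one a := by
    apply Heisenberg.ext
    · exact add_zero _
    · change a.snd + 0 + β a.fst 0 = a.snd
      simp
  inv_mul_cancel a := by
    apply Heisenberg.ext
    · exact neg_add_cancel _
    · change -a.snd + β a.fst a.fst + a.snd + β (-a.fst) a.fst = 0
      simp

@[simp] theorem Heisenberg.mul_fst (a b : Heisenberg β) : (a * b).fst = a.fst + b.fst := rfl
@[simp] theorem Heisenberg.mul_snd (a b : Heisenberg β) :
    (a * b).snd = a.snd + b.snd + β a.fst b.fst := rfl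
@[simp] theorem Heisenberg.one_fst : (1 : Heisenberg β).fst = 0 := rfl
@[simp] theorem Heisenberg.one_snd : (1 : Heisenberg β).snd = 0 := rfl
@[simp] theorem Heisenberg.inv_fst (a : Heisenberg β) : a⁻¹.fst = -a.fst := rfl
@[simp] theorem Heisenberg.inv_snd (a : Heisenberg β) :
    a⁻¹.snd = -a.snd + β a.fst a.fst := rfl

end Heis

/-- A non-degenerate rational quadratic space `V`, given by its bilinear form, with an even
lattice `L` in `V` and an isotropic subspace `U` of `V`. -/
structure IsotropicDatum (V : Type*) [AddCommGroup V] [Module ℚ V] where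
  form : BilinForm ℚ V
  symm : form.IsSymm
  nondegenerate : form.Nondegenerate
  L : Submodule ℤ V
  isLattice : L.IsLattice ℚ
  even : ∀ x ∈ L, ∃ n : ℤ, form x x = 2 * n
  U : Submodule ℚ V
  isotropic : U ≤ form.orthogonal U

namespace IsotropicDatum

variable {V : Type*} [AddCommGroup V] [Module ℚ V] (D : IsotropicDatum V)

/-- The dual lattice `L*`, inside `V`. -/
def Ldual : Submodule ℤ V := D.form.dualSubmodule D.L

/-- `U^⊥`. -/
abbrev Uperp : Submodule ℚ V := D.form.orthogonal D.U

/-- `W = U^⊥ / U`. -/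
abbrev W : Type _ := D.Uperp ⧸ D.U.submoduleOf D.Uperp

/-- The projection `U^⊥ → W`. -/
abbrev toW : D.Uperp →ₗ[ℚ] D.W := (D.U.submoduleOf D.Uperp).mkQ

/-- The bilinear form on `W` induced from `V`. -/
def formW : BilinForm ℚ D.W :=
  LinearMap.liftQ₂ (D.U.submoduleOf D.Uperp) (D.U.submoduleOf D.Uperp)
    (D.form.restrict D.Uperp)
    (fun x hx => LinearMap.ext fun y => y.2 x.1 hx)
    (fun x hx => LinearMap.ext fun y => (D.symm.eq y.1 x.1).trans (y.2 x.1 hx))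

theorem formW_toW (x y : D.Uperp) : D.formW (D.toW x) (D.toW y) = D.form x y := rfl

theorem formW_symm : D.formW.IsSymm := ⟨fun x y => by
  obtain ⟨x, rfl⟩ := Submodule.mkQ_surjective _ x
  obtain ⟨y, rfl⟩ := Submodule.mkQ_surjective _ y
  exact D.symm.eq x.1 y.1⟩

/-- `Λ = (L ∩ U^⊥) / (L ∩ U)`, a lattice in `W`. -/
def Lam : Submodule ℤ D.W :=
  (D.L.comap (D.Uperp.subtype.restrictScalars ℤ)).map (D.toW.restrictScalars ℤ)

/-- The dual lattice `Λ*`, inside `W`. -/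
def LamDual : Submodule ℤ D.W := D.formW.dualSubmodule D.Lam

/-- The intersection of a subgroup of `V` with `U`, as a subgroup of `U`. -/
def inU (N : Submodule ℤ V) : Submodule ℤ D.U := N.comap (D.U.subtype.restrictScalars ℤ)

/-- `I = U ∩ L`. -/
def I : Submodule ℤ D.U := D.inU D.L

/-- `I_{L*} = U ∩ L*`. -/
def ILdual : Submodule ℤ D.U := D.inU D.Ldual

/-- `I* = Hom(I, ℤ)`, inside the dual space of `U`. -/
def Idual : Submodule ℤ (Module.Dual ℚ D.U) where
  carrier := {f | ∀ i ∈ D.I, f i ∈ (1 : Submodule ℤ ℚ)}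
  zero_mem' := fun _ _ => zero_mem _
  add_mem' := fun ha hb i hi => add_mem (ha i hi) (hb i hi)
  smul_mem' := fun c _ ha i hi => Submodule.smul_mem _ c (ha i hi)

/-- The map `V → V / U^⊥ ≅ U*` that is given by the pairing. -/
def star : V →ₗ[ℚ] Module.Dual ℚ D.U := D.U.subtype.dualMap ∘ₗ D.form

theorem star_apply (v : V) (u : D.U) : D.star v u = D.form v u := rfl

/-- `Hom^{as}(U*, U)`. -/
def homAs : Submodule ℚ (Module.Dual ℚ D.U →ₗ[ℚ] D.U) where
  carrier := {η | ∀ f g : Module.Dual ℚ D.U, f (η g) = - g (η f)}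
  zero_mem' := fun f g => by simp
  add_mem' := fun {a b} ha hb f g => by
    simp only [LinearMap.add_apply, map_add, ha f g, hb f g]; ring
  smul_mem' := fun c a ha f g => by
    simp only [LinearMap.smul_apply, map_smul, ha f g, smul_neg]

/-- `Hom(Λ*, I)`, inside `Hom_ℚ(W, U)`. -/
def homLattice : AddSubgroup (D.W →ₗ[ℚ] D.U) where
  carrier := {ψ | ∀ x ∈ D.LamDual, ψ x ∈ D.I}
  zero_mem' := fun _ _ => zero_mem _
  add_mem' := fun ha hb x hx => add_mem (ha x hx) (hb x hx)
  neg_mem' := fun ha x hx => neg_mem (ha x hx)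

/-- The parabolic subgroup `P_U`. -/
abbrev P : Subgroup (GeneralLinearGroup ℚ V) := parabolic D.form D.U

variable {D} in
theorem P_inv_form (A : D.P) (x y : V) : D.form (A⁻¹.1.1 x) y = D.form x (A.1.1 y) := by
  have h := A.2.1 (A⁻¹.1.1 x) y
  have e : A.1.1 (A⁻¹.1.1 x) = x := by
    rw [← Module.End.mul_apply]
    change (A.1 * A.1⁻¹).1 x = x
    simp
  rw [e] at h
  exact h.symm

theorem P_mem_Uperp (A : D.P) (x : V) (hx : x ∈ D.Uperp) : A.1.1 x ∈ D.Uperp := fun u hu => by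
  change D.form u (A.1.1 x) = 0
  rw [← P_inv_form]
  exact hx _ ((A⁻¹.2.2 u).2 hu)

/-- The action of `P_U` on `U`. -/
def actU : D.P →* GeneralLinearGroup ℚ D.U :=
  MonoidHom.toHomUnits
    { toFun := fun A => A.1.1.restrict fun x hx => (A.2.2 x).2 hx
      map_one' := rfl
      map_mul' := fun _ _ => rfl }

theorem actU_apply (A : D.P) (u : D.U) : ((D.actU A).1 u : V) = A.1.1 u := rfl

/-- The action of `P_U` on `W`. -/
def actW : D.P →* GeneralLinearGroup ℚ D.W :=
  MonoidHom.toHomUnits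
    { toFun := fun A => Submodule.mapQ _ _ (A.1.1.restrict (D.P_mem_Uperp A))
        fun x hx => (A.2.2 x.1).2 hx
      map_one' := LinearMap.ext fun x => by
        obtain ⟨x, rfl⟩ := Submodule.mkQ_surjective _ x
        rfl
      map_mul' := fun A B => LinearMap.ext fun x => by
        obtain ⟨x, rfl⟩ := Submodule.mkQ_surjective _ x
        rfl }

theorem actW_toW (A : D.P) (x : D.Uperp) :
    (D.actW A).1 (D.toW x) = D.toW ⟨A.1.1 x, D.P_mem_Uperp A x x.2⟩ := rfl

theorem actW_mem (A : D.P) : D.actW A ∈ orthogonalGroup D.formW := fun x y => by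
  obtain ⟨x, rfl⟩ := Submodule.mkQ_surjective _ x
  obtain ⟨y, rfl⟩ := Submodule.mkQ_surjective _ y
  exact A.2.1 x.1 y.1

/-- The natural map `P_U → GL(U) × O(W)`. -/
def levi : D.P →* GeneralLinearGroup ℚ D.U × orthogonalGroup D.formW :=
  D.actU.prod (D.actW.codRestrict _ D.actW_mem)

/-- The unipotent radical `𝒲_U`, the kernel of `P_U → GL(U) × O(W)`. -/
def unipotentRadical : Subgroup D.P := D.levi.ker

/-- The endomorphism `v ↦ v - η v*` of `V` that belongs to a map `η : U* → U`. -/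
def transEnd (η : Module.Dual ℚ D.U →ₗ[ℚ] D.U) : Module.End ℚ V :=
  LinearMap.id - D.U.subtype ∘ₗ η ∘ₗ D.star

theorem transEnd_zero : D.transEnd 0 = 1 := LinearMap.ext fun v => by simp [transEnd]

theorem transEnd_add (η ρ : Module.Dual ℚ D.U →ₗ[ℚ] D.U) :
    D.transEnd (η + ρ) = D.transEnd η * D.transEnd ρ := by
  have h0 : ∀ u : D.U, D.star u = 0 := fun u => LinearMap.ext fun u' => D.isotropic u'.2 u u.2
  refine LinearMap.ext fun v => ?_
  simp [h0, transEnd]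
  abel

theorem transEnd_apply (η : Module.Dual ℚ D.U →ₗ[ℚ] D.U) (v : V) :
    D.transEnd η v = v - (η (D.star v) : D.U) := rfl

/-- `Hom^{as}(U*, U)` as a subgroup of `P_U`: the elements of the form `v ↦ v - η v*` with
anti-symmetric `η`. -/
def center : Subgroup D.P where
  carrier := {A | ∃ η ∈ D.homAs, A.1.1 = D.transEnd η}
  one_mem' := ⟨0, zero_mem _, D.transEnd_zero.symm⟩
  mul_mem' := by
    rintro A B ⟨η, hη, hA⟩ ⟨ρ, hρ, hB⟩
    refine ⟨η + ρ, add_mem hη hρ, ?_⟩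
    rw [transEnd_add, ← hA, ← hB]
    rfl
  inv_mem' := by
    rintro A ⟨η, hη, hA⟩
    refine ⟨-η, neg_mem hη, ?_⟩
    have h1 : A.1.1 * D.transEnd (-η) = 1 := by
      rw [hA, ← transEnd_add, add_neg_cancel, transEnd_zero]
    exact Units.inv_eq_of_mul_eq_one_right h1

instance center_normal : D.center.Normal where
  conj_mem := by
    rintro B ⟨η, hη, hB⟩ A
    let M : D.U →ₗ[ℚ] D.U := (D.actU A).1
    refine ⟨M ∘ₗ η ∘ₗ M.dualMap, fun f g => hη (M.dualMap f) (M.dualMap g), ?_⟩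
    refine LinearMap.ext fun v => ?_
    change A.1.1 (B.1.1 (A⁻¹.1.1 v)) = v - A.1.1 (η (M.dualMap (D.star v)))
    have e : A.1.1 (A⁻¹.1.1 v) = v := by
      rw [← Module.End.mul_apply]
      change (A.1 * A.1⁻¹).1 v = v
      simp
    have e2 : D.star (A⁻¹.1.1 v) = M.dualMap (D.star v) :=
      LinearMap.ext fun u => P_inv_form A v u
    rw [hB, transEnd_apply, map_sub, e, e2]

/-- `P̄_U = P_U / Hom^{as}(U*, U)`. -/
abbrev Pbar : Type _ := D.P ⧸ D.center

theorem center_le : D.center ≤ D.levi.ker := by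
  rintro A ⟨η, hη, hA⟩
  have h0 : ∀ x : D.Uperp, A.1.1 x = x := fun x => by
    have : D.star x = 0 := LinearMap.ext fun u => (D.symm.eq _ _).trans (x.2 u u.2)
    rw [hA, transEnd_apply, this]
    simp
  refine Prod.ext ?_ ?_
  · apply Units.ext
    exact LinearMap.ext fun u => Subtype.ext (h0 ⟨u, D.isotropic u.2⟩)
  · apply Subtype.ext
    apply Units.ext
    refine LinearMap.ext fun x => ?_
    obtain ⟨x, rfl⟩ := Submodule.mkQ_surjective _ x
    change (D.actW _).1 (D.toW x) = D.toW x
    rw [actW_toW]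
    congr 1
    exact Subtype.ext (h0 x)

/-- The map `P̄_U → GL(U) × O(W)` induced by `levi`. -/
def leviBar : D.Pbar →* GeneralLinearGroup ℚ D.U × orthogonalGroup D.formW :=
  QuotientGroup.lift D.center D.levi D.center_le

/-- For a subgroup `J` of `U`, the group `SL(J, I)` of the automorphisms `M` of `I` (extended to
`U`) of determinant 1 such that `u - M u ∈ I` for all `u ∈ J`. -/
def SL (J : Submodule ℤ D.U) : Subgroup (GeneralLinearGroup ℚ D.U) where
  carrier := {M | (∀ u, M.1 u ∈ D.I ↔ u ∈ D.I) ∧ LinearMap.det M.1 = 1 ∧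
    ∀ u ∈ J, u - M.1 u ∈ D.I}
  one_mem' := ⟨fun _ => Iff.rfl, LinearMap.det_id, fun u _ => by simp⟩
  mul_mem' := fun {a b} ha hb => by
    refine ⟨fun u => (ha.1 (b.1 u)).trans (hb.1 u), ?_, fun u hu => ?_⟩
    · rw [Units.val_mul, map_mul, ha.2.1, hb.2.1, one_mul]
    · have h := add_mem (ha.2.2 u hu) ((ha.1 _).2 (hb.2.2 u hu))
      rw [map_sub, sub_add_sub_cancel] at h
      exact h
  inv_mem' := fun {a} ha => by
    have e : ∀ x, a.1 (a⁻¹.1 x) = x := fun x => by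
      rw [← Module.End.mul_apply, Units.mul_inv]; rfl
    refine ⟨fun x => ?_, ?_, fun x hx => ?_⟩
    · have h := ha.1 (a⁻¹.1 x)
      rw [e] at h
      exact h.symm
    · have h : LinearMap.det (a.1 * a⁻¹.1) = 1 := by
        rw [Units.mul_inv, map_one]
      rwa [map_mul, ha.2.1, one_mul] at h
    · rw [← ha.1, map_sub, e, ← neg_sub]
      exact neg_mem (ha.2.2 x hx)

theorem Lam_isLattice : D.Lam.IsLattice ℚ := by
  have := D.isLattice
  have hL : IsNoetherian ℤ D.L := isNoetherian_of_isNoetherianRing_of_finite ℤ D.L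
  constructor
  · refine Submodule.FG.map _ ?_
    have h1 : (D.L ⊓ D.Uperp.restrictScalars ℤ).FG := by
      have h2 := isNoetherian_submodule.1 hL (D.L ⊓ D.Uperp.restrictScalars ℤ) inf_le_left
      exact h2
    refine Submodule.fg_of_fg_map_injective (D.Uperp.subtype.restrictScalars ℤ)
      Subtype.val_injective ?_
    rw [Submodule.map_comap_eq]
    convert h1 using 1
    rw [inf_comm]
    congr 1
    ext x
    simp
  · rw [eq_top_iff]
    rintro x -
    obtain ⟨x, rfl⟩ := Submodule.mkQ_surjective _ x
    have hx : x.1 ∈ Submodule.span ℚ (D.L : Set V) := by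
      rw [D.isLattice.span_eq_top]; trivial
    obtain ⟨n, hn, hnx⟩ : ∃ n : ℤ, n ≠ 0 ∧ n • x.1 ∈ D.L := by
      generalize x.1 = x at hx
      induction hx using Submodule.span_induction with
      | mem x h => exact ⟨1, one_ne_zero, by simpa using h⟩
      | zero => exact ⟨1, one_ne_zero, by simp⟩
      | add x y _ _ hx hy =>
        obtain ⟨n, hn, hx⟩ := hx
        obtain ⟨m, hm, hy⟩ := hy
        refine ⟨n * m, mul_ne_zero hn hm, ?_⟩
        rw [smul_add, mul_comm, mul_smul, mul_comm, mul_smul]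
        exact add_mem (Submodule.smul_mem _ _ hx) (Submodule.smul_mem _ _ hy)
      | smul a x _ hx =>
        obtain ⟨n, hn, hx⟩ := hx
        refine ⟨n * a.den, mul_ne_zero hn (by exact_mod_cast a.den_nz), ?_⟩
        have h : (n * (a.den : ℤ)) • a • x = a.num • n • x := by
          rw [← Int.cast_smul_eq_zsmul ℚ, ← Int.cast_smul_eq_zsmul ℚ a.num,
            ← Int.cast_smul_eq_zsmul ℚ n, smul_smul, smul_smul]
          congr 1
          push_cast
          rw [mul_assoc, Rat.den_mul_eq_num, mul_comm]
        rw [h]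
        exact Submodule.smul_mem _ _ hx
    have h : D.toW x = (n : ℚ)⁻¹ • D.toW (n • x) := by
      rw [map_zsmul, ← Int.cast_smul_eq_zsmul ℚ, inv_smul_smul₀ (by exact_mod_cast hn)]
    change D.toW x ∈ _
    rw [h]
    exact Submodule.smul_mem _ _ (Submodule.subset_span ⟨n • x, hnx, rfl⟩)

theorem Lam_le_dual : D.Lam ≤ D.LamDual := by
  rintro _ ⟨x, hx, rfl⟩ _ ⟨y, hy, rfl⟩
  obtain ⟨a, ha⟩ := D.even x.1 hx
  obtain ⟨b, hb⟩ := D.even y.1 hy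
  obtain ⟨c, hc⟩ := D.even (x.1 + y.1) (add_mem hx hy)
  refine Submodule.mem_one.2 ⟨c - a - b, ?_⟩
  change ((c - a - b : ℤ) : ℚ) = D.form x.1 y.1
  have h := D.symm.eq x.1 y.1
  simp only [map_add, LinearMap.add_apply] at hc
  push_cast
  linarith

section Finite

variable [FiniteDimensional ℚ V]

theorem formW_nondegenerate : D.formW.Nondegenerate := by
  have hl : ∀ x : D.W, (∀ y, D.formW x y = 0) → x = 0 := fun x hx => by
    obtain ⟨x, rfl⟩ := Submodule.mkQ_surjective _ x
    have h : x.1 ∈ D.form.orthogonal D.Uperp := fun y hy =>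
      (D.symm.eq _ _).trans (hx (D.toW ⟨y, hy⟩))
    rw [LinearMap.BilinForm.orthogonal_orthogonal D.nondegenerate D.symm.isRefl] at h
    exact (Submodule.Quotient.mk_eq_zero _).2 h
  exact ⟨hl, fun y hy => hl y fun x => (D.formW_symm.eq _ _).trans (hy x)⟩

/-- The dual map `ψ* : U* → W* ≅ W` of a map `ψ : W → U`. -/
def adj : (D.W →ₗ[ℚ] D.U) →ₗ[ℚ] (Module.Dual ℚ D.U →ₗ[ℚ] D.W) :=
  (LinearMap.compRight ℚ (D.formW.toDual D.formW_nondegenerate).symm.toLinearMap) ∘ₗ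
    Module.Dual.transpose

theorem formW_adj (ψ : D.W →ₗ[ℚ] D.U) (f : Module.Dual ℚ D.U) (w : D.W) :
    D.formW (D.adj ψ f) w = f (ψ w) :=
  LinearMap.BilinForm.apply_toDual_symm_apply (hB := D.formW_nondegenerate) _ _

/-- The map `(ψ, φ) ↦ (ψ φ* - φ ψ*) / 2` from `Hom(W, U) × Hom(W, U)` to `Hom^{as}(U*, U)`. -/
def bracket : (D.W →ₗ[ℚ] D.U) →ₗ[ℚ] (D.W →ₗ[ℚ] D.U) →ₗ[ℚ] D.homAs :=
  LinearMap.mk₂ ℚ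
    (fun ψ φ => ⟨(2⁻¹ : ℚ) • (ψ ∘ₗ D.adj φ - φ ∘ₗ D.adj ψ), fun f g => by
      have h := D.formW_symm.eq
      simp only [LinearMap.smul_apply, LinearMap.sub_apply, LinearMap.comp_apply, map_smul,
        map_sub, ← formW_adj, smul_eq_mul]
      rw [h (D.adj ψ f), h (D.adj φ f)]
      ring⟩)
    (fun a b c => Subtype.ext <| LinearMap.ext fun f => by
      simp [smul_sub, smul_add]; abel)
    (fun r a c => Subtype.ext <| LinearMap.ext fun f => by
      simp [smul_sub, smul_comm r (2⁻¹ : ℚ)])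
    (fun a b c => Subtype.ext <| LinearMap.ext fun f => by
      simp [smul_sub, smul_add]; abel)
    (fun r a c => Subtype.ext <| LinearMap.ext fun f => by
      simp [smul_sub, smul_comm r (2⁻¹ : ℚ)])

theorem bracket_apply (ψ φ : D.W →ₗ[ℚ] D.U) (f : Module.Dual ℚ D.U) :
    (D.bracket ψ φ).1 f = (2⁻¹ : ℚ) • (ψ (D.adj φ f) - φ (D.adj ψ f)) := rfl

/-- The rational Heisenberg group `H(Hom(W, U), Hom^{as}(U*, U))`. -/
abbrev Heis : Type _ := Heisenberg (X := D.W →ₗ[ℚ] D.U) (Y := D.homAs) D.bracket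

theorem LamDual_dual : D.formW.dualSubmodule D.LamDual = D.Lam := by
  have := D.Lam_isLattice
  have := Submodule.IsLattice.free ℚ D.Lam
  let b := Module.Free.chooseBasis ℤ D.Lam
  have h : Submodule.span ℤ (Set.range (b.extendOfIsLattice ℚ)) = D.Lam := by
    have h1 : Set.range (b.extendOfIsLattice ℚ) = D.Lam.subtype '' Set.range b := by
      rw [← Set.range_comp]
      congr 1
      ext i
      simp
    rw [h1, Submodule.span_image, b.span_eq, Submodule.map_top, Submodule.range_subtype]
  have h2 := LinearMap.BilinForm.dualSubmodule_dualSubmodule_of_basis (R := ℤ)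
    D.formW D.formW_nondegenerate D.formW_symm (b.extendOfIsLattice ℚ)
  rwa [h] at h2

theorem adj_mem (ψ : D.W →ₗ[ℚ] D.U) (hψ : ψ ∈ D.homLattice) (f : Module.Dual ℚ D.U)
    (hf : f ∈ D.Idual) : D.adj ψ f ∈ D.LamDual := by
  have h : D.adj ψ f ∈ D.Lam := by
    rw [← LamDual_dual]
    intro x hx
    rw [formW_adj]
    exact hf _ (hψ x hx)
  exact D.Lam_le_dual h

/-- The integral Heisenberg group `H(Hom(Λ*, I), Hom^{as}(I*, I))`: the pairs `(ψ, η)` with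
`ψ ∈ Hom(Λ*, I)` and `η ∈ Hom^{as}(I*, I/2)` such that `ψ ψ* / 2 + η` maps `I*` to `I`. -/
def integralHeis : Subgroup D.Heis where
  carrier := {h | h.fst ∈ D.homLattice ∧ (∀ f ∈ D.Idual, (2 : ℤ) • h.snd.1 f ∈ D.I) ∧
    ∀ f ∈ D.Idual, (2⁻¹ : ℚ) • h.fst (D.adj h.fst f) + h.snd.1 f ∈ D.I}
  one_mem' := ⟨zero_mem _, fun f _ => by simp, fun f _ => by simp⟩
  mul_mem' := by
    rintro a b ⟨ha1, ha2, ha3⟩ ⟨hb1, hb2, hb3⟩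
    refine ⟨add_mem ha1 hb1, fun f hf => ?_, fun f hf => ?_⟩
    · have h1 := sub_mem (ha1 _ (D.adj_mem _ hb1 f hf)) (hb1 _ (D.adj_mem _ ha1 f hf))
      have h2 := add_mem (add_mem (ha2 f hf) (hb2 f hf)) h1
      convert h2 using 1
      simp only [Heisenberg.mul_snd, Submodule.coe_add, LinearMap.add_apply, bracket_apply]
      module
    · have h1 := ha1 _ (D.adj_mem _ hb1 f hf)
      have h2 := add_mem (add_mem (ha3 f hf) (hb3 f hf)) h1
      convert h2 using 1
      simp only [Heisenberg.mul_snd, Heisenberg.mul_fst, Submodule.coe_add, LinearMap.add_apply,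
        bracket_apply, map_add]
      module
  inv_mem' := by
    rintro a ⟨ha1, ha2, ha3⟩
    have h0 : ∀ f, (D.bracket a.fst a.fst).1 f = 0 := fun f => by
      rw [bracket_apply]; module
    have h1 : ∀ f, (a⁻¹).snd.1 f = - a.snd.1 f := fun f => by
      simp only [Heisenberg.inv_snd, Submodule.coe_add, LinearMap.add_apply, h0]
      simp
    refine ⟨neg_mem ha1, fun f hf => ?_, fun f hf => ?_⟩
    · rw [h1, smul_neg]
      exact neg_mem (ha2 f hf)
    · have h2 := sub_mem (ha1 _ (D.adj_mem _ ha1 f hf)) (ha3 f hf)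
      convert h2 using 1
      rw [h1]
      simp only [Heisenberg.inv_fst, map_neg, LinearMap.neg_apply, neg_neg]
      module

/-- The group `Γ_{L,I}`: the elements of `Γ_L` that lie in the identity component of the real
parabolic group, as a subgroup of `P_U`. -/
def Gam : Subgroup D.P :=
  (discriminantKernel D.form D.L ⊓ parabolicPlus D.form D.U).subgroupOf D.P

/-- `Γ̄_{L,I}`, the image of `Γ_{L,I}` in `P̄_U`. -/
def GamBar : Subgroup D.Pbar := D.Gam.map (QuotientGroup.mk' D.center)

/-- The discriminant kernel `Γ_Λ`, as a subgroup of `O(W)`. -/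
def GamLam : Subgroup (orthogonalGroup D.formW) :=
  (discriminantKernel D.formW D.Lam).subgroupOf (orthogonalGroup D.formW)

theorem GamLam_mem (g : D.GamLam) (x : D.W) (hx : x ∈ D.LamDual) :
    g.1.1.1 x ∈ D.LamDual := by
  have h := D.Lam_le_dual (g.2.1.2.2 x hx)
  have h2 := add_mem h hx
  rwa [sub_add_cancel] at h2

/-- The action of `(M, γ)` on `Hom(Λ*, I)` by `ψ ↦ M ψ γ⁻¹`. -/
def actHom {J : Submodule ℤ D.U} (g : D.SL J × D.GamLam) (ψ : D.homLattice) : D.homLattice :=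
  ⟨g.1.1.1 ∘ₗ ψ.1 ∘ₗ g.2⁻¹.1.1.1, fun x hx =>
    (g.1.2.1 _).2 (ψ.2 _ (D.GamLam_mem g.2⁻¹ x hx))⟩

theorem actHom_one {J : Submodule ℤ D.U} (ψ : D.homLattice) :
    D.actHom (1 : D.SL J × D.GamLam) ψ = ψ := rfl

theorem actHom_mul {J : Submodule ℤ D.U} (g h : D.SL J × D.GamLam) (ψ : D.homLattice) :
    D.actHom (g * h) ψ = D.actHom g (D.actHom h ψ) := by
  apply Subtype.ext
  refine LinearMap.ext fun x => ?_
  change g.1.1.1 (h.1.1.1 (ψ.1 ((g.2 * h.2)⁻¹.1.1.1 x))) = _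
  rw [mul_inv_rev]
  rfl

/-- The action of `SL(J, I) × Γ_Λ` on `Hom(Λ*, I)`, as a homomorphism. -/
def actHomAut (J : Submodule ℤ D.U) :
    (D.SL J × D.GamLam) →* MulAut (Multiplicative D.homLattice) where
  toFun g :=
    { toFun := fun ψ => Multiplicative.ofAdd (D.actHom g ψ.toAdd)
      invFun := fun ψ => Multiplicative.ofAdd (D.actHom g⁻¹ ψ.toAdd)
      left_inv := fun ψ => by
        change Multiplicative.ofAdd (D.actHom g⁻¹ (D.actHom g ψ.toAdd)) = ψ
        rw [← actHom_mul, inv_mul_cancel, actHom_one, ofAdd_toAdd]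
      right_inv := fun ψ => by
        change Multiplicative.ofAdd (D.actHom g (D.actHom g⁻¹ ψ.toAdd)) = ψ
        rw [← actHom_mul, mul_inv_cancel, actHom_one, ofAdd_toAdd]
      map_mul' := fun ψ φ => by
        rw [← ofAdd_add]
        congr 1
        apply Subtype.ext
        refine LinearMap.ext fun x => ?_
        exact map_add g.1.1.1 _ _ }
  map_one' := MulEquiv.ext fun ψ => congrArg Multiplicative.ofAdd (D.actHom_one (J := J) ψ.toAdd)
  map_mul' := fun g h => MulEquiv.ext fun ψ =>
    congrArg Multiplicative.ofAdd (D.actHom_mul g h ψ.toAdd)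

/-- `Δ_Λ = Λ* / Λ`. -/
abbrev Disc : Type _ := D.LamDual ⧸ D.Lam.submoduleOf D.LamDual

end Finite

/-- A sublattice `T` of `L*` (playing the role of `Ĩ`) whose pairing with `I` is unimodular:
the map `T → Hom(I, ℤ)` is bijective. -/
structure IsUnimodularComplement (T : Submodule ℤ V) : Prop where
  le_dual : T ≤ D.Ldual
  unimodular : ∀ f : D.I →ₗ[ℤ] ℤ, ∃! t : V, t ∈ T ∧ ∀ i : D.I, D.form t i.1 = f i

/-- `Ũ`, the rational span of `Ĩ`. -/
def tildeU (T : Submodule ℤ V) : Submodule ℚ V := Submodule.span ℚ (T : Set V)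

/-- `W̃ = (U + Ũ)^⊥`. -/
def tildeW (T : Submodule ℤ V) : Submodule ℚ V := D.form.orthogonal (D.U ⊔ tildeU T)

theorem tildeW_le (T : Submodule ℤ V) : D.tildeW T ≤ D.Uperp :=
  LinearMap.BilinForm.orthogonal_le le_sup_left

/-- The natural map `W̃ → W`, an isomorphism when `Ũ` is a complement of `U^⊥`. -/
def tildeToW (T : Submodule ℤ V) : D.tildeW T →ₗ[ℚ] D.W :=
  D.toW ∘ₗ Submodule.inclusion (D.tildeW_le T)

/-- `Ĩ_L`: the elements of `Ĩ` that pair with `I` like some element of `L`. -/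
def tildeIL (T : Submodule ℤ V) : Submodule ℤ V where
  carrier := {μ | μ ∈ T ∧ ∃ ν ∈ D.L, ∀ i ∈ D.I, D.form μ i = D.form ν i}
  zero_mem' := ⟨zero_mem _, 0, zero_mem _, fun _ _ => rfl⟩
  add_mem' := by
    rintro a b ⟨ha, c, hc, h1⟩ ⟨hb, d, hd, h2⟩
    refine ⟨add_mem ha hb, c + d, add_mem hc hd, fun i hi => ?_⟩
    simp only [map_add, LinearMap.add_apply, h1 i hi, h2 i hi]
  smul_mem' := by
    rintro n a ⟨ha, c, hc, h1⟩
    refine ⟨Submodule.smul_mem _ n ha, n • c, Submodule.smul_mem _ n hc, fun i hi => ?_⟩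
    simp only [map_zsmul, LinearMap.smul_apply, h1 i hi]

/-- The map `ι : Ĩ_L → Δ_Λ` of the decomposition of `L` along `V = U ⊕ W̃ ⊕ Ũ`: it sends the
`Ũ`-component `t` of an element `u + w + t` of `L` to the class in `Δ_Λ` of its
`W̃`-component `w`. -/
def IsIota (T : Submodule ℤ V) (ι : D.tildeIL T →ₗ[ℤ] D.Disc) : Prop :=
  ∀ (u : D.U) (w : D.tildeW T) (t : D.tildeIL T), (u + w + t : V) ∈ D.L →
    ∃ h : D.tildeToW T w ∈ D.LamDual, ι t = Submodule.Quotient.mk ⟨D.tildeToW T w, h⟩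

/-- The lattice `I_ι` in `U`, for which `I_ι / I_{L*}` is the image of the `ℚ/ℤ`-dual
`ι* : Δ_Λ → U / I_{L*}` of `ι`. A vector `u` lies in the coset `ι* δ` if and only if
`(u, t) = (δ, ι t)` in `ℚ/ℤ` for all `t ∈ Ĩ_L`; here `x` and `y` are representatives in `Λ*`
of `δ` and of `ι t`. -/
def Iiota {T : Submodule ℤ V} (ι : D.tildeIL T →ₗ[ℤ] D.Disc) : Submodule ℤ D.U where
  carrier := {u | ∃ x : D.LamDual, ∀ (t : D.tildeIL T) (y : D.LamDual),
    ι t = Submodule.Quotient.mk y → D.form u t - D.formW x y ∈ (1 : Submodule ℤ ℚ)}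
  zero_mem' := ⟨0, fun t y _ => by simp⟩
  add_mem' := by
    rintro a b ⟨x, hx⟩ ⟨y, hy⟩
    refine ⟨x + y, fun t z hz => ?_⟩
    have h := add_mem (hx t z hz) (hy t z hz)
    convert h using 1
    simp only [Submodule.coe_add, map_add, LinearMap.add_apply]
    ring
  smul_mem' := by
    rintro n a ⟨x, hx⟩
    refine ⟨n • x, fun t z hz => ?_⟩
    have h := Submodule.smul_mem _ n (hx t z hz)
    convert h using 1
    simp only [Submodule.coe_smul_of_tower, map_zsmul, LinearMap.smul_apply, smul_sub]

variable [FiniteDimensional ℚ V]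

/-- The element `A` of `P_U` has Heisenberg coordinates `(ψ, η)` with respect to `Ĩ`:
`A u = u`, `A w = w - ψ w` and `A t = t + ψ* t - (ψ ψ* / 2 + η) t` for `u ∈ U`, `w ∈ W̃` and
`t ∈ Ũ`, under the identifications `W̃ ≅ W` and `Ũ ≅ U*`. -/
def HasHeisCoord (T : Submodule ℤ V) (A : D.P) (h : D.Heis) : Prop :=
  (∀ u : D.U, A.1.1 u = u) ∧
  (∀ w : D.tildeW T, A.1.1 w = w - (h.fst (D.tildeToW T w) : D.U)) ∧
  ∀ t ∈ tildeU T, ∃ w : D.tildeW T, D.tildeToW T w = D.adj h.fst (D.star t) ∧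
    A.1.1 t = t + w -
      (((2⁻¹ : ℚ) • h.fst (D.adj h.fst (D.star t)) + h.snd.1 (D.star t) : D.U) : V)

end IsotropicDatum

end IntegralParabolic

end

open IntegralParabolic

/-! The proof works in coordinates adapted to the lattice. A unimodular complement Ĩ identifies Ũ
with U*. After half of its Gram form is subtracted from this identification, V becomes U × W × U*
with the split form f'(u) + f(u') + (w, w') (`exists_splitting`). In these coordinates the kernel of
P_U → GL(U) × O(W) is the rational Heisenberg group (`exists_heis`), and every (M, γ) has a
block-diagonal lift `leviLift`.

Integrality: since L** = L, an isometry preserves L and acts trivially on L*/L as soon as it moves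
each element of L* by an element of L (`stableOrthogonal_iff`). Moreover L* = Ĩ ⊕ (L* ∩ U^⊥)
(`exists_t_add`). Testing a Heisenberg element on the two summands yields exactly the integral
Heisenberg group (`heis_mem_Gam_iff`).

Surjectivity: the Levi lift of (M, γ) moves z ∈ L* ∩ U^⊥ by an element of Λ ⊂ W̃ and by Mu - u,
where u is the U-component of z. The second term is cancelled modulo I by a map ψ : W → U, defined
on Λ* through a section of L* ∩ U^⊥ → Λ*. Other lifts differ by I_{L*}, on which M is trivial modulo
I (`exists_levi_eq`). What remains is an error on Ĩ, measured by a bilinear form on I*. Evenness of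
L makes its diagonal integral, so modulo integral forms it is alternating, and a central η removes
it (`exists_homAs_congr`, `exists_homAs_stable`).

Identity components: unipotent elements lie on one-parameter groups, SL(U) is generated by
transvections that lift to Eichler transvections, and O(W_ℝ) embeds continuously. Hence determinant
one on U together with SO⁺ on W suffices (`mem_parabolicPlus`). Conversely the determinant on U is
positive, and it is a unit because a lattice is preserved.

The quotient: Hom^{as}(U*, U) consists of the elements of P_U that are trivial on U^⊥. Classes in
P̄_U are therefore computed on U^⊥, where η disappears (`mk_eq_mk_iff`). The Levi lift needs no
correction by ψ when M is trivial modulo I on the U-components of L* ∩ U^⊥. These lie in I_ι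
(`a_mem_Iiota`), whence the splitting over SL(I_ι, I) × Γ_Λ. -/

namespace IntegralParabolic

/-! ### Lattices in rational vector spaces and their duals -/

section Lattice

variable {X Y : Type*} [AddCommGroup X] [Module ℚ X] [AddCommGroup Y] [Module ℚ Y]

theorem mem_one_int {q : ℚ} : q ∈ (1 : Submodule ℤ ℚ) ↔ ∃ n : ℤ, (n : ℚ) = q :=
  Submodule.mem_one

theorem intCast_mem_one (n : ℤ) : (n : ℚ) ∈ (1 : Submodule ℤ ℚ) := mem_one_int.2 ⟨n, rfl⟩

theorem exists_zsmul_mem_of_mem_span (N : Submodule ℤ X) {x : X}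
    (hx : x ∈ Submodule.span ℚ (N : Set X)) : ∃ n : ℤ, n ≠ 0 ∧ n • x ∈ N := by
  induction hx using Submodule.span_induction with
  | mem x h => exact ⟨1, one_ne_zero, by simpa using h⟩
  | zero => exact ⟨1, one_ne_zero, by simp⟩
  | add x y _ _ hx hy =>
    obtain ⟨n, hn, hx⟩ := hx
    obtain ⟨m, hm, hy⟩ := hy
    refine ⟨n * m, mul_ne_zero hn hm, ?_⟩
    rw [smul_add, mul_comm, mul_smul, mul_comm, mul_smul]
    exact add_mem (Submodule.smul_mem _ _ hx) (Submodule.smul_mem _ _ hy)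
  | smul a x _ hx =>
    obtain ⟨n, hn, hx⟩ := hx
    refine ⟨n * a.den, mul_ne_zero hn (by exact_mod_cast a.den_nz), ?_⟩
    have h : (n * (a.den : ℤ)) • a • x = a.num • n • x := by
      rw [← Int.cast_smul_eq_zsmul ℚ, ← Int.cast_smul_eq_zsmul ℚ a.num,
        ← Int.cast_smul_eq_zsmul ℚ n, smul_smul, smul_smul]
      congr 1
      push_cast
      rw [mul_assoc, Rat.den_mul_eq_num, mul_comm]
    rw [h]
    exact Submodule.smul_mem _ _ hx

theorem zsmul_eq_zero_rat {n : ℤ} (hn : n ≠ 0) {x : X} (h : n • x = 0) : x = 0 := by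
  rw [← Int.cast_smul_eq_zsmul ℚ] at h
  exact (smul_eq_zero.1 h).resolve_left (by exact_mod_cast hn)

theorem exists_zsmul_mem_lattice (L : Submodule ℤ X) [hL : L.IsLattice ℚ] (x : X) :
    ∃ n : ℤ, n ≠ 0 ∧ n • x ∈ L :=
  exists_zsmul_mem_of_mem_span L (by rw [hL.span_eq_top]; trivial)

/-- A homomorphism from a lattice to a rational vector space extends to the whole space. -/
theorem exists_extend_lattice (L : Submodule ℤ X) [L.IsLattice ℚ] (f : L →ₗ[ℤ] Y) :
    ∃ F : X →ₗ[ℚ] Y, ∀ x : L, F x = f x := by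
  have := Submodule.IsLattice.free ℚ L
  let b := Module.Free.chooseBasis ℤ L
  let F := (b.extendOfIsLattice ℚ).constr ℚ (fun i => f (b i))
  have h : F.restrictScalars ℤ ∘ₗ L.subtype = f := b.ext fun i => by
    change F (b i) = f (b i)
    rw [← b.extendOfIsLattice_apply ℚ i]
    exact Module.Basis.constr_basis _ ℚ _ i
  exact ⟨F, fun x => LinearMap.congr_fun h x⟩

theorem exists_basis_span_eq (L : Submodule ℤ X) [L.IsLattice ℚ] :
    ∃ (n : ℕ) (b : Module.Basis (Fin n) ℚ X), Submodule.span ℤ (Set.range b) = L := by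
  have := Submodule.IsLattice.free ℚ L
  let b := Module.finBasis ℤ L
  refine ⟨_, b.extendOfIsLattice ℚ, ?_⟩
  have h1 : Set.range (b.extendOfIsLattice ℚ) = L.subtype '' Set.range b := by
    rw [← Set.range_comp]
    congr 1
    ext i
    simp
  rw [h1, Submodule.span_image, b.span_eq, Submodule.map_top, Submodule.range_subtype]

theorem dualSubmodule_dualSubmodule_lattice {B : BilinForm ℚ X} (hB : B.Nondegenerate)
    (hs : B.IsSymm) (L : Submodule ℤ X) [L.IsLattice ℚ] :
    B.dualSubmodule (B.dualSubmodule L) = L := by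
  obtain ⟨n, b, rfl⟩ := exists_basis_span_eq L
  exact LinearMap.BilinForm.dualSubmodule_dualSubmodule_of_basis B hB hs b

theorem isLattice_dualSubmodule {B : BilinForm ℚ X} (hB : B.Nondegenerate)
    (L : Submodule ℤ X) [L.IsLattice ℚ] : (B.dualSubmodule L).IsLattice ℚ := by
  classical
  obtain ⟨n, b, rfl⟩ := exists_basis_span_eq L
  have := b.finiteDimensional_of_finite
  rw [LinearMap.BilinForm.dualSubmodule_span_of_basis B hB b]
  refine ⟨Submodule.fg_span (Set.finite_range _), ?_⟩
  rw [Submodule.span_span_of_tower, Module.Basis.span_eq]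

/-- A `ℤ`-valued functional on the intersection of a lattice with a subspace is represented by an
element of the dual lattice. -/
theorem exists_dual_vector [FiniteDimensional ℚ X] {B : BilinForm ℚ X} (hB : B.Nondegenerate)
    (L : Submodule ℤ X) [L.IsLattice ℚ] (S : Submodule ℚ X)
    (f : L.comap (S.subtype.restrictScalars ℤ) →ₗ[ℤ] ℤ) :
    ∃ ν ∈ B.dualSubmodule L, ∀ i, B ν i.1 = f i := by
  -- The image of L in X/S is finitely generated and torsion-free, hence free. So L ∩ S is a direct
  -- summand of L, and `f` extends to L through the retraction `r`.
  let g : L →ₗ[ℤ] X ⧸ S := S.mkQ.restrictScalars ℤ ∘ₗ L.subtype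
  have : Module.Finite ℤ g.range := Module.Finite.range g
  have : Module.IsTorsionFree ℤ (X ⧸ S) := Module.IsTorsionFree.trans ℚ
  have : Module.Free ℤ g.range := Module.free_of_finite_type_torsion_free'
  obtain ⟨σ, hσ⟩ := Module.projective_lifting_property g.rangeRestrict LinearMap.id
    g.surjective_rangeRestrict
  have hσ' : ∀ y, g (σ y) = y := fun y =>
    congrArg Subtype.val (LinearMap.congr_fun hσ y)
  have hr : ∀ x : L, (x - σ (g.rangeRestrict x) : X) ∈ S := fun x => by
    rw [← Submodule.Quotient.mk_eq_zero, Submodule.Quotient.mk_sub, sub_eq_zero]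
    exact (hσ' (g.rangeRestrict x)).symm
  let r : L →ₗ[ℤ] L.comap (S.subtype.restrictScalars ℤ) :=
    { toFun := fun x => ⟨⟨_, hr x⟩, sub_mem x.2 (σ (g.rangeRestrict x)).2⟩
      map_add' := fun x y => by
        apply Subtype.ext; apply Subtype.ext
        simp
        abel
      map_smul' := fun c x => by
        apply Subtype.ext; apply Subtype.ext
        simp [smul_sub] }
  obtain ⟨F, hF⟩ := exists_extend_lattice L
    ((Algebra.linearMap ℤ ℚ) ∘ₗ f ∘ₗ r)
  have hν : ∀ x, B ((B.toDual hB).symm F) x = F x := fun x =>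
    LinearMap.BilinForm.apply_toDual_symm_apply (hB := hB) _ _
  refine ⟨(B.toDual hB).symm F, fun y hy => ?_, fun i => ?_⟩
  · rw [hν, hF ⟨y, hy⟩]
    exact intCast_mem_one _
  · have hi : (i.1 : X) ∈ L := i.2
    rw [hν, hF ⟨_, hi⟩]
    have h0 : g.rangeRestrict ⟨_, hi⟩ = 0 :=
      Subtype.ext ((Submodule.Quotient.mk_eq_zero S).2 i.1.2)
    have h1 : r ⟨_, hi⟩ = i := by
      apply Subtype.ext; apply Subtype.ext
      change (i.1 : X) - (σ (g.rangeRestrict ⟨_, hi⟩) : L) = i.1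
      rw [h0]; simp
    change ((f (r ⟨_, hi⟩) : ℤ) : ℚ) = f i
    rw [h1]

theorem isLattice_comap_subtype [FiniteDimensional ℚ X] (L : Submodule ℤ X) [hL : L.IsLattice ℚ]
    (S : Submodule ℚ X) : (L.comap (S.subtype.restrictScalars ℤ)).IsLattice ℚ := by
  have : IsNoetherian ℤ L := isNoetherian_of_isNoetherianRing_of_finite ℤ L
  constructor
  · refine Submodule.fg_of_fg_map_injective (S.subtype.restrictScalars ℤ)
      Subtype.val_injective ?_
    exact isNoetherian_submodule.1 this _ (Submodule.map_comap_le _ _)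
  · rw [eq_top_iff]
    rintro x -
    obtain ⟨n, hn, hx⟩ := exists_zsmul_mem_lattice L x.1
    have h : x = (n : ℚ)⁻¹ • (n • x) := by
      rw [← Int.cast_smul_eq_zsmul ℚ, inv_smul_smul₀ (by exact_mod_cast hn)]
    rw [h]
    exact Submodule.smul_mem _ _ (Submodule.subset_span hx)

/-- An automorphism of positive determinant that preserves a lattice has determinant `1`. -/
theorem det_of_preserves_lattice (L : Submodule ℤ X) [L.IsLattice ℚ]
    (g : GeneralLinearGroup ℚ X) (hg : ∀ x, g.1 x ∈ L ↔ x ∈ L) (hpos : 0 < LinearMap.det g.1) :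
    LinearMap.det g.1 = 1 := by
  classical
  obtain ⟨n, b, hb⟩ := exists_basis_span_eq L
  -- In a lattice basis the matrix is integral. Applied to both `g` and its inverse, this makes the
  -- determinant a unit of ℤ.
  have key : ∀ h : X →ₗ[ℚ] X, (∀ x ∈ L, h x ∈ L) → ∃ m : ℤ, LinearMap.det h = m := by
    intro h hh
    have h1 : ∀ i j, ∃ m : ℤ, LinearMap.toMatrix b b h i j = m := fun i j => by
      have h2 : h (b j) ∈ Submodule.span ℤ (Set.range b) := by
        rw [hb]
        exact hh _ (hb ▸ Submodule.subset_span ⟨j, rfl⟩)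
      obtain ⟨m, hm⟩ := (b.mem_span_iff_repr_mem ℤ _).1 h2 i
      exact ⟨m, by rw [LinearMap.toMatrix_apply, ← hm]; rfl⟩
    choose m hm using h1
    refine ⟨(Matrix.of m).det, ?_⟩
    rw [← LinearMap.det_toMatrix b, Int.cast_det]
    congr 1
    ext i j
    rw [hm]
    rfl
  obtain ⟨m, hm⟩ := key g.1 fun x hx => (hg x).2 hx
  obtain ⟨k, hk⟩ := key g⁻¹.1 fun x hx => by
    rw [← hg, ← Module.End.mul_apply, Units.mul_inv]
    exact hx
  have h1 : LinearMap.det (g.1 * g⁻¹.1) = 1 := by rw [Units.mul_inv, map_one]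
  rw [map_mul, hm, hk] at h1
  have h2 : m * k = 1 := by exact_mod_cast h1
  rw [hm] at hpos ⊢
  have h3 : 0 < m := by exact_mod_cast hpos
  rcases Int.eq_one_or_neg_one_of_mul_eq_one h2 with h | h
  · exact_mod_cast h
  · omega

end Lattice

/-! ### Identity components of real linear groups -/

section IdentityComponent

variable {X Y : Type*} [AddCommGroup X] [Module ℝ X] [Module.Finite ℝ X]
  [AddCommGroup Y] [Module ℝ Y] [Module.Finite ℝ Y]

theorem identityComponent_le (G : Subgroup (GeneralLinearGroup ℝ X)) :
    identityComponent G ≤ G := by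
  rintro _ ⟨x, _, rfl⟩
  exact x.2

/-- A homomorphism between groups of automorphisms that is given by an affine map between the
endomorphism rings preserves the identity components. -/
theorem map_mem_identityComponent {G : Subgroup (GeneralLinearGroup ℝ X)}
    {H : Subgroup (GeneralLinearGroup ℝ Y)} (F : G →* H)
    (Φ : Module.End ℝ X →ₗ[ℝ] Module.End ℝ Y) (c : Module.End ℝ Y)
    (hF : ∀ g : G, (F g).1.1 = Φ g.1.1 + c) (g : G) (hg : g.1 ∈ identityComponent G) :
    (F g).1 ∈ identityComponent H := by
  let _ : TopologicalSpace (Module.End ℝ X) := moduleTopology ℝ (Module.End ℝ X)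
  have : IsModuleTopology ℝ (Module.End ℝ X) := ⟨rfl⟩
  have : IsTopologicalRing (Module.End ℝ X) := IsModuleTopology.isTopologicalRing ℝ _
  let _ : TopologicalSpace (Module.End ℝ Y) := moduleTopology ℝ (Module.End ℝ Y)
  have : IsModuleTopology ℝ (Module.End ℝ Y) := ⟨rfl⟩
  have : IsTopologicalRing (Module.End ℝ Y) := IsModuleTopology.isTopologicalRing ℝ _
  have : ContinuousSMul ℝ (Module.End ℝ Y) := IsModuleTopology.toContinuousSMul ℝ _
  have hΦ : Continuous Φ := IsModuleTopology.continuous_of_linearMap Φ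
  have h1 : Continuous fun g : G => (F g).1.1 := by
    simp_rw [hF]
    exact (hΦ.comp (Units.continuous_val.comp continuous_subtype_val)).add continuous_const
  have hc : Continuous F := by
    refine Continuous.subtype_mk (Units.continuous_iff.2 ⟨h1, ?_⟩) _
    -- The unit topology also asks for continuity of inverses; this reduces to continuity of
    -- inversion in `G`.
    have h2 : ∀ g : G, ((F g).1⁻¹).1 = (F g⁻¹).1.1 := fun g => by rw [map_inv]; rfl
    simp_rw [h2]
    exact h1.comp continuous_inv
  obtain ⟨x, hx, hxg⟩ := hg
  obtain rfl : x = g := Subtype.ext hxg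
  refine ⟨F x, ?_, rfl⟩
  have h3 := hc.image_connectedComponent_subset 1 ⟨x, hx, rfl⟩
  rwa [map_one] at h3

/-- A path through the identity stays in the identity component. -/
theorem path_mem_identityComponent {G : Subgroup (GeneralLinearGroup ℝ X)}
    (F : ℝ → GeneralLinearGroup ℝ X) (hG : ∀ r, F r ∈ G) (a b : Module.End ℝ X)
    (hF : ∀ r, (F r).1 = 1 + r • a + r ^ 2 • b) (hinv : ∀ r, (F r)⁻¹ = F (-r)) (r : ℝ) :
    F r ∈ identityComponent G := by
  let _ : TopologicalSpace (Module.End ℝ X) := moduleTopology ℝ (Module.End ℝ X)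
  have : IsModuleTopology ℝ (Module.End ℝ X) := ⟨rfl⟩
  have : IsTopologicalRing (Module.End ℝ X) := IsModuleTopology.isTopologicalRing ℝ _
  have : ContinuousSMul ℝ (Module.End ℝ X) := IsModuleTopology.toContinuousSMul ℝ _
  have h1 : Continuous fun r => (F r).1 := by
    simp_rw [hF]
    fun_prop
  have hc : Continuous F := by
    refine Units.continuous_iff.2 ⟨h1, ?_⟩
    simp_rw [hinv]
    exact h1.comp continuous_neg
  let F' : ℝ → G := fun r => ⟨F r, hG r⟩
  have hc' : Continuous F' := hc.subtype_mk _
  have h0 : F' 0 = 1 := by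
    apply Subtype.ext; apply Units.ext
    change (F 0).1 = 1
    simp [hF]
  refine ⟨F' r, ?_, rfl⟩
  have h3 := hc'.image_connectedComponent_subset 0 ⟨r, by simp, rfl⟩
  rwa [h0] at h3

/-- The determinant is continuous and has no zero on a connected set where it takes the value 1, so
by the intermediate value theorem it stays positive. The map `Φ` will be the compression of
endomorphisms to U. -/
theorem det_pos_of_mem_identityComponent {G : Subgroup (GeneralLinearGroup ℝ X)}
    (Φ : Module.End ℝ X →ₗ[ℝ] Module.End ℝ Y) (h1 : Φ 1 = 1)
    (hG : ∀ g ∈ G, LinearMap.det (Φ g.1) ≠ 0) {g : GeneralLinearGroup ℝ X}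
    (hg : g ∈ identityComponent G) : 0 < LinearMap.det (Φ g.1) := by
  classical
  let _ : TopologicalSpace (Module.End ℝ X) := moduleTopology ℝ (Module.End ℝ X)
  have : IsModuleTopology ℝ (Module.End ℝ X) := ⟨rfl⟩
  have : IsTopologicalRing (Module.End ℝ X) := IsModuleTopology.isTopologicalRing ℝ _
  obtain ⟨x, hx, rfl⟩ := hg
  let b := Module.finBasis ℝ Y
  let Ψ : Module.End ℝ X →ₗ[ℝ] Matrix _ _ ℝ := (LinearMap.toMatrix b b).toLinearMap ∘ₗ Φ
  have hΨ : Continuous Ψ := IsModuleTopology.continuous_of_linearMap Ψ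
  have hc : Continuous fun g : G => LinearMap.det (Φ g.1.1) := by
    have : ∀ g : G, LinearMap.det (Φ g.1.1) = (Ψ g.1.1).det := fun g =>
      (LinearMap.det_toMatrix b _).symm
    simp_rw [this]
    exact (hΨ.comp (Units.continuous_val.comp continuous_subtype_val)).matrix_det
  have hpre : IsPreconnected ((fun g : G => LinearMap.det (Φ g.1.1)) ''
      connectedComponent (1 : G)) :=
    isPreconnected_connectedComponent.image _ hc.continuousOn
  by_contra hneg
  have hone : (1 : ℝ) ∈ (fun g : G => LinearMap.det (Φ g.1.1)) '' connectedComponent (1 : G) :=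
    ⟨1, mem_connectedComponent, by
      change LinearMap.det (Φ 1) = 1
      rw [h1, map_one]⟩
  obtain ⟨y, -, hy⟩ := hpre.ordConnected.out ⟨x, hx, rfl⟩ hone ⟨not_lt.1 hneg, zero_le_one⟩
  exact hG y.1 y.2 hy

/-- A unipotent element of index three of a parabolic group lies in the identity component. -/
theorem unipotent_mem_identityComponent {B : BilinForm ℝ X} {U : Submodule ℝ X}
    {g : GeneralLinearGroup ℝ X} (hg : g ∈ parabolic B U)
    (h3 : (g.1 - 1) * (g.1 - 1) * (g.1 - 1) = 0) : g ∈ identityComponent (parabolic B U) := by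
  set N : Module.End ℝ X := g.1 - 1 with hN
  have hN3 : ∀ x, N (N (N x)) = 0 := fun x => LinearMap.congr_fun h3 x
  have hgN : ∀ x, g.1 x = x + N x := fun x => by simp [hN]
  have hskN : ∀ x y, B (N x) y + B x (N y) + B (N x) (N y) = 0 := fun x y => by
    have h := hg.1 x y
    rw [hgN, hgN] at h
    simp only [map_add, LinearMap.add_apply] at h
    linarith
  -- `Z` is log(1 + N), with the series cut off because N³ = 0. It is skew for B since `g` is an
  -- isometry, and `E r` = exp(rZ) joins 1 to `g` inside the parabolic group.
  let Z : Module.End ℝ X := N - (2⁻¹ : ℝ) • (N * N)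
  have hZ : ∀ x, Z x = N x - (2⁻¹ : ℝ) • N (N x) := fun x => rfl
  have hZZ : ∀ x, Z (Z x) = N (N x) := fun x => by
    simp [hZ, hN3]
  have hZ3 : ∀ x, Z (Z (Z x)) = 0 := fun x => by
    rw [hZZ, hZ]; simp [hN3]
  have hskZ : ∀ x y, B (Z x) y = - B x (Z y) := fun x y => by
    have e1 := hskN x y
    have e2 := hskN (N x) y
    have e3 := hskN x (N y)
    have e4 := hskN (N x) (N y)
    -- Gives B(N²x, N²y) = 0, the term that the other four identities leave over.
    have e5 := hskN (N x) (N (N y))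
    simp only [hN3, map_zero] at e5
    simp only [hZ, map_sub, map_smul, LinearMap.sub_apply, LinearMap.smul_apply, smul_eq_mul]
    linarith
  let E : ℝ → Module.End ℝ X := fun r => 1 + r • Z + r ^ 2 • ((2⁻¹ : ℝ) • (Z * Z))
  have hE : ∀ r x, E r x = x + r • Z x + (r ^ 2 * 2⁻¹) • Z (Z x) := fun r x => by
    simp [E, smul_smul]
  have hEE : ∀ r, E r * E (-r) = 1 := fun r => by
    refine LinearMap.ext fun x => ?_
    rw [Module.End.mul_apply, hE, hE]
    simp only [map_add, map_smul, hZ3, smul_zero, add_zero, Module.End.one_apply]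
    module
  have hEB : ∀ r x y, B (E r x) (E r y) = B x y := fun r x y => by
    have e1 := hskZ x y
    have e2 := hskZ (Z x) y
    have e3 := hskZ x (Z y)
    have e4 := hskZ (Z x) (Z y)
    have e5 := hskZ (Z x) (Z (Z y))
    simp only [hZ3, map_zero, neg_zero] at e5
    simp only [hE, map_add, map_smul, LinearMap.add_apply, LinearMap.smul_apply, smul_eq_mul,
      e5, e4, e2, e1, e3]
    ring
  have hNU : ∀ x ∈ U, N x ∈ U := fun x hx => by
    simpa [hN] using sub_mem ((hg.2 x).2 hx) hx
  have hZU : ∀ x ∈ U, Z x ∈ U := fun x hx =>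
    sub_mem (hNU x hx) (U.smul_mem _ (hNU _ (hNU x hx)))
  have hEU : ∀ r, ∀ x ∈ U, E r x ∈ U := fun r x hx => by
    rw [hE]
    exact add_mem (add_mem hx (U.smul_mem _ (hZU x hx))) (U.smul_mem _ (hZU _ (hZU x hx)))
  let F : ℝ → GeneralLinearGroup ℝ X := fun r =>
    ⟨E r, E (-r), hEE r, by have h := hEE (-r); rwa [neg_neg] at h⟩
  have hF1 : F 1 = g := Units.ext <| LinearMap.ext fun x => by
    change E 1 x = g.1 x
    rw [hE, hgN, hZZ, hZ]
    module
  rw [← hF1]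
  refine path_mem_identityComponent (G := parabolic B U) F
    (fun r => ⟨hEB r, fun x => ⟨fun hx => ?_, hEU r x⟩⟩) _ _
    (fun r => rfl) (fun r => Units.ext rfl) 1
  have h := hEU (-r) _ hx
  have h' := LinearMap.congr_fun (hEE (-r)) x
  rw [neg_neg] at h'
  change E (-r) (E r x) = x at h'
  rwa [h'] at h

end IdentityComponent

/-! ### Extension of scalars to ℝ -/

section BaseChange

variable {X Y : Type*} [AddCommGroup X] [Module ℚ X] [AddCommGroup Y] [Module ℚ Y]

theorem baseChange_bilin_ext {β β' : (ℝ ⊗[ℚ] X) →ₗ[ℝ] (ℝ ⊗[ℚ] Y) →ₗ[ℝ] ℝ}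
    (h : ∀ x y, β (1 ⊗ₜ x) (1 ⊗ₜ y) = β' (1 ⊗ₜ x) (1 ⊗ₜ y)) : β = β' := by
  refine LinearMap.ext fun a => LinearMap.ext fun b => ?_
  induction a using TensorProduct.induction_on with
  | zero => simp
  | add a a' ha ha' => simp only [map_add, LinearMap.add_apply, ha, ha']
  | tmul r x =>
    induction b using TensorProduct.induction_on with
    | zero => simp
    | add b b' hb hb' => simp only [map_add, hb, hb']
    | tmul t y =>
      have e1 : r ⊗ₜ[ℚ] x = r • (1 : ℝ) ⊗ₜ[ℚ] x := by rw [TensorProduct.smul_tmul']; simp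
      have e2 : t ⊗ₜ[ℚ] y = t • (1 : ℝ) ⊗ₜ[ℚ] y := by rw [TensorProduct.smul_tmul']; simp
      rw [e1, e2]
      simp only [map_smul, LinearMap.smul_apply, h]

theorem baseChange_adjoint {B : BilinForm ℚ X} {B' : BilinForm ℚ Y} (f : Y →ₗ[ℚ] X)
    (g : X →ₗ[ℚ] Y) (h : ∀ y x, B (f y) x = B' y (g x)) (y : ℝ ⊗[ℚ] Y) (x : ℝ ⊗[ℚ] X) :
    B.baseChange ℝ (f.baseChange ℝ y) x = B'.baseChange ℝ y (g.baseChange ℝ x) := by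
  have := baseChange_bilin_ext (β := B.baseChange ℝ ∘ₗ f.baseChange ℝ)
    (β' := (B'.baseChange ℝ).compl₂ (g.baseChange ℝ)) (fun y x => by simp [h])
  exact LinearMap.congr_fun (LinearMap.congr_fun this y) x

theorem baseChange_isometry {B : BilinForm ℚ X} (f : X →ₗ[ℚ] X)
    (h : ∀ x y, B (f x) (f y) = B x y) (x y : ℝ ⊗[ℚ] X) :
    B.baseChange ℝ (f.baseChange ℝ x) (f.baseChange ℝ y) = B.baseChange ℝ x y := by
  have := baseChange_bilin_ext (β := (B.baseChange ℝ).compl₁₂ (f.baseChange ℝ) (f.baseChange ℝ))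
    (β' := B.baseChange ℝ) (fun y x => by simp [h])
  exact LinearMap.congr_fun (LinearMap.congr_fun this x) y

theorem baseChange_symm {B : BilinForm ℚ X} (hs : B.IsSymm) (x y : ℝ ⊗[ℚ] X) :
    B.baseChange ℝ x y = B.baseChange ℝ y x := by
  have := baseChange_bilin_ext (β := B.baseChange ℝ) (β' := (B.baseChange ℝ).flip)
    (fun x y => by simp [hs.eq x y])
  exact LinearMap.congr_fun (LinearMap.congr_fun this x) y

theorem realGL_mem_orthogonalGroup {B : BilinForm ℚ X} {g : GeneralLinearGroup ℚ X}
    (hg : g ∈ orthogonalGroup B) : realGL X g ∈ orthogonalGroup (B.baseChange ℝ) :=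
  baseChange_isometry g.1 hg

theorem baseChange_mem_baseChange {U : Submodule ℚ X} {U' : Submodule ℚ Y} (f : X →ₗ[ℚ] Y)
    (h : ∀ x ∈ U, f x ∈ U') {x : ℝ ⊗[ℚ] X} (hx : x ∈ U.baseChange ℝ) :
    f.baseChange ℝ x ∈ U'.baseChange ℝ := by
  obtain ⟨y, rfl⟩ := hx
  have e : f ∘ₗ U.subtype = U'.subtype ∘ₗ f.restrict h := rfl
  rw [← LinearMap.comp_apply, ← LinearMap.baseChange_comp, e, LinearMap.baseChange_comp]
  exact ⟨_, rfl⟩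

theorem baseChange_mem_of_range_le {U' : Submodule ℚ Y} (f : X →ₗ[ℚ] Y)
    (h : ∀ x, f x ∈ U') (x : ℝ ⊗[ℚ] X) : f.baseChange ℝ x ∈ U'.baseChange ℝ :=
  baseChange_mem_baseChange (U := ⊤) f (fun x _ => h x) (by simp)

theorem baseChange_eq_zero_of_mem {U : Submodule ℚ X} (f : X →ₗ[ℚ] Y)
    (h : ∀ x ∈ U, f x = 0) {x : ℝ ⊗[ℚ] X} (hx : x ∈ U.baseChange ℝ) :
    f.baseChange ℝ x = 0 := by
  simpa using baseChange_mem_baseChange (U' := ⊥) f (by simpa using h) hx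

theorem realGL_mem_parabolic {B : BilinForm ℚ X} {U : Submodule ℚ X} {g : GeneralLinearGroup ℚ X}
    (hg : g ∈ parabolic B U) : realGL X g ∈ parabolic (B.baseChange ℝ) (U.baseChange ℝ) := by
  refine ⟨realGL_mem_orthogonalGroup hg.1, fun x => ⟨fun hx => ?_, fun hx => ?_⟩⟩
  · have h := baseChange_mem_baseChange (U' := U) (g⁻¹).1
      (fun x hx => ((inv_mem hg).2 x).2 hx) hx
    change (realGL X g⁻¹).1 ((realGL X g).1 x) ∈ _ at h
    rwa [← Module.End.mul_apply, ← Units.val_mul, ← map_mul, inv_mul_cancel, map_one] at h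
  · exact baseChange_mem_baseChange (U' := U) g.1 (fun x hx => (hg.2 x).2 hx) hx

end BaseChange

/-! ### Rational elements of real identity components -/

section Plus

variable {X : Type*} [AddCommGroup X] [Module ℚ X] [FiniteDimensional ℚ X]

/-- Continuity of the inclusion of the real parabolic group in the orthogonal group. It makes the
SO⁺ condition in Γ_{L,I} redundant. -/
theorem parabolicPlus_le_specialOrthPlus (B : BilinForm ℚ X) (U : Submodule ℚ X) :
    parabolicPlus B U ≤ specialOrthPlus B := fun g hg => by
  let G := parabolic (B.baseChange ℝ) (U.baseChange ℝ)
  let F : G →* orthogonalGroup (B.baseChange ℝ) := Subgroup.inclusion fun _ h => h.1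
  exact map_mem_identityComponent F LinearMap.id 0 (fun g => by simp [F])
    ⟨_, identityComponent_le _ hg⟩ hg

theorem unipotent_mem_parabolicPlus {B : BilinForm ℚ X} {U : Submodule ℚ X}
    {g : GeneralLinearGroup ℚ X} (hg : g ∈ parabolic B U)
    (h3 : (g.1 - 1) * (g.1 - 1) * (g.1 - 1) = 0) : g ∈ parabolicPlus B U := by
  refine unipotent_mem_identityComponent (realGL_mem_parabolic hg) ?_
  have h := congrArg (Module.End.baseChangeHom ℚ ℝ X) h3
  simp only [map_mul, map_sub, map_one, map_zero] at h
  exact h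

/-- Compression by a retraction `π` onto U is linear on all endomorphisms. On the parabolic group it
is restriction to U_ℝ, hence invertible, so the previous positivity argument applies. -/
theorem det_pos_of_mem_parabolicPlus {B : BilinForm ℚ X} {U : Submodule ℚ X}
    {g : GeneralLinearGroup ℚ X} (hg : g ∈ parabolicPlus B U) (M : Module.End ℚ U)
    (hM : ∀ u : U, (M u : X) = g.1 u) : 0 < LinearMap.det M := by
  obtain ⟨π, hπ⟩ := U.subtype.exists_leftInverse_of_injective U.ker_subtype
  have hπi : ∀ x, π.baseChange ℝ (U.subtype.baseChange ℝ x) = x := fun x => by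
    rw [← LinearMap.comp_apply, ← LinearMap.baseChange_comp, hπ, LinearMap.baseChange_id]
    rfl
  have hiπ : ∀ x ∈ U.baseChange ℝ, U.subtype.baseChange ℝ (π.baseChange ℝ x) = x := by
    rintro _ ⟨y, rfl⟩
    rw [hπi]
  let Φ : Module.End ℝ (ℝ ⊗[ℚ] X) →ₗ[ℝ] Module.End ℝ (ℝ ⊗[ℚ] U) :=
    (LinearMap.compRight ℝ (π.baseChange ℝ)) ∘ₗ (LinearMap.lcomp ℝ _ (U.subtype.baseChange ℝ))
  have hΦ : ∀ a x, Φ a x = π.baseChange ℝ (a (U.subtype.baseChange ℝ x)) := fun _ _ => rfl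
  have h := det_pos_of_mem_identityComponent Φ (LinearMap.ext fun x => hπi x)
    (fun a ha => by
      have h1 : Φ a.1 * Φ (a⁻¹).1 = 1 := LinearMap.ext fun x => by
        have h2 : (a⁻¹).1 (U.subtype.baseChange ℝ x) ∈ U.baseChange ℝ :=
          ((inv_mem ha).2 _).2 ⟨x, rfl⟩
        rw [Module.End.mul_apply, hΦ, hΦ, hiπ _ h2, ← Module.End.mul_apply, Units.mul_inv]
        exact hπi x
      intro h0
      have h2 := congrArg LinearMap.det h1
      rw [map_mul, h0, zero_mul, map_one] at h2
      exact zero_ne_one h2) hg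
  have e : Φ (realGL X g).1 = M.baseChange ℝ := by
    have e1 : M = π ∘ₗ g.1 ∘ₗ U.subtype := LinearMap.ext fun u => by
      change M u = π (g.1 u)
      rw [← hM]
      exact (LinearMap.congr_fun hπ (M u)).symm
    rw [e1, LinearMap.baseChange_comp, LinearMap.baseChange_comp]
    rfl
  rw [e, LinearMap.det_baseChange] at h
  simpa using h

end Plus

/-! ### Passing between X and a subquotient U^⊥/U -/

section Splitting

variable {X Y : Type*} [AddCommGroup X] [Module ℚ X] [AddCommGroup Y] [Module ℚ Y]

/-- A presentation of the quadratic space `Y` as a subquotient `U^⊥ / U` of `X`, by an isometric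
embedding `s` and its adjoint `p`. -/
structure SubquotientSplitting (B : BilinForm ℚ X) (U : Submodule ℚ X) (B' : BilinForm ℚ Y)
    (s : Y →ₗ[ℚ] X) (p : X →ₗ[ℚ] Y) : Prop where
  adjoint : ∀ y x, B (s y) x = B' y (p x)
  leftInv : ∀ y, p (s y) = y
  map_zero : ∀ u ∈ U, p u = 0
  -- The sum is the component of `x` in a complement of U^⊥. Finitely many rational vectors describe
  -- it, so the statement survives base change.
  sub_mem : ∃ (n : ℕ) (u t : Fin n → X), (∀ i, u i ∈ U) ∧
    ∀ x, x - s (p x) - ∑ i, B x (u i) • t i ∈ U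

namespace SubquotientSplitting

variable {B : BilinForm ℚ X} {U : Submodule ℚ X} {B' : BilinForm ℚ Y} {s : Y →ₗ[ℚ] X}
  {p : X →ₗ[ℚ] Y}

theorem real_leftInv (S : SubquotientSplitting B U B' s p) (y : ℝ ⊗[ℚ] Y) :
    p.baseChange ℝ (s.baseChange ℝ y) = y := by
  have h : p ∘ₗ s = LinearMap.id := LinearMap.ext S.leftInv
  rw [← LinearMap.comp_apply, ← LinearMap.baseChange_comp, h, LinearMap.baseChange_id]
  rfl

/-- The operator id - s p - q has values in U, and keeps them in U_ℝ after base change; `q` involves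
only pairings with U, so it vanishes on `x`. -/
theorem real_sub_mem (S : SubquotientSplitting B U B' s p)
    {x : ℝ ⊗[ℚ] X} (hx : ∀ u ∈ U.baseChange ℝ, B.baseChange ℝ x u = 0) :
    x - s.baseChange ℝ (p.baseChange ℝ x) ∈ U.baseChange ℝ := by
  obtain ⟨n, u, t, hu, h⟩ := S.sub_mem
  let q : X →ₗ[ℚ] X := ∑ i, (B.flip (u i)).smulRight (t i)
  have h1 := baseChange_mem_of_range_le (U' := U) (LinearMap.id - s ∘ₗ p - q)
    (fun x => by simpa [q] using h x) x
  have h2 : ∀ x, q.baseChange ℝ x = ∑ i, B.baseChange ℝ x (1 ⊗ₜ u i) • (1 : ℝ) ⊗ₜ[ℚ] t i := by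
    intro x
    induction x using TensorProduct.induction_on with
    | zero => simp
    | add x y hx hy =>
      simp only [map_add, hx, hy, LinearMap.add_apply, add_smul, Finset.sum_add_distrib]
    | tmul r x =>
      simp only [LinearMap.baseChange_tmul, q, LinearMap.sum_apply, TensorProduct.tmul_sum]
      refine Finset.sum_congr rfl fun i _ => ?_
      rw [LinearMap.BilinForm.baseChange_tmul, LinearMap.smulRight_apply, ← TensorProduct.smul_tmul,
        TensorProduct.smul_tmul']
      simp
  have h3 : q.baseChange ℝ x = 0 := by
    rw [h2]
    refine Finset.sum_eq_zero fun i _ => ?_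
    rw [hx _ (Submodule.tmul_mem_baseChange_of_mem _ (hu i)), zero_smul]
  rw [LinearMap.baseChange_sub, LinearMap.baseChange_sub, LinearMap.baseChange_id,
    LinearMap.baseChange_comp] at h1
  simpa [h3] using h1

/-- The action of the real parabolic group on the subquotient is a ↦ p a s. This is linear in `a`,
hence continuous, and maps identity component to identity component. -/
theorem quotient_mem_specialOrthPlus [FiniteDimensional ℚ X]
    [FiniteDimensional ℚ Y] (S : SubquotientSplitting B U B' s p) (hs : B.IsSymm)
    {g : GeneralLinearGroup ℚ X}
    (hg : g ∈ parabolicPlus B U) (γ : GeneralLinearGroup ℚ Y)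
    (hγ : ∀ y, γ.1 y = p (g.1 (s y))) : γ ∈ specialOrthPlus B' := by
  let G := parabolic (B.baseChange ℝ) (U.baseChange ℝ)
  let sR := s.baseChange ℝ
  let pR := p.baseChange ℝ
  have adj := baseChange_adjoint s p S.adjoint
  have hsymm := baseChange_symm hs
  have hperp : ∀ (a : G) (y : ℝ ⊗[ℚ] Y), ∀ u ∈ U.baseChange ℝ,
      B.baseChange ℝ (a.1.1 (sR y)) u = 0 := fun a y u hu => by
    have h1 := a.2.1 (sR y) (a⁻¹.1.1 u)
    have h2 : a.1.1 (a⁻¹.1.1 u) = u := by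
      change (a.1.1 * (a.1⁻¹).1) u = u
      rw [Units.mul_inv]; rfl
    rw [h2] at h1
    have h3 : a⁻¹.1.1 u ∈ U.baseChange ℝ := (a⁻¹.2.2 u).2 hu
    rw [h1, adj, baseChange_eq_zero_of_mem p S.map_zero h3, _root_.map_zero]
  have hmem : ∀ (a : G) (y : ℝ ⊗[ℚ] Y),
      a.1.1 (sR y) - sR (pR (a.1.1 (sR y))) ∈ U.baseChange ℝ := fun a y =>
    S.real_sub_mem (hperp a y)
  let F₀ : G →* Module.End ℝ (ℝ ⊗[ℚ] Y) :=
    { toFun := fun a => pR ∘ₗ a.1.1 ∘ₗ sR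
      map_one' := LinearMap.ext fun y => S.real_leftInv y
      map_mul' := fun a b => LinearMap.ext fun y => by
        change pR (a.1.1 (b.1.1 (sR y))) = pR (a.1.1 (sR (pR (b.1.1 (sR y)))))
        -- Multiplicativity: `b (s y)` and its projection to the image of `s` differ by an element
        -- of U_ℝ, which `a` preserves and `p` kills.
        rw [← sub_eq_zero, ← map_sub, ← map_sub]
        exact baseChange_eq_zero_of_mem p S.map_zero ((a.2.2 _).2 (hmem b y)) }
  let F : G →* orthogonalGroup (B'.baseChange ℝ) :=
    F₀.toHomUnits.codRestrict _ fun a x y => by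
      change B'.baseChange ℝ (pR (a.1.1 (sR x))) (pR (a.1.1 (sR y))) = _
      have h1 := hperp a y _ (hmem a x)
      rw [hsymm] at h1
      simp only [map_sub, LinearMap.sub_apply] at h1
      rw [← adj, ← sub_eq_zero.1 h1, a.2.1, adj, S.real_leftInv]
  let Φ : Module.End ℝ (ℝ ⊗[ℚ] X) →ₗ[ℝ] Module.End ℝ (ℝ ⊗[ℚ] Y) :=
    (LinearMap.compRight ℝ pR) ∘ₗ (LinearMap.lcomp ℝ _ sR)
  have h := map_mem_identityComponent F Φ 0 (fun a => by rw [add_zero]; rfl)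
    ⟨_, identityComponent_le _ hg⟩ hg
  have e : realGL Y γ = (F ⟨_, identityComponent_le _ hg⟩).1 := by
    apply Units.ext
    change γ.1.baseChange ℝ = pR ∘ₗ g.1.baseChange ℝ ∘ₗ sR
    have e1 : γ.1 = p ∘ₗ g.1 ∘ₗ s := LinearMap.ext hγ
    rw [e1, LinearMap.baseChange_comp, LinearMap.baseChange_comp]
  change realGL Y γ ∈ identityComponent (orthogonalGroup (B'.baseChange ℝ))
  rw [e]
  exact h

/-- The orthogonal group of Y_ℝ acts on X_ℝ through the block a ↦ s a p + (1 - s p), the identity on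
ker p. The formula is affine in `a`, so this homomorphism is continuous. -/
theorem lift_mem_parabolicPlus [FiniteDimensional ℚ X]
    [FiniteDimensional ℚ Y] (S : SubquotientSplitting B U B' s p) (hs : B.IsSymm)
    {γ : GeneralLinearGroup ℚ Y}
    (hγ : γ ∈ specialOrthPlus B') (g : GeneralLinearGroup ℚ X)
    (hg : ∀ x, g.1 x = x + s (γ.1 (p x) - p x)) : g ∈ parabolicPlus B U := by
  let G := orthogonalGroup (B'.baseChange ℝ)
  let sR := s.baseChange ℝ
  let pR := p.baseChange ℝ
  have adj := baseChange_adjoint s p S.adjoint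
  have hsymm := baseChange_symm hs
  have adj' : ∀ x y, B.baseChange ℝ x (sR y) = B'.baseChange ℝ y (pR x) := fun x y => by
    rw [← adj]; exact hsymm _ _
  have hps : ∀ y, pR (sR y) = y := S.real_leftInv
  have adjs : ∀ y x, B.baseChange ℝ (sR y) x = B'.baseChange ℝ y (pR x) := adj
  have symm' : ∀ x y, B'.baseChange ℝ x y = B'.baseChange ℝ y x := fun x y => by
    have h := adj' (sR y) x
    rwa [adjs, hps, hps, eq_comm] at h
  let Φ : Module.End ℝ (ℝ ⊗[ℚ] Y) →ₗ[ℝ] Module.End ℝ (ℝ ⊗[ℚ] X) :=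
    (LinearMap.compRight ℝ sR) ∘ₗ (LinearMap.lcomp ℝ _ pR)
  let F₀ : G →* Module.End ℝ (ℝ ⊗[ℚ] X) :=
    { toFun := fun a => Φ a.1.1 + (1 - sR ∘ₗ pR)
      map_one' := LinearMap.ext fun y => by
        change sR (pR y) + (y - sR (pR y)) = y
        abel
      map_mul' := fun a b => LinearMap.ext fun y => by
        change sR (a.1.1 (b.1.1 (pR y))) + (y - sR (pR y)) =
          sR (a.1.1 (pR (sR (b.1.1 (pR y)) + (y - sR (pR y))))) +
            (sR (b.1.1 (pR y)) + (y - sR (pR y)) - sR (pR (sR (b.1.1 (pR y)) + (y - sR (pR y)))))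
        simp only [map_add, map_sub, hps]
        abel }
  have hF₀ : ∀ a x, F₀ a x = sR (a.1.1 (pR x)) + (x - sR (pR x)) := fun _ _ => rfl
  have hU : ∀ a, ∀ x ∈ U.baseChange ℝ, F₀ a x = x := fun a x hx => by
    have h0 : pR x = 0 := baseChange_eq_zero_of_mem p S.map_zero hx
    rw [hF₀, h0]
    simp
  let F : G →* parabolic (B.baseChange ℝ) (U.baseChange ℝ) :=
    F₀.toHomUnits.codRestrict _ fun a => by
      refine ⟨fun x y => ?_, fun x => ⟨fun hx => ?_, fun hx => ?_⟩⟩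
      · change B.baseChange ℝ (F₀ a x) (F₀ a y) = _
        simp only [hF₀, map_add, map_sub, LinearMap.add_apply, LinearMap.sub_apply, adjs, adj', hps]
        linarith [a.2 (pR x) (pR y), symm' (a.1.1 (pR y)) (a.1.1 (pR x)),
          symm' (pR x) (a.1.1 (pR y)), symm' (pR x) (pR y)]
      · have h := hU a⁻¹ _ hx
        change F₀ a⁻¹ (F₀ a x) = F₀ a x at h
        rw [← Module.End.mul_apply, ← map_mul, inv_mul_cancel, map_one] at h
        change F₀ a x ∈ _ at hx
        rw [← h] at hx
        exact hx
      · change F₀ a x ∈ _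
        rwa [hU a x hx]
  have h := map_mem_identityComponent F Φ _ (fun a => rfl) ⟨_, identityComponent_le _ hγ⟩ hγ
  have e : realGL X g = (F ⟨_, identityComponent_le _ hγ⟩).1 := by
    apply Units.ext
    change g.1.baseChange ℝ = sR ∘ₗ γ.1.baseChange ℝ ∘ₗ pR + (1 - sR ∘ₗ pR)
    have e1 : g.1 = s ∘ₗ γ.1 ∘ₗ p + (LinearMap.id - s ∘ₗ p) := LinearMap.ext fun x => by
      rw [hg]
      simp only [map_sub, LinearMap.add_apply, LinearMap.comp_apply, LinearMap.sub_apply,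
        LinearMap.id_apply]
      abel
    rw [e1, LinearMap.baseChange_add, LinearMap.baseChange_sub, LinearMap.baseChange_comp,
      LinearMap.baseChange_comp, LinearMap.baseChange_comp, LinearMap.baseChange_id]
    rfl
  change realGL X g ∈ identityComponent (parabolic (B.baseChange ℝ) (U.baseChange ℝ))
  rw [e]
  exact h

end SubquotientSplitting

end Splitting

/-! ### Generation of the special linear group by transvections -/

section Transvections

variable {K X : Type*} [Field K] [AddCommGroup X] [Module K X]

/-- The transvection `x ↦ x + f x • u`, for `f u = 0`. -/
def transvectionGL (f : Module.Dual K X) (u : X) (h : f u = 0) : GeneralLinearGroup K X where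
  val := LinearMap.id + f.smulRight u
  inv := LinearMap.id - f.smulRight u
  val_inv := LinearMap.ext fun x => by simp [h]
  inv_val := LinearMap.ext fun x => by simp [h]

theorem transvectionGL_apply (f : Module.Dual K X) (u : X) (h : f u = 0) (x : X) :
    (transvectionGL f u h).1 x = x + f x • u := rfl

/-- The automorphisms of determinant one are generated by the transvections. -/
theorem mem_of_det_eq_one [FiniteDimensional K X] (G : Subgroup (GeneralLinearGroup K X))
    (hG : ∀ f u h, transvectionGL f u h ∈ G) (g : GeneralLinearGroup K X)
    (hg : LinearMap.det g.1 = 1) : g ∈ G := by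
  classical
  let b := Module.finBasis K X
  -- The matrix diag(a, a⁻¹) as w(a) w(-1), with w(a) = e_ij(a) e_ji(-a⁻¹) e_ij(a): six elementary
  -- factors.
  have hpair : ∀ i j, i ≠ j → ∀ a : K, a ≠ 0 → ∃ g ∈ G, ∀ l, g.1 (b l) =
      ((if l = i then a else 1) * (if l = j then a⁻¹ else 1)) • b l := by
    intro i j hij a ha
    have h1 : b.coord i (b i) = 1 := by simp
    have h2 : b.coord j (b j) = 1 := by simp
    have h3 : b.coord i (b j) = 0 := by simp [hij.symm]
    have h4 : b.coord j (b i) = 0 := by simp [hij]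
    have hv : ∀ c : K, b.coord i (c • b j) = 0 := fun c => by rw [map_smul, h3, smul_zero]
    have hu : ∀ c : K, b.coord j (c • b i) = 0 := fun c => by rw [map_smul, h4, smul_zero]
    refine ⟨_, mul_mem (hG _ _ (hu a)) (mul_mem (hG _ _ (hv (-a⁻¹))) (mul_mem (hG _ _ (hu a))
      (mul_mem (hG _ _ (hu (-1))) (mul_mem (hG _ _ (hv 1)) (hG _ _ (hu (-1))))))), fun l => ?_⟩
    simp only [Units.val_mul, Module.End.mul_apply, transvectionGL_apply, map_add, map_smul,
      h1, h2, h3, h4]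
    by_cases hli : l = i
    · subst hli
      simp only [h1, h4, if_true, if_neg hij]
      match_scalars <;> field_simp <;> ring
    · by_cases hlj : l = j
      · subst hlj
        simp only [h2, h3, if_true, if_neg hli]
        match_scalars <;> field_simp <;> ring
      · have h5 : b.coord i (b l) = 0 := by simp [hli]
        have h6 : b.coord j (b l) = 0 := by simp [hlj]
        simp [h5, h6, hli, hlj]
  -- Induction on the number of entries different from 1. As the product is 1, a nontrivial entry `D
  -- i` has a nontrivial partner `D j`, into which it is moved by `hpair`.
  have hdiag : ∀ (n : ℕ) (D : Fin (Module.finrank K X) → K), ∏ i, D i = 1 →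
      (Finset.univ.filter fun i => D i ≠ 1).card ≤ n → ∃ g ∈ G, ∀ l, g.1 (b l) = D l • b l := by
    intro n
    induction n with
    | zero =>
      intro D _ hcard
      refine ⟨1, one_mem _, fun l => ?_⟩
      have h := Finset.card_eq_zero.1 (Nat.le_zero.1 hcard)
      have hl : D l = 1 := by
        by_contra hne
        exact Finset.notMem_empty l (h ▸ Finset.mem_filter.2 ⟨Finset.mem_univ _, hne⟩)
      rw [hl, one_smul]; rfl
    | succ n ih =>
      intro D hD hcard
      by_cases hall : ∀ i, D i = 1
      · exact ⟨1, one_mem _, fun l => by rw [hall, one_smul]; rfl⟩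
      push Not at hall
      obtain ⟨i, hi⟩ := hall
      obtain ⟨j, hij, hj⟩ : ∃ j, j ≠ i ∧ D j ≠ 1 := by
        by_contra! hne
        rw [Finset.prod_eq_single i (fun j _ hj => hne j hj) (by simp)] at hD
        exact hi hD
      have hDi : D i ≠ 0 := fun h0 => by
        rw [Finset.prod_eq_zero (Finset.mem_univ i) h0] at hD
        exact zero_ne_one hD
      let E : Fin (Module.finrank K X) → K := fun l =>
        D l * ((if l = i then (D i)⁻¹ else 1) * (if l = j then D i else 1))
      have hE : ∏ l, E l = 1 := by
        simp only [E, Finset.prod_mul_distrib, hD, Finset.prod_ite_eq', Finset.mem_univ, if_true]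
        field_simp
      have hEi : E i = 1 := by simp [E, hij.symm, hDi]
      have hsub : (Finset.univ.filter fun l => E l ≠ 1) ⊂ Finset.univ.filter fun l => D l ≠ 1 := by
        refine Finset.ssubset_iff_subset_ne.2 ⟨fun l hl => ?_, fun he => ?_⟩
        · simp only [Finset.mem_filter, Finset.mem_univ, true_and] at hl ⊢
          by_cases hlj : l = j
          · rwa [hlj]
          · by_cases hli : l = i
            · rwa [hli]
            · simpa [E, hli, hlj] using hl
        · have : i ∈ Finset.univ.filter fun l => D l ≠ 1 := by simpa using hi
          rw [← he] at this
          simp [hEi] at this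
      obtain ⟨g, hgG, hg⟩ := ih E hE (by have := Finset.card_lt_card hsub; omega)
      obtain ⟨h, hhG, hh⟩ := hpair i j hij.symm (D i) hDi
      refine ⟨g * h, mul_mem hgG hhG, fun l => ?_⟩
      rw [Units.val_mul, Module.End.mul_apply, hh, map_smul, hg, smul_smul]
      congr 1
      by_cases hli : l = i
      · subst hli; simp [E, hij.symm, hDi]
      · by_cases hlj : l = j
        · subst hlj; simp [E, hli, hDi, mul_comm]
        · simp [E, hli, hlj]
  let P : Matrix _ _ K → Prop := fun M => ∃ g ∈ G, LinearMap.toMatrix b b g.1 = M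
  obtain ⟨g', hg', he⟩ : P (LinearMap.toMatrix b b g.1) := by
    -- Gaussian elimination reduces to diagonal matrices of the same determinant.
    refine Matrix.diagonal_transvection_induction P _ (fun D hD => ?_) (fun t => ?_) ?_
    · rw [LinearMap.det_toMatrix, hg, Matrix.det_diagonal] at hD
      obtain ⟨g, hgG, hg⟩ := hdiag _ D hD le_rfl
      refine ⟨g, hgG, ?_⟩
      ext k l
      rw [LinearMap.toMatrix_apply, hg, map_smul, Module.Basis.repr_self, Matrix.diagonal_apply]
      by_cases hkl : k = l
      · subst hkl; simp
      · simp [hkl]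
    · have h0 : (t.c • b.coord t.j) (b t.i) = 0 := by simp [t.hij]
      refine ⟨transvectionGL _ _ h0, hG _ _ _, ?_⟩
      ext k l
      rw [LinearMap.toMatrix_apply, transvectionGL_apply, Matrix.TransvectionStruct.toMatrix,
        Matrix.transvection]
      simp only [map_add, map_smul, Module.Basis.repr_self, Matrix.add_apply, Matrix.one_apply,
        Matrix.single_apply, Finsupp.add_apply, Finsupp.smul_apply, Finsupp.single_apply,
        LinearMap.smul_apply, Module.Basis.coord_apply, smul_eq_mul]
      congr 1
      · simp [eq_comm]
      · by_cases h1 : t.i = k <;> by_cases h2 : t.j = l <;> simp [h1, h2, eq_comm (a := l)]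
    · rintro _ _ ⟨g, hgG, rfl⟩ ⟨h, hhG, rfl⟩
      exact ⟨g * h, mul_mem hgG hhG, by rw [Units.val_mul, LinearMap.toMatrix_mul]⟩
  have : g' = g := Units.ext ((LinearMap.toMatrix b b).injective he)
  rwa [← this]

end Transvections

/-! ### Eichler transvections and lifts of SL(U) -/

namespace IsotropicDatum

variable {V : Type*} [AddCommGroup V] [Module ℚ V] (D : IsotropicDatum V)

theorem form_comm (x y : V) : D.form x y = D.form y x := D.symm.eq x y

theorem form_U_U (u u' : D.U) : D.form u u' = 0 := D.isotropic u'.2 u u.2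

theorem star_surjective [FiniteDimensional ℚ V] : Function.Surjective D.star := fun f => by
  obtain ⟨F, hF⟩ := LinearMap.exists_extend f
  refine ⟨(D.form.toDual D.nondegenerate).symm F, LinearMap.ext fun u => ?_⟩
  rw [star_apply, LinearMap.BilinForm.apply_toDual_symm_apply (hB := D.nondegenerate), ← hF]
  rfl

theorem star_eq_zero_iff (v : V) : D.star v = 0 ↔ v ∈ D.Uperp := by
  constructor
  · intro h u hu
    exact (D.form_comm _ _).trans (LinearMap.congr_fun h ⟨u, hu⟩)
  · intro h
    exact LinearMap.ext fun u => (D.form_comm _ _).trans (h u u.2)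

/-- The endomorphism `x ↦ x + (v, x) u - (u, x) v - (v, v) (u, x) u / 2`. -/
def eichlerEnd (u : D.U) (v : V) : Module.End ℚ V :=
  LinearMap.id + (D.form v).smulRight (u : V) -
    (D.form u).smulRight (v + (2⁻¹ * D.form v v) • (u : V))

theorem eichlerEnd_apply (u : D.U) (v x : V) : D.eichlerEnd u v x =
    x + D.form v x • (u : V) - D.form u x • (v + (2⁻¹ * D.form v v) • (u : V)) := rfl

theorem eichlerEnd_mul (u : D.U) (v : V) (h : D.form v u = 0) :
    D.eichlerEnd u v * D.eichlerEnd u (-v) = 1 := by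
  refine LinearMap.ext fun x => ?_
  have h1 : D.form u v = 0 := (D.form_comm _ _).trans h
  simp only [Module.End.mul_apply, eichlerEnd_apply, map_add, map_sub, map_neg, map_smul,
    LinearMap.neg_apply, form_U_U, h, h1, Module.End.one_apply]
  match_scalars <;> ring

/-- The Eichler transvection that belongs to `u ∈ U` and `v ∈ V` with `(u, v) = 0`. -/
def eichler (u : D.U) (v : V) (h : D.form v u = 0) : D.P :=
  ⟨⟨D.eichlerEnd u v, D.eichlerEnd u (-v), D.eichlerEnd_mul u v h, by
      have h2 := D.eichlerEnd_mul u (-v) (by simp [h])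
      rwa [neg_neg] at h2⟩, by
    have h1 : D.form u v = 0 := (D.form_comm _ _).trans h
    have hU : ∀ w : V, D.form w u = 0 → ∀ x ∈ D.U, D.eichlerEnd u w x ∈ D.U := by
      intro w _ x hx
      have h2 : D.form u x = 0 := D.form_U_U u ⟨x, hx⟩
      rw [eichlerEnd_apply, h2, zero_smul, sub_zero]
      exact add_mem hx (D.U.smul_mem _ u.2)
    refine ⟨fun x y => ?_, fun x => ⟨fun hx => ?_, hU v h x⟩⟩
    · change D.form (D.eichlerEnd u v x) (D.eichlerEnd u v y) = _
      simp only [eichlerEnd_apply, map_add, map_sub, map_smul, LinearMap.add_apply,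
        LinearMap.sub_apply, LinearMap.smul_apply, form_U_U, h, h1, smul_eq_mul]
      rw [D.form_comm x u, D.form_comm x v]
      ring
    · have h2 := D.eichlerEnd_mul u (-v) (by simp [h])
      rw [neg_neg] at h2
      have h3 := hU (-v) (by simp [h]) _ hx
      change D.eichlerEnd u (-v) (D.eichlerEnd u v x) ∈ D.U at h3
      rwa [← Module.End.mul_apply, h2] at h3⟩

variable [FiniteDimensional ℚ V]

/-- The difference from the identity maps V into the span of u and v, sends v to a multiple of u,
and kills u; so its cube is zero. -/
theorem eichler_mem_parabolicPlus (u : D.U) (v : V) (h : D.form v u = 0) :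
    (D.eichler u v h).1 ∈ parabolicPlus D.form D.U := by
  refine unipotent_mem_parabolicPlus (D.eichler u v h).2 (LinearMap.ext fun x => ?_)
  have h1 : D.form u v = 0 := (D.form_comm _ _).trans h
  have hN : ∀ x, (D.eichlerEnd u v - 1) x =
      D.form v x • (u : V) - D.form u x • (v + (2⁻¹ * D.form v v) • (u : V)) := fun x => by
    rw [LinearMap.sub_apply, eichlerEnd_apply, Module.End.one_apply]
    abel
  change (D.eichlerEnd u v - 1) ((D.eichlerEnd u v - 1) ((D.eichlerEnd u v - 1) x)) = 0
  simp only [hN, map_add, map_sub, map_smul, form_U_U, h, h1, smul_eq_mul]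
  match_scalars <;> ring

/-- Every element of `SL(U)` lifts to the identity component of the parabolic group, with trivial
action on `W`. -/
theorem exists_parabolicPlus_lift_SL (M : GeneralLinearGroup ℚ D.U)
    (hM : LinearMap.det M.1 = 1) :
    ∃ A : D.P, A.1 ∈ parabolicPlus D.form D.U ∧ D.actU A = M ∧ D.actW A = 1 := by
  let G : Subgroup (GeneralLinearGroup ℚ D.U) :=
    ((parabolicPlus D.form D.U).subgroupOf D.P ⊓ D.actW.ker).map D.actU
  obtain ⟨A, ⟨h1, h2⟩, h3⟩ : M ∈ G := by
    refine mem_of_det_eq_one G (fun f u h => ?_) M hM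
    -- With f = (v, ·), the Eichler transvection restricts on U to the given transvection because
    -- (u, ·) vanishes there. On U^⊥ it moves vectors by multiples of u, hence acts trivially on W.
    obtain ⟨v, rfl⟩ := D.star_surjective f
    refine ⟨D.eichler u v h, ⟨D.eichler_mem_parabolicPlus u v h, ?_⟩, ?_⟩
    · apply Units.ext
      refine LinearMap.ext fun x => ?_
      obtain ⟨x, rfl⟩ := Submodule.mkQ_surjective _ x
      change D.toW ⟨D.eichlerEnd u v x, _⟩ = D.toW x
      refine (Submodule.Quotient.eq _).2 ?_
      change D.eichlerEnd u v x - x ∈ D.U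
      have h2 : D.form u x = 0 := x.2 u u.2
      rw [eichlerEnd_apply, h2, zero_smul, sub_zero, add_sub_cancel_left]
      exact D.U.smul_mem _ u.2
    · apply Units.ext
      refine LinearMap.ext fun x => Subtype.ext ?_
      change D.eichlerEnd u v x = x + D.form v x • (u : V)
      rw [eichlerEnd_apply, form_U_U, zero_smul, sub_zero]
  exact ⟨A, h1, h3, h2⟩

end IsotropicDatum

theorem exists_int_linearMap {N : Type*} [AddCommGroup N] (F : N →ₗ[ℤ] ℚ)
    (h : ∀ x, F x ∈ (1 : Submodule ℤ ℚ)) : ∃ g : N →ₗ[ℤ] ℤ, ∀ x, (g x : ℚ) = F x := by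
  choose g hg using fun x => mem_one_int.1 (h x)
  exact ⟨AddMonoidHom.toIntLinearMap (AddMonoidHom.mk' g fun x y => by
    have : (g (x + y) : ℚ) = g x + g y := by rw [hg, hg, hg, map_add]
    exact_mod_cast this), hg⟩

/-! ### Unimodular complements and adapted coordinates -/

namespace IsotropicDatum

variable {V : Type*} [AddCommGroup V] [Module ℚ V] (D : IsotropicDatum V)

theorem Ldual_dual : D.form.dualSubmodule D.Ldual = D.L :=
  haveI := D.isLattice
  dualSubmodule_dualSubmodule_lattice D.nondegenerate D.symm D.L

theorem star_mem_Idual {v : V} (hv : v ∈ D.Ldual) : D.star v ∈ D.Idual := fun i hi => hv i hi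

theorem toW_surjective : Function.Surjective D.toW := Submodule.mkQ_surjective _

theorem toW_eq_zero_iff (z : D.Uperp) : D.toW z = 0 ↔ (z : V) ∈ D.U :=
  Submodule.Quotient.mk_eq_zero _

section Complement

variable {D} {T : Submodule ℤ V}

theorem IsUnimodularComplement.eq_zero (hT : D.IsUnimodularComplement T) {t : V} (ht : t ∈ T)
    (h : D.star t = 0) : t = 0 := by
  obtain ⟨x, _, hx⟩ := hT.unimodular 0
  rw [hx t ⟨ht, fun i => LinearMap.congr_fun h i.1⟩, hx 0 ⟨zero_mem _, fun i => by simp⟩]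

theorem mem_tildeW_iff (v : V) : v ∈ D.tildeW T ↔ v ∈ D.Uperp ∧ ∀ t ∈ tildeU T, D.form t v = 0 := by
  constructor
  · exact fun h => ⟨D.tildeW_le T h, fun t ht => h t (Submodule.mem_sup_right ht)⟩
  · rintro ⟨h1, h2⟩ x hx
    obtain ⟨u, hu, t, ht, rfl⟩ := Submodule.mem_sup.1 hx
    change D.form (u + t) v = 0
    rw [map_add, LinearMap.add_apply, h2 t ht, add_zero]
    exact h1 u hu

end Complement

variable [FiniteDimensional ℚ V]

theorem I_isLattice : D.I.IsLattice ℚ :=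
  haveI := D.isLattice
  isLattice_comap_subtype D.L D.U

theorem LamDual_isLattice : D.LamDual.IsLattice ℚ :=
  haveI := D.Lam_isLattice
  isLattice_dualSubmodule D.formW_nondegenerate D.Lam

/-- Unimodular complements exist. -/
theorem exists_isUnimodularComplement : ∃ T : Submodule ℤ V, D.IsUnimodularComplement T := by
  classical
  have := D.isLattice
  have := D.I_isLattice
  have := Submodule.IsLattice.free ℚ D.I
  let b := Module.finBasis ℤ D.I
  -- Vectors of L* dual to a basis of I; their ℤ-span is the complement.
  choose ν hν hνb using fun j =>
    exists_dual_vector D.nondegenerate D.L D.U (b.coord j)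
  have hνi : ∀ j k, D.form (ν j) (b k).1 = if k = j then 1 else 0 := fun j k => by
    have h : b.coord j (b k) = if k = j then 1 else 0 := by
      rw [Module.Basis.coord_apply, Module.Basis.repr_self, Finsupp.single_apply]
    refine (hνb j (b k)).trans ((congrArg Int.cast h).trans ?_)
    split_ifs <;> simp
  have hsum : ∀ (c : Fin (Module.finrank ℤ D.I) → ℤ) k,
      D.form (∑ j, c j • ν j) (b k).1 = c k := fun c k => by
    simp [hνi]
  refine ⟨Submodule.span ℤ (Set.range ν), Submodule.span_le.2 ?_, fun f => ?_⟩
  · rintro _ ⟨j, rfl⟩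
    exact hν j
  · refine ⟨∑ j, f (b j) • ν j, ⟨?_, fun i => ?_⟩, ?_⟩
    · exact sum_mem fun j _ => Submodule.smul_mem _ _ (Submodule.subset_span ⟨j, rfl⟩)
    · let F : D.I →ₗ[ℤ] ℚ := (D.form (∑ j, f (b j) • ν j)).restrictScalars ℤ ∘ₗ
        D.U.subtype.restrictScalars ℤ ∘ₗ D.I.subtype
      have h : F = Algebra.linearMap ℤ ℚ ∘ₗ f := b.ext fun k => hsum _ k
      exact LinearMap.congr_fun h i
    · rintro t ⟨ht, htf⟩
      obtain ⟨c, rfl⟩ := (Submodule.mem_span_range_iff_exists_fun ℤ).1 ht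
      refine Finset.sum_congr rfl fun j _ => ?_
      have h := htf (b j)
      rw [hsum] at h
      rw [show c j = f (b j) by exact_mod_cast h]

theorem eq_of_eqOn_I {f g : Module.Dual ℚ D.U} (h : ∀ i ∈ D.I, f i = g i) : f = g :=
  LinearMap.ext_on D.I_isLattice.span_eq_top h

variable {D} {T : Submodule ℤ V}

theorem IsUnimodularComplement.exists_star_eq (hT : D.IsUnimodularComplement T)
    {f : Module.Dual ℚ D.U} (hf : f ∈ D.Idual) : ∃ t ∈ T, D.star t = f := by
  obtain ⟨g, hg⟩ := exists_int_linearMap (f.restrictScalars ℤ ∘ₗ D.I.subtype)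
    (fun i => hf i i.2)
  obtain ⟨t, ⟨ht, h⟩, _⟩ := hT.unimodular g
  exact ⟨t, ht, D.eq_of_eqOn_I fun i hi => (h ⟨i, hi⟩).trans (hg ⟨i, hi⟩)⟩

theorem exists_zsmul_mem_Idual (f : Module.Dual ℚ D.U) : ∃ n : ℤ, n ≠ 0 ∧ n • f ∈ D.Idual := by
  have := D.isLattice
  have : D.Ldual.IsLattice ℚ := isLattice_dualSubmodule D.nondegenerate D.L
  obtain ⟨v, rfl⟩ := D.star_surjective f
  obtain ⟨n, hn, h⟩ := exists_zsmul_mem_lattice D.Ldual v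
  exact ⟨n, hn, by rw [← map_zsmul]; exact D.star_mem_Idual h⟩

/-- Obtained from the bijection of Ĩ with I* by clearing denominators. It identifies Ũ with U*. -/
theorem IsUnimodularComplement.star_bijective (hT : D.IsUnimodularComplement T) :
    Function.Bijective (D.star.domRestrict (tildeU T)) := by
  constructor
  · rw [← LinearMap.ker_eq_bot, LinearMap.ker_eq_bot']
    rintro ⟨x, hx⟩ h0
    obtain ⟨n, hn, h⟩ := exists_zsmul_mem_of_mem_span T hx
    refine Subtype.ext (zsmul_eq_zero_rat hn (hT.eq_zero h ?_))
    rw [map_zsmul]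
    change n • (D.star.domRestrict (tildeU T)) ⟨x, hx⟩ = 0
    rw [h0, smul_zero]
  · intro f
    obtain ⟨n, hn, h⟩ := exists_zsmul_mem_Idual f
    obtain ⟨t, ht, hf⟩ := hT.exists_star_eq h
    refine ⟨(n : ℚ)⁻¹ • ⟨t, Submodule.subset_span ht⟩, ?_⟩
    rw [map_smul]
    change (n : ℚ)⁻¹ • D.star t = f
    rw [hf, ← Int.cast_smul_eq_zsmul ℚ, inv_smul_smul₀ (by exact_mod_cast hn)]

variable (D)

/-- Coordinates `V ≅ U × W × U*` on `V` in which the form is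
`((u, w, f), (u', w', f')) ↦ f' u + f u' + (w, w')`, adapted to a unimodular complement `T`: the
image of `W` is `W̃`, and the section of `V → U*` with values in `Ũ` is `f ↦ τ f + σ f`. -/
structure Splitting (T : Submodule ℤ V) where
  a : V →ₗ[ℚ] D.U
  p : V →ₗ[ℚ] D.W
  s : D.W →ₗ[ℚ] V
  τ : Module.Dual ℚ D.U →ₗ[ℚ] V
  σ : Module.Dual ℚ D.U →ₗ[ℚ] D.U
  decomp : ∀ v, (a v : V) + s (p v) + τ (D.star v) = v
  a_U : ∀ u : D.U, a u = u
  a_s : ∀ w, a (s w) = 0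
  a_τ : ∀ f, a (τ f) = 0
  p_τ : ∀ f, p (τ f) = 0
  p_s : ∀ w, p (s w) = w
  p_perp : ∀ z : D.Uperp, p z = D.toW z
  star_s : ∀ w, D.star (s w) = 0
  star_τ : ∀ f, D.star (τ f) = f
  form_eq : ∀ v v', D.form v v' = D.star v' (a v) + D.star v (a v') + D.formW (p v) (p v')
  s_mem : ∀ w, s w ∈ D.tildeW T
  s_tilde : ∀ w : D.tildeW T, s (D.tildeToW T w) = w
  mem_tildeU : ∀ f, τ f + σ f ∈ tildeU T
  mem_T : ∀ f ∈ D.Idual, τ f + σ f ∈ T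
  eq_of_mem_tildeU : ∀ t ∈ tildeU T, τ (D.star t) + σ (D.star t) = t

variable {D}

theorem IsUnimodularComplement.exists_splitting (hT : D.IsUnimodularComplement T) :
    Nonempty (D.Splitting T) := by
  let e : tildeU T ≃ₗ[ℚ] Module.Dual ℚ D.U := LinearEquiv.ofBijective _ hT.star_bijective
  let t : Module.Dual ℚ D.U →ₗ[ℚ] V := (tildeU T).subtype ∘ₗ e.symm.toLinearMap
  have ht : ∀ f, t f ∈ tildeU T := fun f => (e.symm f).2
  have hst : ∀ f, D.star (t f) = f := fun f => e.apply_symm_apply f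
  have hts : ∀ x ∈ tildeU T, t (D.star x) = x := fun x hx =>
    congrArg Subtype.val (e.symm_apply_apply ⟨x, hx⟩)
  have hsU : ∀ u : D.U, D.star u = 0 := fun u => (D.star_eq_zero_iff _).2 (D.isotropic u.2)
  have hdual : ∀ F : Module.Dual ℚ (Module.Dual ℚ D.U), ∃ u : D.U, ∀ f, f u = F f := fun F =>
    ⟨(Module.evalEquiv ℚ D.U).symm F, fun f => by
      rw [← Module.Dual.eval_apply ℚ]
      exact LinearMap.congr_fun ((Module.evalEquiv ℚ D.U).apply_symm_apply F) f⟩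
  have hbij : Function.Bijective (D.tildeToW T) := by
    constructor
    · rw [← LinearMap.ker_eq_bot, LinearMap.ker_eq_bot']
      rintro ⟨w, hw⟩ h0
      have hU : w ∈ D.U := (D.toW_eq_zero_iff _).1 h0
      refine Subtype.ext ?_
      change ((⟨w, hU⟩ : D.U) : V) = 0
      rw [Submodule.coe_eq_zero, ← Module.forall_dual_apply_eq_zero_iff ℚ]
      intro f
      rw [← hst f]
      exact ((mem_tildeW_iff w).1 hw).2 _ (ht f)
    · intro x
      obtain ⟨x, rfl⟩ := D.toW_surjective x
      -- Pairing with Ũ gives all functionals on U, so a unique u ∈ U corrects `x` to be orthogonal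
      -- to Ũ without changing its class in W.
      obtain ⟨u, hu⟩ := hdual (D.form x ∘ₗ t)
      have hperp : (x - u : V) ∈ D.Uperp := sub_mem x.2 (D.isotropic u.2)
      refine ⟨⟨x - u, (mem_tildeW_iff _).2 ⟨hperp, fun y hy => ?_⟩⟩, ?_⟩
      · have h := hu (D.star y)
        rw [LinearMap.comp_apply, hts y hy, star_apply] at h
        rw [map_sub, h, D.form_comm x y, sub_self]
      · refine (Submodule.Quotient.eq _).2 ?_
        change (x - u : V) - x ∈ D.U
        rw [sub_sub_cancel_left]
        exact neg_mem u.2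
  let ew : D.tildeW T ≃ₗ[ℚ] D.W := LinearEquiv.ofBijective _ hbij
  let s : D.W →ₗ[ℚ] V := (D.tildeW T).subtype ∘ₗ ew.symm.toLinearMap
  have hs : ∀ w, s w ∈ D.tildeW T := fun w => (ew.symm w).2
  have hsw : ∀ w : D.tildeW T, s (D.tildeToW T w) = w := fun w =>
    congrArg Subtype.val (ew.symm_apply_apply w)
  have hsperp : ∀ w, s w ∈ D.Uperp := fun w => D.tildeW_le T (hs w)
  have htoW : ∀ w, D.toW ⟨s w, hsperp w⟩ = w := fun w => ew.apply_symm_apply w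
  -- The adjoint of `s`; it extends the projection U^⊥ → W to all of V and kills Ũ.
  let p : V →ₗ[ℚ] D.W := (D.formW.toDual D.formW_nondegenerate).symm.toLinearMap ∘ₗ
    s.dualMap ∘ₗ D.form
  have hp : ∀ v w, D.formW (p v) w = D.form v (s w) := fun v w =>
    LinearMap.BilinForm.apply_toDual_symm_apply (hB := D.formW_nondegenerate) _ _
  have hpext : ∀ v x, (∀ w, D.form v (s w) = D.formW x w) → p v = x := fun v x h => by
    rw [← sub_eq_zero]
    refine D.formW_nondegenerate.1 _ fun w => ?_
    rw [map_sub, LinearMap.sub_apply, hp, h, sub_self]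
  have hpperp : ∀ z : D.Uperp, p z = D.toW z := fun z => hpext _ _ fun w => by
    conv_rhs => rw [← htoW w]
    rfl
  have hpt : ∀ f, p (t f) = 0 := fun f => hpext _ _ fun w => by
    rw [map_zero, LinearMap.zero_apply]
    exact ((mem_tildeW_iff _).1 (hs w)).2 _ (ht f)
  have hpU : ∀ u : D.U, p u = 0 := fun u => by
    rw [hpperp ⟨u, D.isotropic u.2⟩, toW_eq_zero_iff]
    exact u.2
  have hps : ∀ w, p (s w) = w := fun w => (hpperp ⟨_, hsperp w⟩).trans (htoW w)
  have hstars : ∀ w, D.star (s w) = 0 := fun w => (D.star_eq_zero_iff _).2 (hsperp w)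
  -- Ũ need not be isotropic. Subtracting half of its Gram form, read as a map U* → U, makes the
  -- image of `τ` isotropic.
  let σ : Module.Dual ℚ D.U →ₗ[ℚ] D.U := (Module.evalEquiv ℚ D.U).symm.toLinearMap ∘ₗ
    t.dualMap ∘ₗ ((2⁻¹ : ℚ) • D.form) ∘ₗ t
  have hσ : ∀ f g, g (σ f) = 2⁻¹ * D.form (t f) (t g) := fun f g => by
    rw [← Module.Dual.eval_apply ℚ]
    exact LinearMap.congr_fun ((Module.evalEquiv ℚ D.U).apply_symm_apply
      ((t.dualMap ∘ₗ ((2⁻¹ : ℚ) • D.form) ∘ₗ t) f)) g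
  let τ : Module.Dual ℚ D.U →ₗ[ℚ] V := t - D.U.subtype ∘ₗ σ
  have hτ : ∀ f, τ f = t f - σ f := fun f => rfl
  have hστ : ∀ f, D.star (τ f) = f := fun f => by rw [hτ, map_sub, hsU, hst, sub_zero]
  have hpτ : ∀ f, p (τ f) = 0 := fun f => by rw [hτ, map_sub, hpU, hpt, sub_zero]
  have haU : ∀ v, v - s (p v) - τ (D.star v) ∈ D.U := fun v => by
    have h1 : v - τ (D.star v) ∈ D.Uperp := by
      rw [← star_eq_zero_iff, map_sub, hστ, sub_self]
    have h2 : p v = D.toW ⟨_, h1⟩ := by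
      rw [← hpperp]
      change _ = p (v - τ (D.star v))
      rw [map_sub, hpτ, sub_zero]
    have h3 : D.toW (⟨_, h1⟩ - ⟨s (p v), hsperp _⟩) = 0 := by
      rw [map_sub, htoW, h2, sub_self]
    have h4 := (D.toW_eq_zero_iff _).1 h3
    have h5 : v - s (p v) - τ (D.star v) = v - τ (D.star v) - s (p v) := by abel
    rw [h5]
    exact h4
  let a : V →ₗ[ℚ] D.U := (LinearMap.id - s ∘ₗ p - τ ∘ₗ D.star).codRestrict D.U haU
  have ha : ∀ v, (a v : V) = v - s (p v) - τ (D.star v) := fun v => rfl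
  have hdec : ∀ v, (a v : V) + s (p v) + τ (D.star v) = v := fun v => by rw [ha]; abel
  have hττ : ∀ f g, D.form (τ f) (τ g) = 0 := fun f g => by
    have h1 := hσ f g
    have h2 := hσ g f
    rw [← hst g, star_apply] at h1
    rw [← hst f, star_apply, D.form_comm (t g)] at h2
    simp only [hst] at h1 h2
    rw [hτ, hτ, map_sub, map_sub, LinearMap.sub_apply, LinearMap.sub_apply, form_U_U, h2,
      D.form_comm (σ f), h1]
    ring
  refine ⟨⟨a, p, s, τ, σ, hdec, fun u => ?_, fun w => ?_, fun f => ?_, hpτ, hps, hpperp,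
    hstars, hστ,
    fun v v' => ?_, hs, hsw, fun f => ?_, fun f hf => ?_, fun x hx => ?_⟩⟩
  · apply Subtype.ext
    rw [ha, hpU, hsU]
    simp
  · apply Subtype.ext
    rw [ha, hps, hstars]
    simp
  · apply Subtype.ext
    rw [ha, hpτ, hστ]
    simp
  · have h1 : ∀ w, ∀ u : D.U, D.form u (s w) = 0 := fun w u => hsperp w u u.2
    have h2 : ∀ w f, D.form (s w) (τ f) = 0 := fun w f => by
      rw [D.form_comm, ← hp, hpτ, map_zero, LinearMap.zero_apply]
    have h3 : ∀ f (u : D.U), D.form (τ f) u = f u := fun f u => by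
      rw [← star_apply, hστ]
    have h4 : ∀ w w', D.form (s w) (s w') = D.formW w w' := fun w w' => by rw [← hp, hps]
    conv_lhs => rw [← hdec v, ← hdec v']
    simp only [map_add, LinearMap.add_apply, h1, h2, h3, h4, hττ, form_U_U]
    rw [D.form_comm (a v) (τ _), h3, D.form_comm (s _) (a v' : V), h1, D.form_comm (τ _) (s _), h2]
    ring
  · rw [hτ, sub_add_cancel]
    exact ht f
  · rw [hτ, sub_add_cancel]
    obtain ⟨x, hx, rfl⟩ := hT.exists_star_eq hf
    rwa [hts x (Submodule.subset_span hx)]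
  · rw [hτ, sub_add_cancel, hts x hx]

end IsotropicDatum

theorem mul_mem_one_int {x y : ℚ} (hx : x ∈ (1 : Submodule ℤ ℚ)) (hy : y ∈ (1 : Submodule ℤ ℚ)) :
    x * y ∈ (1 : Submodule ℤ ℚ) := by
  obtain ⟨m, rfl⟩ := mem_one_int.1 hx
  obtain ⟨n, rfl⟩ := mem_one_int.1 hy
  exact_mod_cast intCast_mem_one (m * n)

theorem inv_apply_self {K X : Type*} [Field K] [AddCommGroup X] [Module K X]
    (g : GeneralLinearGroup K X) (x : X) : (g⁻¹).1 (g.1 x) = x := by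
  rw [← Module.End.mul_apply, Units.inv_mul]; rfl

theorem apply_inv_self {K X : Type*} [Field K] [AddCommGroup X] [Module K X]
    (g : GeneralLinearGroup K X) (x : X) : g.1 ((g⁻¹).1 x) = x := by
  rw [← Module.End.mul_apply, Units.mul_inv]; rfl

/-! ### Integrality criteria and the alternating correction -/

namespace IsotropicDatum

variable {V : Type*} [AddCommGroup V] [Module ℚ V] (D : IsotropicDatum V)

theorem star_U (u : D.U) : D.star u = 0 := (D.star_eq_zero_iff _).2 (D.isotropic u.2)

/-- The identity (g⁻¹x - x, y) = (x, gy - y) passes the condition on L* to the inverse by duality.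
Thus `g` and its inverse both preserve L, and invariance of L need not be checked separately. -/
theorem mem_stableOrthogonal {g : GeneralLinearGroup ℚ V} (hg : g ∈ orthogonalGroup D.form)
    (h : ∀ x ∈ D.Ldual, g.1 x - x ∈ D.L) (hL : D.L ≤ D.Ldual)
    (hdual : ∀ x, (∀ y ∈ D.Ldual, D.form x y ∈ (1 : Submodule ℤ ℚ)) → x ∈ D.L) :
    g ∈ stableOrthogonal D.form D.L := by
  have h1 : ∀ x ∈ D.L, g.1 x ∈ D.L := fun x hx => by
    simpa using add_mem (h x (hL hx)) hx
  have h2 : ∀ x ∈ D.Ldual, (g⁻¹).1 x - x ∈ D.L := fun x hx => hdual _ fun y hy => by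
    have e : D.form ((g⁻¹).1 x) y = D.form x (g.1 y) := by
      rw [← hg ((g⁻¹).1 x) y, apply_inv_self]
    rw [map_sub, LinearMap.sub_apply, e, ← map_sub]
    exact hx _ (h y hy)
  refine ⟨hg, fun x => ⟨fun hx => ?_, h1 x⟩, h⟩
  have h3 := add_mem (h2 _ (hL hx)) hx
  rwa [sub_add_cancel, inv_apply_self] at h3

theorem L_le_Ldual : D.L ≤ D.Ldual := by
  intro x hx y hy
  obtain ⟨a, ha⟩ := D.even x hx
  obtain ⟨b, hb⟩ := D.even y hy
  obtain ⟨c, hc⟩ := D.even (x + y) (add_mem hx hy)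
  refine Submodule.mem_one.2 ⟨c - a - b, ?_⟩
  change ((c - a - b : ℤ) : ℚ) = D.form x y
  have h := D.form_comm x y
  simp only [map_add, LinearMap.add_apply] at hc
  push_cast
  linarith

theorem mem_L_of_pairing {x : V} (h : ∀ y ∈ D.Ldual, D.form x y ∈ (1 : Submodule ℤ ℚ)) :
    x ∈ D.L := by
  rw [← Ldual_dual]
  exact h

theorem stableOrthogonal_iff {g : GeneralLinearGroup ℚ V} (hg : g ∈ orthogonalGroup D.form) :
    g ∈ stableOrthogonal D.form D.L ↔ ∀ x ∈ D.Ldual, g.1 x - x ∈ D.L :=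
  ⟨fun h => h.2.2, fun h => D.mem_stableOrthogonal hg h D.L_le_Ldual fun _ => D.mem_L_of_pairing⟩

theorem toW_mem_LamDual {z : D.Uperp} (hz : (z : V) ∈ D.Ldual) : D.toW z ∈ D.LamDual := by
  rintro _ ⟨y, hy, rfl⟩
  exact hz _ hy

theorem P_ext {A B : D.P} (h : ∀ v, A.1.1 v = B.1.1 v) : A = B :=
  Subtype.ext (Units.ext (LinearMap.ext h))

theorem actU_eq_iff (A : D.P) (M : GeneralLinearGroup ℚ D.U) :
    D.actU A = M ↔ ∀ u : D.U, A.1.1 u = (M.1 u : D.U) := by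
  constructor
  · rintro rfl u
    rfl
  · exact fun h => Units.ext (LinearMap.ext fun u => Subtype.ext (h u))

theorem actW_eq_iff (A : D.P) (γ : GeneralLinearGroup ℚ D.W) :
    D.actW A = γ ↔ ∀ z : D.Uperp, D.toW ⟨A.1.1 z, D.P_mem_Uperp A z z.2⟩ = γ.1 (D.toW z) := by
  constructor
  · rintro rfl u
    rfl
  · intro h
    refine Units.ext (LinearMap.ext fun x => ?_)
    obtain ⟨z, rfl⟩ := D.toW_surjective x
    exact h z

theorem levi_eq_iff (A : D.P) (M : GeneralLinearGroup ℚ D.U) (γ : orthogonalGroup D.formW) :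
    D.levi A = (M, γ) ↔ D.actU A = M ∧ D.actW A = γ.1 := by
  rw [Prod.ext_iff, Subtype.ext_iff]
  rfl

theorem mem_unipotentRadical_iff (A : D.P) :
    A ∈ D.unipotentRadical ↔ D.actU A = 1 ∧ D.actW A = 1 :=
  D.levi_eq_iff A 1 1

theorem star_apply_P (A : D.P) (v : V) (u : D.U) :
    D.star (A.1.1 v) ((D.actU A).1 u) = D.star v u :=
  A.2.1 v u

theorem star_P (A : D.P) (v : V) :
    D.star (A.1.1 v) = D.star v ∘ₗ ((D.actU A)⁻¹).1 := LinearMap.ext fun u => by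
  have h := D.star_apply_P A v (((D.actU A)⁻¹).1 u)
  rwa [apply_inv_self] at h

variable [FiniteDimensional ℚ V]

theorem mem_I_of_pairing {u : D.U} (h : ∀ f ∈ D.Idual, f u ∈ (1 : Submodule ℤ ℚ)) : u ∈ D.I := by
  have := D.I_isLattice
  obtain ⟨n, b, hb⟩ := exists_basis_span_eq D.I
  rw [← hb, b.mem_span_iff_repr_mem ℤ]
  intro i
  refine mem_one_int.1 (h (b.coord i) fun x hx => ?_)
  rw [← hb, b.mem_span_iff_repr_mem ℤ] at hx
  exact mem_one_int.2 (hx i)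

/-- Elements of `Λ*` lift to `L* ∩ U^⊥`. -/
theorem exists_lift_LamDual {x : D.W} (hx : x ∈ D.LamDual) :
    ∃ z : D.Uperp, (z : V) ∈ D.Ldual ∧ D.toW z = x := by
  have := D.isLattice
  have hlat := isLattice_comap_subtype D.L D.Uperp
  let N := D.L.comap (D.Uperp.subtype.restrictScalars ℤ)
  obtain ⟨g, hg⟩ := exists_int_linearMap
    ((D.formW x ∘ₗ D.toW).restrictScalars ℤ ∘ₗ N.subtype) (fun i => hx _ ⟨i.1, i.2, rfl⟩)
  -- The functional (x, ·) on L ∩ U^⊥ is represented by an element of L*. It vanishes on U, so the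
  -- representing vector lies in U^⊥.
  obtain ⟨ν, hν, hνg⟩ := exists_dual_vector D.nondegenerate D.L D.Uperp g
  have heq : D.form ν ∘ₗ D.Uperp.subtype = D.formW x ∘ₗ D.toW :=
    LinearMap.ext_on hlat.span_eq_top fun i hi => (hνg ⟨i, hi⟩).trans (hg ⟨i, hi⟩)
  have hperp : ν ∈ D.Uperp := fun u hu => by
    have h := LinearMap.congr_fun heq ⟨u, D.isotropic hu⟩
    rw [LinearMap.comp_apply, LinearMap.comp_apply, (D.toW_eq_zero_iff _).2 hu, map_zero] at h
    exact (D.form_comm _ _).trans h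
  refine ⟨⟨ν, hperp⟩, hν, ?_⟩
  rw [← sub_eq_zero]
  refine D.formW_nondegenerate.1 _ fun y => ?_
  obtain ⟨y, rfl⟩ := D.toW_surjective y
  rw [map_sub, LinearMap.sub_apply, sub_eq_zero]
  exact LinearMap.congr_fun heq y

/-- A bilinear form on `U*` that is integral on the diagonal of `I*` is congruent to an
alternating one modulo the forms that are integral on `I*`. -/
theorem exists_homAs_congr (q : Module.Dual ℚ D.U →ₗ[ℚ] Module.Dual ℚ D.U →ₗ[ℚ] ℚ)
    (hq : ∀ f ∈ D.Idual, q f f ∈ (1 : Submodule ℤ ℚ)) :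
    ∃ η ∈ D.homAs, ∀ f ∈ D.Idual, ∀ g ∈ D.Idual, q f g - g (η f) ∈ (1 : Submodule ℤ ℚ) := by
  have := D.I_isLattice
  obtain ⟨n, b, hb⟩ := exists_basis_span_eq D.I
  have hbI : ∀ i, b i ∈ D.I := fun i => hb ▸ Submodule.subset_span ⟨i, rfl⟩
  have hcI : ∀ i, b.coord i ∈ D.Idual := fun i x hx => by
    rw [← hb, b.mem_span_iff_repr_mem ℤ] at hx
    exact mem_one_int.2 (hx i)
  -- Keep the Gram matrix of `q` above the diagonal and reflect it with opposite sign. The error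
  -- below the diagonal is q(f, g) + q(g, f), integral by polarization.
  let m : Fin n → Fin n → ℚ := fun i j =>
    if i < j then q (b.coord i) (b.coord j) else if j < i then - q (b.coord j) (b.coord i) else 0
  have hm : ∀ i j, m i j = - m j i := fun i j => by
    rcases lt_trichotomy i j with h | rfl | h
    · simp [m, h, h.not_gt]
    · simp [m]
    · simp [m, h, h.not_gt]
  have hqm : ∀ i j, q (b.coord i) (b.coord j) - m i j ∈ (1 : Submodule ℤ ℚ) := fun i j => by
    rcases lt_trichotomy i j with h | rfl | h
    · simp [m, h]
    · simpa [m] using hq _ (hcI i)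
    · have h1 := sub_mem (sub_mem (hq _ (add_mem (hcI i) (hcI j))) (hq _ (hcI i))) (hq _ (hcI j))
      convert h1 using 1
      simp only [m, h, h.not_gt, if_true, if_false, map_add, LinearMap.add_apply]
      ring
  have hexp : ∀ f : Module.Dual ℚ D.U, f = ∑ i, f (b i) • b.coord i := fun f =>
    (b.sum_dual_apply_smul_coord f).symm
  let η : Module.Dual ℚ D.U →ₗ[ℚ] D.U :=
    ∑ i, ∑ j, (Module.Dual.eval ℚ D.U (b i)).smulRight (m i j • b j)
  have hη : ∀ f g : Module.Dual ℚ D.U, g (η f) = ∑ i, ∑ j, f (b i) * (m i j * g (b j)) := by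
    intro f g
    simp [η]
  refine ⟨η, fun f g => ?_, fun f hf g hg => ?_⟩
  · rw [hη, hη, Finset.sum_comm, ← Finset.sum_neg_distrib]
    refine Finset.sum_congr rfl fun i _ => ?_
    rw [← Finset.sum_neg_distrib]
    refine Finset.sum_congr rfl fun j _ => ?_
    rw [hm]
    ring
  · have h1 : q f g = ∑ i, ∑ j, f (b i) * (q (b.coord i) (b.coord j) * g (b j)) := by
      conv_lhs => rw [hexp f, hexp g]
      simp only [map_sum, map_smul, LinearMap.sum_apply, LinearMap.smul_apply, smul_eq_mul,
        Finset.mul_sum]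
      rw [Finset.sum_comm]
      refine Finset.sum_congr rfl fun i _ => Finset.sum_congr rfl fun j _ => ?_
      ring
    rw [h1, hη, ← Finset.sum_sub_distrib]
    refine sum_mem fun i _ => ?_
    rw [← Finset.sum_sub_distrib]
    refine sum_mem fun j _ => ?_
    rw [← mul_sub, ← sub_mul]
    exact mul_mem_one_int (hf _ (hbI i)) (mul_mem_one_int (hqm i j) (hg _ (hbI j)))

/-- Pairing ψ*f with Λ* gives values of f on I, and Λ** = Λ. -/
theorem adj_mem_Lam {ψ : D.W →ₗ[ℚ] D.U} (hψ : ψ ∈ D.homLattice) {f : Module.Dual ℚ D.U}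
    (hf : f ∈ D.Idual) : D.adj ψ f ∈ D.Lam := by
  rw [← LamDual_dual]
  intro x hx
  rw [formW_adj]
  exact hf _ (hψ x hx)

/-- An isometry of `V` that acts on `U` by an automorphism `M`, as an element of `P_U`. -/
noncomputable def mkP (E : Module.End ℚ V) (hE : ∀ x y, D.form (E x) (E y) = D.form x y)
    (M : GeneralLinearGroup ℚ D.U) (hM : ∀ u : D.U, E u = (M.1 u : D.U)) : D.P :=
  have hinj : Function.Injective E := by
    rw [← LinearMap.ker_eq_bot, LinearMap.ker_eq_bot']
    intro x hx
    refine D.nondegenerate.1 x fun y => ?_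
    rw [← hE, hx, map_zero, LinearMap.zero_apply]
  ⟨⟨E, (LinearEquiv.ofInjectiveEndo E hinj).symm.toLinearMap,
      LinearMap.ext fun x => (LinearEquiv.ofInjectiveEndo E hinj).apply_symm_apply x,
      LinearMap.ext fun x => (LinearEquiv.ofInjectiveEndo E hinj).symm_apply_apply x⟩, hE,
    fun x => by
      constructor
      · intro hx
        have h := hM ((M⁻¹).1 ⟨E x, hx⟩)
        rw [apply_inv_self] at h
        rw [← hinj h]
        exact Subtype.property _
      · intro hx
        change E x ∈ D.U
        rw [hM ⟨x, hx⟩]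
        exact Subtype.property _⟩

theorem actU_mkP (E : Module.End ℚ V) (hE : ∀ x y, D.form (E x) (E y) = D.form x y)
    (M : GeneralLinearGroup ℚ D.U) (hM : ∀ u : D.U, E u = (M.1 u : D.U)) :
    D.actU (D.mkP E hE M hM) = M := (D.actU_eq_iff _ _).2 hM

end IsotropicDatum

/-! ### Levi lifts and Heisenberg coordinates -/

namespace IsotropicDatum

variable {V : Type*} [AddCommGroup V] [Module ℚ V] {D : IsotropicDatum V}

theorem apply_sub_mem_U {A : D.P} (hA : D.actW A = 1) (z : D.Uperp) : A.1.1 z - z ∈ D.U := by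
  have h := (D.actW_eq_iff A 1).1 hA z
  exact (Submodule.Quotient.eq (D.U.submoduleOf D.Uperp)).1 h

theorem apply_sub_mem_Uperp {A : D.P} (hA : D.actU A = 1) (v : V) : A.1.1 v - v ∈ D.Uperp := by
  rw [← star_eq_zero_iff, map_sub, star_P, hA, inv_one]
  exact sub_self _

/-- A - 1 maps V into U^⊥, U^⊥ into U, and U to zero, so its cube vanishes. -/
theorem parabolicPlus_of_mem_unipotentRadical [FiniteDimensional ℚ V] {A : D.P}
    (hA : A ∈ D.unipotentRadical) :
    A.1 ∈ parabolicPlus D.form D.U := by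
  rw [mem_unipotentRadical_iff] at hA
  refine unipotent_mem_parabolicPlus A.2 (LinearMap.ext fun v => ?_)
  have h1 := apply_sub_mem_Uperp hA.1 v
  have h2 := apply_sub_mem_U hA.2 ⟨_, h1⟩
  have h3 := (D.actU_eq_iff A 1).1 hA.1 ⟨_, h2⟩
  exact sub_eq_zero.2 h3

variable {T : Submodule ℤ V}

namespace Splitting

variable (H : D.Splitting T)

theorem p_U (u : D.U) : H.p u = 0 := by
  rw [H.p_perp ⟨u, D.isotropic u.2⟩, toW_eq_zero_iff]
  exact u.2

theorem ext_coord {v v' : V} (ha : H.a v = H.a v') (hp : H.p v = H.p v')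
    (hs : D.star v = D.star v') : v = v' := by
  rw [← H.decomp v, ← H.decomp v', ha, hp, hs]

theorem s_perp (w : D.W) : H.s w ∈ D.Uperp := D.tildeW_le T (H.s_mem w)

theorem toW_s (w : D.W) : D.toW ⟨H.s w, H.s_perp w⟩ = w := by
  rw [← H.p_perp]
  exact H.p_s w

theorem star_perp (z : D.Uperp) : D.star z = 0 := (D.star_eq_zero_iff _).2 z.2

theorem decomp_perp (z : D.Uperp) : (H.a z : V) + H.s (D.toW z) = z := by
  have h := H.decomp z
  rwa [star_perp, map_zero, add_zero, H.p_perp] at h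

/-- Although `τ` does not take values in Ũ, it differs from the section into Ũ only by elements of
U. -/
theorem mem_sup_tildeU_iff (v : V) : v ∈ D.U ⊔ tildeU T ↔ H.p v = 0 := by
  constructor
  · intro h
    obtain ⟨u, hu, t, ht, rfl⟩ := Submodule.mem_sup.1 h
    rw [← H.eq_of_mem_tildeU t ht, map_add, map_add, H.p_τ, H.p_U ⟨u, hu⟩, H.p_U, add_zero,
      add_zero]
  · intro h
    rw [← H.decomp v, h, map_zero, add_zero]
    have e : (H.a v : V) + H.τ (D.star v) =
        ((H.a v - H.σ (D.star v) : D.U) : V) + (H.τ (D.star v) + H.σ (D.star v)) := by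
      push_cast
      abel
    rw [e]
    exact add_mem (Submodule.mem_sup_left (Subtype.property _))
      (Submodule.mem_sup_right (H.mem_tildeU _))

/-- The endomorphism `(u, w, f) ↦ (M u, γ w, f ∘ M⁻¹)`. -/
noncomputable def leviEnd (M : GeneralLinearGroup ℚ D.U) (γ : orthogonalGroup D.formW) :
    Module.End ℚ V :=
  D.U.subtype ∘ₗ M.1 ∘ₗ H.a + H.s ∘ₗ γ.1.1 ∘ₗ H.p + H.τ ∘ₗ (M⁻¹).1.dualMap ∘ₗ D.star

theorem leviEnd_apply (M : GeneralLinearGroup ℚ D.U) (γ : orthogonalGroup D.formW) (v : V) :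
    H.leviEnd M γ v = (M.1 (H.a v) : D.U) + H.s (γ.1.1 (H.p v)) +
      H.τ (D.star v ∘ₗ (M⁻¹).1) := rfl

theorem a_leviEnd (M : GeneralLinearGroup ℚ D.U) (γ : orthogonalGroup D.formW) (v : V) :
    H.a (H.leviEnd M γ v) = M.1 (H.a v) := by
  rw [leviEnd_apply, map_add, map_add, H.a_U, H.a_s, H.a_τ, add_zero, add_zero]

theorem p_leviEnd (M : GeneralLinearGroup ℚ D.U) (γ : orthogonalGroup D.formW) (v : V) :
    H.p (H.leviEnd M γ v) = γ.1.1 (H.p v) := by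
  rw [leviEnd_apply, map_add, map_add, H.p_U, H.p_s, H.p_τ, add_zero, zero_add]

theorem star_leviEnd (M : GeneralLinearGroup ℚ D.U) (γ : orthogonalGroup D.formW) (v : V) :
    D.star (H.leviEnd M γ v) = D.star v ∘ₗ (M⁻¹).1 := by
  rw [leviEnd_apply, map_add, map_add, D.star_U, H.star_s, H.star_τ, zero_add, zero_add]

theorem p_apply (A : D.P) (z : D.Uperp) : H.p (A.1.1 z) = (D.actW A).1 (D.toW z) :=
  H.p_perp ⟨_, D.P_mem_Uperp A z z.2⟩

variable [FiniteDimensional ℚ V]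

theorem subquotientSplitting : SubquotientSplitting D.form D.U D.formW H.s H.p where
  adjoint y x := by
    rw [H.form_eq, H.a_s, H.star_s, H.p_s, map_zero, LinearMap.zero_apply]
    ring
  leftInv := H.p_s
  map_zero u hu := H.p_U ⟨u, hu⟩
  sub_mem := by
    let b := Module.finBasis ℚ D.U
    refine ⟨_, fun i => b i, fun i => H.τ (b.coord i), fun i => (b i).2, fun x => ?_⟩
    have h : H.τ (D.star x) = ∑ i, D.form x (b i) • H.τ (b.coord i) := by
      conv_lhs => rw [← b.sum_dual_apply_smul_coord (D.star x), map_sum]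
      simp only [map_smul, star_apply]
    rw [← h]
    have h2 := H.decomp x
    have h3 : x - H.s (H.p x) - H.τ (D.star x) = H.a x := by
      rw [sub_sub, sub_eq_iff_eq_add, ← add_assoc]
      exact h2.symm
    rw [h3]
    exact (H.a x).2

/-- The lift of `(M, γ)` to the Levi subgroup of `P_U` that belongs to the splitting. -/
noncomputable def leviLift (M : GeneralLinearGroup ℚ D.U) (γ : orthogonalGroup D.formW) : D.P :=
  D.mkP (H.leviEnd M γ)
    (fun x y => by
      rw [H.form_eq, H.a_leviEnd, H.a_leviEnd, H.p_leviEnd, H.p_leviEnd, H.star_leviEnd,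
        H.star_leviEnd, H.form_eq x y, γ.2, LinearMap.comp_apply, LinearMap.comp_apply,
        inv_apply_self, inv_apply_self])
    M
    (fun u => H.ext_coord (by rw [H.a_leviEnd, H.a_U, H.a_U])
      (by rw [H.p_leviEnd, H.p_U, H.p_U, map_zero])
      (by rw [H.star_leviEnd, D.star_U, D.star_U]; rfl))

theorem leviLift_apply (M : GeneralLinearGroup ℚ D.U) (γ : orthogonalGroup D.formW) (v : V) :
    (H.leviLift M γ).1.1 v = H.leviEnd M γ v := rfl

theorem actU_leviLift (M : GeneralLinearGroup ℚ D.U) (γ : orthogonalGroup D.formW) :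
    D.actU (H.leviLift M γ) = M := D.actU_mkP _ _ _ _

theorem actW_leviLift (M : GeneralLinearGroup ℚ D.U) (γ : orthogonalGroup D.formW) :
    D.actW (H.leviLift M γ) = γ.1 := by
  rw [actW_eq_iff]
  intro z
  rw [← H.p_perp, ← H.p_perp]
  exact H.p_leviEnd M γ z

theorem levi_leviLift (M : GeneralLinearGroup ℚ D.U) (γ : orthogonalGroup D.formW) :
    D.levi (H.leviLift M γ) = (M, γ) :=
  (D.levi_eq_iff _ _ _).2 ⟨H.actU_leviLift M γ, H.actW_leviLift M γ⟩

theorem leviLift_preserves (M : GeneralLinearGroup ℚ D.U) (γ : orthogonalGroup D.formW) (v : V) :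
    (H.leviLift M γ).1.1 v ∈ D.U ⊔ tildeU T ↔ v ∈ D.U ⊔ tildeU T := by
  rw [H.mem_sup_tildeU_iff, H.mem_sup_tildeU_iff, H.leviLift_apply, H.p_leviEnd]
  constructor
  · intro h
    rw [← inv_apply_self γ.1 (H.p v), h, map_zero]
  · intro h
    rw [h, map_zero]

/-- A factors into a lift of its action on U, the block lift of its action on W, and a unipotent
remainder. Each factor lies in the identity component. -/
theorem mem_parabolicPlus (H : D.Splitting T) {A : D.P} (h1 : LinearMap.det (D.actU A).1 = 1)
    (h2 : D.actW A ∈ specialOrthPlus D.formW) : A.1 ∈ parabolicPlus D.form D.U := by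
  obtain ⟨A₁, hA₁, hA₁U, hA₁W⟩ := D.exists_parabolicPlus_lift_SL _ h1
  let A₂ := H.leviLift 1 ⟨D.actW A, D.actW_mem A⟩
  have hA₂ : A₂.1 ∈ parabolicPlus D.form D.U :=
    H.subquotientSplitting.lift_mem_parabolicPlus D.symm h2 A₂.1 fun x => by
      have h := H.decomp x
      change (H.a x : V) + H.s ((D.actW A).1 (H.p x)) + H.τ (D.star x) = _
      conv_rhs => rw [← h]
      simp only [map_add, map_sub, H.p_U, H.p_s, H.p_τ, zero_add, add_zero]
      abel
  have h3 : (A₁ * A₂)⁻¹ * A ∈ D.unipotentRadical := by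
    rw [mem_unipotentRadical_iff, map_mul, map_mul, map_inv, map_inv, map_mul, map_mul, hA₁U, hA₁W,
      H.actU_leviLift, H.actW_leviLift]
    simp
  have h4 : A.1 = A₁.1 * A₂.1 * ((A₁ * A₂)⁻¹ * A).1 := by
    change A.1 = ((A₁ * A₂) * ((A₁ * A₂)⁻¹ * A) : D.P).1
    rw [mul_inv_cancel_left]
  rw [h4]
  exact mul_mem (mul_mem hA₁ hA₂) (parabolicPlus_of_mem_unipotentRadical h3)

theorem actW_mem_specialOrthPlus (H : D.Splitting T) {A : D.P}
    (h : A.1 ∈ parabolicPlus D.form D.U) :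
    D.actW A ∈ specialOrthPlus D.formW :=
  H.subquotientSplitting.quotient_mem_specialOrthPlus D.symm h _ fun w => by
    rw [H.p_apply A ⟨H.s w, H.s_perp w⟩, H.toW_s]

/-- The endomorphism that belongs to an element of the rational Heisenberg group. -/
noncomputable def heisEnd (h : D.Heis) : Module.End ℚ V :=
  LinearMap.id + H.s ∘ₗ D.adj h.fst ∘ₗ D.star -
    D.U.subtype ∘ₗ (h.fst ∘ₗ H.p + ((2⁻¹ : ℚ) • h.fst ∘ₗ D.adj h.fst + h.snd.1) ∘ₗ D.star)

theorem heisEnd_apply (h : D.Heis) (v : V) :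
    H.heisEnd h v = v + H.s (D.adj h.fst (D.star v)) - (h.fst (H.p v) +
      ((2⁻¹ : ℚ) • h.fst (D.adj h.fst (D.star v)) + h.snd.1 (D.star v)) : D.U) := rfl

theorem a_heisEnd (h : D.Heis) (v : V) :
    H.a (H.heisEnd h v) = H.a v - (h.fst (H.p v) +
      ((2⁻¹ : ℚ) • h.fst (D.adj h.fst (D.star v)) + h.snd.1 (D.star v))) := by
  rw [heisEnd_apply, map_sub, map_add, H.a_U, H.a_s, add_zero]

theorem p_heisEnd (h : D.Heis) (v : V) :
    H.p (H.heisEnd h v) = H.p v + D.adj h.fst (D.star v) := by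
  rw [heisEnd_apply, map_sub, map_add, H.p_U, H.p_s, sub_zero]

theorem star_heisEnd (h : D.Heis) (v : V) : D.star (H.heisEnd h v) = D.star v := by
  rw [heisEnd_apply, map_sub, map_add, D.star_U, H.star_s, sub_zero, add_zero]

/-- The element of the unipotent radical with given Heisenberg coordinates. -/
noncomputable def heis (h : D.Heis) : D.P :=
  D.mkP (H.heisEnd h)
    (fun x y => by
      -- Antisymmetry of η removes its contribution to the form, and ½ψψ* is what compensates for
      -- (ψ*f, ψ*g).
      have h1 := h.snd.2 (D.star x) (D.star y)
      have h2 := fun f g => D.formW_adj h.fst f (D.adj h.fst g)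
      have h3 := D.formW_symm.eq (D.adj h.fst (D.star x)) (D.adj h.fst (D.star y))
      have h4 := D.formW_symm.eq (D.adj h.fst (D.star y)) (H.p x)
      rw [H.form_eq, H.a_heisEnd, H.a_heisEnd, H.p_heisEnd, H.p_heisEnd, H.star_heisEnd,
        H.star_heisEnd, H.form_eq x y]
      simp only [map_add, map_sub, map_smul, LinearMap.add_apply, ← D.formW_adj, smul_eq_mul]
      linarith)
    1
    (fun u => H.ext_coord (by rw [H.a_heisEnd, D.star_U, H.p_U]; simp)
      (by rw [H.p_heisEnd, D.star_U, map_zero, add_zero]; rfl)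
      (by rw [H.star_heisEnd]; rfl))

theorem heis_apply (h : D.Heis) (v : V) : (H.heis h).1.1 v = H.heisEnd h v := rfl

theorem heis_apply_perp (h : D.Heis) (z : D.Uperp) :
    (H.heis h).1.1 z = z - (h.fst (D.toW z) : D.U) := by
  rw [heis_apply, heisEnd_apply, star_perp, H.p_perp]
  simp

theorem heis_mem (h : D.Heis) : H.heis h ∈ D.unipotentRadical := by
  rw [mem_unipotentRadical_iff]
  refine ⟨D.actU_mkP _ _ _ _, (D.actW_eq_iff _ _).2 fun z => ?_⟩
  rw [← H.p_perp, ← H.p_perp]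
  change H.p (H.heisEnd h z) = H.p z
  rw [H.p_heisEnd, star_perp, map_zero, add_zero]

/-- Composition produces the cross term ψφ*, whereas ½(ψ+φ)(ψ+φ)* contains only ½(ψφ* + φψ*). The
difference is the bracket. -/
theorem heis_mul (h k : D.Heis) : H.heis (h * k) = H.heis h * H.heis k := by
  refine D.P_ext fun v => ?_
  change H.heisEnd (h * k) v = H.heisEnd h (H.heisEnd k v)
  refine H.ext_coord ?_ ?_ ?_
  · simp only [H.a_heisEnd, H.p_heisEnd, H.star_heisEnd, Heisenberg.mul_fst, Heisenberg.mul_snd,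
      map_add, LinearMap.add_apply, Submodule.coe_add, bracket_apply]
    module
  · simp only [H.p_heisEnd, H.star_heisEnd, Heisenberg.mul_fst, map_add, LinearMap.add_apply]
    abel
  · simp only [H.star_heisEnd]

theorem heis_injective : Function.Injective H.heis := by
  intro h k hhk
  have h1 : ∀ v, H.heisEnd h v = H.heisEnd k v := fun v => by
    rw [← heis_apply, hhk, heis_apply]
  have h2 : h.fst = k.fst := LinearMap.ext fun w => by
    have := congrArg H.a (h1 (H.s w))
    rw [H.a_heisEnd, H.a_heisEnd, H.star_s, H.p_s] at this
    simpa using this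
  refine Heisenberg.ext h2 (Subtype.ext (LinearMap.ext fun f => ?_))
  have := congrArg H.a (h1 (H.τ f))
  rw [H.a_heisEnd, H.a_heisEnd, H.star_τ, H.p_τ, h2] at this
  simpa using this

/-- ψ is read off from A on W̃. Preservation of the pairing between W̃ and the image of `τ` forces
the W-component of A τ f to be ψ*f, and isotropy of that image forces κ - ½ψψ* to be antisymmetric.
-/
theorem exists_heis {A : D.P} (hA : A ∈ D.unipotentRadical) : ∃ h, H.heis h = A := by
  rw [mem_unipotentRadical_iff] at hA
  have hU : ∀ u : D.U, A.1.1 u = u := (D.actU_eq_iff A 1).1 hA.1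
  have hstar : ∀ v, D.star (A.1.1 v) = D.star v := fun v => by
    rw [star_P, hA.1, inv_one]; rfl
  have hps : ∀ w, H.p (A.1.1 (H.s w)) = w := fun w => by
    rw [H.p_apply A ⟨H.s w, H.s_perp w⟩, H.toW_s, hA.2]; rfl
  let ψ : D.W →ₗ[ℚ] D.U := -(H.a ∘ₗ A.1.1 ∘ₗ H.s)
  have hψ : ∀ w, H.a (A.1.1 (H.s w)) = - ψ w := fun w => (neg_neg _).symm
  have hadj : ∀ f, H.p (A.1.1 (H.τ f)) = D.adj ψ f := fun f => by
    rw [← sub_eq_zero]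
    refine D.formW_nondegenerate.1 _ fun w => ?_
    have h1 := A.2.1 (H.τ f) (H.s w)
    rw [H.form_eq, H.form_eq (H.τ f), hstar, hstar, H.star_s, H.star_τ, hψ, hps, H.p_τ,
      H.a_s] at h1
    rw [map_sub, LinearMap.sub_apply, D.formW_adj]
    simp only [map_neg, map_zero, LinearMap.zero_apply] at h1
    linarith
  let κ : Module.Dual ℚ D.U →ₗ[ℚ] D.U := -(H.a ∘ₗ A.1.1 ∘ₗ H.τ)
  have hκ : ∀ f, H.a (A.1.1 (H.τ f)) = - κ f := fun f => (neg_neg _).symm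
  have hη : κ - (2⁻¹ : ℚ) • ψ ∘ₗ D.adj ψ ∈ D.homAs := fun f g => by
    have h1 := A.2.1 (H.τ f) (H.τ g)
    have h3 := D.formW_symm.eq (D.adj ψ f) (D.adj ψ g)
    rw [H.form_eq, H.form_eq (H.τ f), hstar, hstar, H.star_τ, H.star_τ, hκ, hκ, hadj, hadj,
      H.p_τ, H.a_τ, H.a_τ] at h1
    simp only [map_neg, map_zero, LinearMap.zero_apply] at h1
    simp only [LinearMap.sub_apply, LinearMap.smul_apply, LinearMap.comp_apply, map_sub, map_smul,
      ← D.formW_adj, smul_eq_mul]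
    linarith
  refine ⟨⟨ψ, ⟨_, hη⟩⟩, D.P_ext fun v => ?_⟩
  rw [heis_apply]
  conv_rhs => rw [← H.decomp v]
  rw [map_add, map_add, hU]
  refine H.ext_coord ?_ ?_ ?_
  · rw [H.a_heisEnd, map_add, map_add, hψ, hκ, H.a_U]
    simp only [LinearMap.sub_apply, LinearMap.smul_apply, LinearMap.comp_apply]
    abel
  · rw [H.p_heisEnd, map_add, map_add, hps, hadj, H.p_U, zero_add]
  · rw [H.star_heisEnd, map_add, map_add, hstar, hstar, D.star_U, H.star_s, H.star_τ]
    simp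

/-- The displacement of a vector depends only on its images in W and U*, so the formula on Ũ is the
same as on the isotropic complement. -/
theorem heis_hasHeisCoord (h : D.Heis) : D.HasHeisCoord T (H.heis h) h := by
  refine ⟨(D.actU_eq_iff _ 1).1 ((D.mem_unipotentRadical_iff _).1 (H.heis_mem h)).1, fun w => ?_,
    fun t ht => ?_⟩
  · exact H.heis_apply_perp h ⟨w, D.tildeW_le T w.2⟩
  · refine ⟨⟨_, H.s_mem (D.adj h.fst (D.star t))⟩, ?_, ?_⟩
    · exact H.toW_s _
    · have hp : H.p t = 0 := (H.mem_sup_tildeU_iff t).1 (Submodule.mem_sup_right ht)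
      rw [heis_apply, heisEnd_apply, hp, map_zero, zero_add]

theorem hasHeisCoord_unique (H : D.Splitting T) {A B : D.P} {h : D.Heis} (hA : D.HasHeisCoord T A h)
    (hB : D.HasHeisCoord T B h) : A = B := by
  obtain ⟨hA1, hA2, hA3⟩ := hA
  obtain ⟨hB1, hB2, hB3⟩ := hB
  refine D.P_ext fun v => ?_
  have h1 : ∀ w, A.1.1 (H.s w) = B.1.1 (H.s w) := fun w =>
    (hA2 ⟨_, H.s_mem w⟩).trans (hB2 ⟨_, H.s_mem w⟩).symm
  have h2 : ∀ t ∈ tildeU T, A.1.1 t = B.1.1 t := fun t ht => by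
    obtain ⟨w, hw, e⟩ := hA3 t ht
    obtain ⟨w', hw', e'⟩ := hB3 t ht
    rw [e, e', ← H.s_tilde w, ← H.s_tilde w', hw, hw']
  have h3 := h2 _ (H.mem_tildeU (D.star v))
  rw [map_add, map_add, hA1, hB1] at h3
  rw [← H.decomp v]
  simp only [map_add, hA1, hB1, h1, add_right_cancel h3]

theorem eq_heis_iff (A : D.P) (h : D.Heis) : H.heis h = A ↔ D.HasHeisCoord T A h := by
  constructor
  · rintro rfl
    exact H.heis_hasHeisCoord h
  · exact fun hA => H.hasHeisCoord_unique (H.heis_hasHeisCoord h) hA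

end Splitting

end IsotropicDatum

/-! ### Lifting into the discriminant kernel -/

namespace IsotropicDatum

variable {V : Type*} [AddCommGroup V] [Module ℚ V] {D : IsotropicDatum V}

theorem SL_inv_sub_mem {J : Submodule ℤ D.U} {M : GeneralLinearGroup ℚ D.U} (hM : M ∈ D.SL J)
    {u : D.U} (hu : u ∈ J) : u - (M⁻¹).1 u ∈ D.I :=
  (inv_mem hM).2.2 u hu

theorem comp_mem_Idual {J : Submodule ℤ D.U} {M : GeneralLinearGroup ℚ D.U} (hM : M ∈ D.SL J)
    {f : Module.Dual ℚ D.U} (hf : f ∈ D.Idual) : f ∘ₗ M.1 ∈ D.Idual :=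
  fun i hi => hf _ ((hM.1 i).2 hi)

theorem stableOrthogonal_dual_mem {γ : GeneralLinearGroup ℚ D.W}
    (hγ : γ ∈ stableOrthogonal D.formW D.Lam) {x : D.W} (hx : x ∈ D.LamDual) :
    γ.1 x ∈ D.LamDual := by
  have h := add_mem (D.Lam_le_dual (hγ.2.2 x hx)) hx
  rwa [sub_add_cancel] at h

theorem form_inv_P (A : D.P) (x y : V) : D.form (A.1.1 x) y = D.form x (A⁻¹.1.1 y) := by
  rw [D.form_comm x, P_inv_form, D.form_comm y]

theorem P_apply_inv (A : D.P) (x : V) : A.1.1 (A⁻¹.1.1 x) = x := apply_inv_self A.1 x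

theorem P_inv_apply (A : D.P) (x : V) : A⁻¹.1.1 (A.1.1 x) = x := inv_apply_self A.1 x

variable {T : Submodule ℤ V}

namespace Splitting

variable (H : D.Splitting T)

/-- The section of `star` with values in `Ũ`. -/
noncomputable def t : Module.Dual ℚ D.U →ₗ[ℚ] V := H.τ + D.U.subtype ∘ₗ H.σ

theorem t_apply (f : Module.Dual ℚ D.U) : H.t f = H.τ f + H.σ f := rfl

theorem star_t (f : Module.Dual ℚ D.U) : D.star (H.t f) = f := by
  rw [t_apply, map_add, H.star_τ, D.star_U, add_zero]

theorem p_t (f : Module.Dual ℚ D.U) : H.p (H.t f) = 0 := by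
  rw [t_apply, map_add, H.p_τ, H.p_U, add_zero]

theorem t_mem_Ldual (hT : D.IsUnimodularComplement T) {f : Module.Dual ℚ D.U}
    (hf : f ∈ D.Idual) : H.t f ∈ D.Ldual := hT.le_dual (H.mem_T f hf)

theorem form_t_perp (f : Module.Dual ℚ D.U) (z : D.Uperp) : D.form (H.t f) z = f (H.a z) := by
  rw [H.form_eq, star_perp, H.star_t, H.p_t]
  simp

/-- Elements of L* restrict to I*, and Ĩ ⊂ L* realizes all of I*. So integrality can be tested on Ĩ
and on L* ∩ U^⊥. -/
theorem exists_t_add {x : V} (hT : D.IsUnimodularComplement T) (hx : x ∈ D.Ldual) :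
    ∃ f ∈ D.Idual, ∃ z : D.Uperp, (z : V) ∈ D.Ldual ∧ x = H.t f + z := by
  have hf := D.star_mem_Idual hx
  have hz : x - H.t (D.star x) ∈ D.Uperp := by
    rw [← star_eq_zero_iff, map_sub, H.star_t, sub_self]
  exact ⟨_, hf, ⟨_, hz⟩, sub_mem hx (H.t_mem_Ldual hT hf), (add_sub_cancel _ _).symm⟩

end Splitting

variable [FiniteDimensional ℚ V]

/-- If `A ∈ P_U` acts trivially on `(L* ∩ U^⊥) / (L ∩ U^⊥)`, then so does its inverse. -/
theorem inv_apply_sub_mem_L {A : D.P} (hM : D.actU A ∈ D.SL D.ILdual)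
    (hγ : D.actW A ∈ stableOrthogonal D.formW D.Lam)
    (hN : ∀ z : D.Uperp, (z : V) ∈ D.Ldual → A.1.1 z - z ∈ D.L) (y : D.Uperp)
    (hy : (y : V) ∈ D.Ldual) : A⁻¹.1.1 y - y ∈ D.L := by
  -- Choose z over γ⁻¹ of the class of y. Then Az - y lies in I_{L*}, where A⁻¹ is trivial modulo I,
  -- and A⁻¹y - y is the sum of -(Az - z) and (Az - y) - A⁻¹(Az - y).
  obtain ⟨z, hz, hzy⟩ := D.exists_lift_LamDual
    (stableOrthogonal_dual_mem (inv_mem hγ) (D.toW_mem_LamDual hy))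
  have h1 : A.1.1 z - y ∈ D.U := by
    have h : D.toW ⟨A.1.1 z, D.P_mem_Uperp A z z.2⟩ = D.toW y := by
      rw [← actW_toW, hzy, apply_inv_self]
    exact (Submodule.Quotient.eq (D.U.submoduleOf D.Uperp)).1 h
  have h2 := hN z hz
  have h3 : (⟨_, h1⟩ : D.U) ∈ D.ILdual := by
    change A.1.1 z - y ∈ D.Ldual
    have h := sub_mem (add_mem (D.L_le_Ldual h2) hz) hy
    rwa [sub_add_cancel] at h
  have h4 : (A.1.1 z - y) - A⁻¹.1.1 (A.1.1 z - y) ∈ D.L := by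
    have h := SL_inv_sub_mem hM h3
    rw [← map_inv] at h
    exact h
  rw [map_sub, P_inv_apply] at h4
  have h5 := add_mem (neg_mem h2) h4
  convert h5 using 1
  abel

namespace Splitting

variable (H : D.Splitting T)

/-- Ĩ ⊂ L* pairs integrally with z and sees only its U-component. Hence L ∩ U^⊥ is the sum of I and
the copy of Λ in W̃. -/
theorem a_mem_I (hT : D.IsUnimodularComplement T) {z : D.Uperp} (hz : (z : V) ∈ D.L) :
    H.a z ∈ D.I := D.mem_I_of_pairing fun f hf => by
  rw [← form_t_perp]
  exact H.t_mem_Ldual hT hf _ hz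

theorem s_mem_L (hT : D.IsUnimodularComplement T) {w : D.W} (hw : w ∈ D.Lam) : H.s w ∈ D.L := by
  obtain ⟨z, hz, rfl⟩ := hw
  have h1 : (H.a z : V) ∈ D.L := H.a_mem_I hT hz
  have h2 : (z : V) - H.a z ∈ D.L := sub_mem hz h1
  have h3 := H.decomp_perp z
  rwa [← eq_sub_iff_add_eq'.2 h3] at h2

/-- An element of `P_U` that acts as it should on `U`, `W` and `L* ∩ U^⊥` can be corrected by an
element of the center so that it acts trivially on `L* / L`. -/
theorem exists_homAs_stable (H : D.Splitting T) (hT : D.IsUnimodularComplement T) {A : D.P}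
    (hM : D.actU A ∈ D.SL D.ILdual) (hγ : D.actW A ∈ stableOrthogonal D.formW D.Lam)
    (hN : ∀ z : D.Uperp, (z : V) ∈ D.Ldual → A.1.1 z - z ∈ D.L) :
    ∃ η ∈ D.homAs, ∀ A' : D.P, (∀ v, A'.1.1 v = A.1.1 v - (η (D.star (A.1.1 v)) : D.U)) →
      A'.1 ∈ stableOrthogonal D.form D.L := by
  let M := D.actU A
  have hstar : ∀ f, D.star (A.1.1 (H.t (f ∘ₗ M.1))) = f := fun f => by
    rw [star_P, H.star_t]
    exact LinearMap.ext fun u => congrArg f (apply_inv_self M u)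
  have hpair : ∀ f ∈ D.Idual, ∀ y : D.Uperp, (y : V) ∈ D.Ldual →
      D.form (A.1.1 (H.t (f ∘ₗ M.1)) - H.t (f ∘ₗ M.1)) y ∈ (1 : Submodule ℤ ℚ) := by
    intro f hf y hy
    rw [map_sub, LinearMap.sub_apply, form_inv_P, ← map_sub]
    exact H.t_mem_Ldual hT (comp_mem_Idual hM hf) _ (inv_apply_sub_mem_L hM hγ hN y hy)
  -- `d` is the error of A on Ũ, indexed by the functional of the image vector, since η is applied
  -- after A. The form `q` records its pairings with Ũ.
  let d : Module.Dual ℚ D.U →ₗ[ℚ] V := (A.1.1 - 1) ∘ₗ H.t ∘ₗ M.1.dualMap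
  have hd : ∀ f, d f = A.1.1 (H.t (f ∘ₗ M.1)) - H.t (f ∘ₗ M.1) := fun f => rfl
  let q : Module.Dual ℚ D.U →ₗ[ℚ] Module.Dual ℚ D.U →ₗ[ℚ] ℚ := (D.form ∘ₗ d).compl₂ H.t
  have hq : ∀ f g, q f g = D.form (d f) (H.t g) := fun f g => rfl
  have hUt : ∀ (u : D.U) g, D.form u (H.t g) = g u := fun u g => by
    rw [D.form_comm, ← star_apply, H.star_t]
  have hUz : ∀ (u : D.U) (z : D.Uperp), D.form u z = 0 := fun u z => z.2 u u.2
  have hqf : ∀ f ∈ D.Idual, q f f ∈ (1 : Submodule ℤ ℚ) := by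
    intro f hf
    obtain ⟨u, hu⟩ : ∃ u : D.U, ∀ g, g u = D.form (d f) (H.t g) :=
      ⟨(Module.evalEquiv ℚ D.U).symm (D.form (d f) ∘ₗ H.t), fun g => by
        rw [← Module.Dual.eval_apply ℚ]
        exact LinearMap.congr_fun ((Module.evalEquiv ℚ D.U).apply_symm_apply _) g⟩
    have h0 : ∀ g, D.form (d f - u) (H.t g) = 0 := fun g => by
      rw [map_sub, LinearMap.sub_apply, hUt, hu, sub_self]
    -- Once its pairings with Ũ are cancelled by u ∈ U, the error lies in L and so has even norm 2n.
    -- Expanding the norm with A isometric gives 2n = -2 q(f, f).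
    have hL : d f - u ∈ D.L := D.mem_L_of_pairing fun y hy => by
      obtain ⟨g, hg, z, hz, rfl⟩ := H.exists_t_add hT hy
      rw [map_add, h0, zero_add, map_sub, LinearMap.sub_apply, hUz, sub_zero]
      exact hpair f hf z hz
    obtain ⟨n, hn⟩ := D.even _ hL
    have hx : A.1.1 (H.t (f ∘ₗ M.1)) - H.t f ∈ D.Uperp := by
      rw [← star_eq_zero_iff, map_sub, hstar, H.star_t, sub_self]
    have e1 := h0 f
    have e2 := h0 (f ∘ₗ M.1)
    have e3 := hUz u ⟨_, hx⟩
    have e4 := D.form_U_U u u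
    have e5 := A.2.1 (H.t (f ∘ₗ M.1)) (H.t (f ∘ₗ M.1))
    rw [hq]
    refine mem_one_int.2 ⟨-n, ?_⟩
    push_cast
    rw [hd] at hn e1 e2 ⊢
    set As := A.1.1 (H.t (f ∘ₗ M.1))
    set s := H.t (f ∘ₗ M.1)
    have c1 := D.form_comm As s
    have c2 := D.form_comm As (H.t f)
    have c3 := D.form_comm s (H.t f)
    have c4 := D.form_comm As u
    have c5 := D.form_comm s u
    have c6 := D.form_comm (H.t f) u
    simp only [map_sub, LinearMap.sub_apply] at hn e1 e2 e3 e4 e5 ⊢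
    linarith
  obtain ⟨η, hη, hηq⟩ := D.exists_homAs_congr q hqf
  refine ⟨η, hη, fun A' hA' => (D.stableOrthogonal_iff A'.2.1).2 fun x hx => ?_⟩
  obtain ⟨g', hg', z, hz, rfl⟩ := H.exists_t_add hT hx
  have h1 : A'.1.1 z - z ∈ D.L := by
    rw [hA', star_perp ⟨_, D.P_mem_Uperp A z z.2⟩, map_zero]
    simpa using hN z hz
  have h2 : A'.1.1 (H.t g') - H.t g' ∈ D.L := by
    obtain ⟨f, hf, rfl⟩ : ∃ f ∈ D.Idual, g' = f ∘ₗ M.1 :=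
      ⟨g' ∘ₗ (M⁻¹).1, comp_mem_Idual (inv_mem hM) hg', LinearMap.ext fun u =>
        congrArg g' (inv_apply_self M u).symm⟩
    refine D.mem_L_of_pairing fun y hy => ?_
    obtain ⟨g, hg, z, hz, rfl⟩ := H.exists_t_add hT hy
    have e : A'.1.1 (H.t (f ∘ₗ M.1)) - H.t (f ∘ₗ M.1) = d f - η f := by
      rw [hA', hstar, hd]
      abel
    rw [e, map_add]
    refine add_mem ?_ ?_
    · rw [map_sub, LinearMap.sub_apply, hUt]
      exact hηq f hf g hg
    · rw [map_sub, LinearMap.sub_apply, hUz, sub_zero]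
      exact hpair f hf z hz
  have h3 := add_mem h2 h1
  convert h3 using 1
  rw [map_add]
  abel

end Splitting

theorem mem_Gam_iff (A : D.P) : A ∈ D.Gam ↔
    A.1 ∈ stableOrthogonal D.form D.L ∧ A.1 ∈ parabolicPlus D.form D.U :=
  ⟨fun h => ⟨h.1.1, h.2⟩, fun h => ⟨⟨h.1, parabolicPlus_le_specialOrthPlus _ _ h.2⟩, h.2⟩⟩

/-- The determinant on U is positive in the identity component, and ±1 because I is preserved. -/
theorem actU_mem_SL {A : D.P} (hA : A ∈ D.Gam) : D.actU A ∈ D.SL D.ILdual := by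
  have := D.I_isLattice
  rw [mem_Gam_iff] at hA
  have h1 : ∀ u, (D.actU A).1 u ∈ D.I ↔ u ∈ D.I := fun u => hA.1.2.1 u
  refine ⟨h1, det_of_preserves_lattice D.I _ h1
    (det_pos_of_mem_parabolicPlus hA.2 _ fun u => rfl), fun u hu => ?_⟩
  rw [← neg_sub]
  exact neg_mem (hA.1.2.2 u hu)

namespace Splitting

variable (H : D.Splitting T)

theorem actW_mem_GamLam (H : D.Splitting T) {A : D.P} (hA : A ∈ D.Gam) :
    (⟨D.actW A, D.actW_mem A⟩ : orthogonalGroup D.formW) ∈ D.GamLam := by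
  rw [mem_Gam_iff] at hA
  have hL : ∀ B : D.P, (∀ x, B.1.1 x ∈ D.L ↔ x ∈ D.L) → ∀ x ∈ D.Lam, (D.actW B).1 x ∈ D.Lam := by
    rintro B hB _ ⟨z, hz, rfl⟩
    exact ⟨⟨_, D.P_mem_Uperp B z z.2⟩, (hB z).2 hz, rfl⟩
  refine ⟨⟨D.actW_mem A, fun x => ⟨fun hx => ?_, hL A hA.1.2.1 x⟩, fun x hx => ?_⟩,
    H.actW_mem_specialOrthPlus hA.2⟩
  · have h := hL A⁻¹ (inv_mem hA.1).2.1 _ hx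
    rw [map_inv] at h
    change ((D.actW A)⁻¹).1 ((D.actW A).1 x) ∈ D.Lam at h
    rwa [inv_apply_self] at h
  · obtain ⟨z, hz, rfl⟩ := D.exists_lift_LamDual hx
    change (D.actW A).1 (D.toW z) - D.toW z ∈ D.Lam
    rw [actW_toW, ← map_sub]
    exact ⟨_, hA.1.2.2 _ hz, rfl⟩

theorem heis_zero_apply (η : D.homAs) : (H.heis ⟨0, η⟩).1.1 = D.transEnd η.1 := by
  refine LinearMap.ext fun v => ?_
  rw [heis_apply, heisEnd_apply, transEnd_apply, map_zero]
  simp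

theorem heis_zero_mem_center (η : D.homAs) : H.heis ⟨0, η⟩ ∈ D.center :=
  ⟨η.1, η.2, H.heis_zero_apply η⟩

/-- Existence of lifts to `Γ_{L,I}`, up to the center. -/
theorem exists_center_mul_mem_Gam (H : D.Splitting T) (hT : D.IsUnimodularComplement T) {A : D.P}
    (hM : D.actU A ∈ D.SL D.ILdual)
    (hγ : (⟨D.actW A, D.actW_mem A⟩ : orthogonalGroup D.formW) ∈ D.GamLam)
    (hN : ∀ z : D.Uperp, (z : V) ∈ D.Ldual → A.1.1 z - z ∈ D.L) :
    ∃ c ∈ D.center, c * A ∈ D.Gam := by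
  obtain ⟨η, hη, h⟩ := H.exists_homAs_stable hT hM hγ.1 hN
  have hc := H.heis_zero_mem_center ⟨η, hη⟩
  refine ⟨_, hc, (mem_Gam_iff _).2 ⟨h _ fun v => ?_, H.mem_parabolicPlus ?_ ?_⟩⟩
  · change (H.heis ⟨0, ⟨η, hη⟩⟩).1.1 (A.1.1 v) = _
    rw [heis_zero_apply, transEnd_apply]
  · rw [map_mul, ((D.mem_unipotentRadical_iff _).1 (D.center_le hc)).1, one_mul]
    exact hM.2.1
  · rw [map_mul, ((D.mem_unipotentRadical_iff _).1 (D.center_le hc)).2, one_mul]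
    exact hγ.2

/-- Identity components impose nothing on unipotent elements, so only L*/L matters. On L* ∩ U^⊥ the
condition is ψ(Λ*) ⊆ I; on Ĩ it is that ½ψψ* + η maps I* to I, because ψ*f already lies in Λ. -/
theorem heis_mem_Gam_iff (hT : D.IsUnimodularComplement T) (h : D.Heis) :
    H.heis h ∈ D.Gam ↔ h ∈ D.integralHeis := by
  rw [mem_Gam_iff, D.stableOrthogonal_iff (H.heis h).2.1,
    and_iff_left (parabolicPlus_of_mem_unipotentRadical (H.heis_mem h))]
  have ht : ∀ f, (H.heis h).1.1 (H.t f) - H.t f = H.s (D.adj h.fst f) -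
      ((2⁻¹ : ℚ) • h.fst (D.adj h.fst f) + h.snd.1 f : D.U) := fun f => by
    rw [heis_apply, heisEnd_apply, H.star_t, H.p_t, map_zero, zero_add]
    abel
  constructor
  · intro hL
    have h1 : h.fst ∈ D.homLattice := fun x hx => by
      obtain ⟨z, hz, rfl⟩ := D.exists_lift_LamDual hx
      have h2 := hL z hz
      rw [heis_apply_perp, sub_sub_cancel_left] at h2
      exact neg_mem_iff.1 h2
    have h3 : ∀ f ∈ D.Idual, (2⁻¹ : ℚ) • h.fst (D.adj h.fst f) + h.snd.1 f ∈ D.I := fun f hf => by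
      have h2 := hL _ (H.t_mem_Ldual hT hf)
      rw [ht] at h2
      have h4 := sub_mem (H.s_mem_L hT (D.adj_mem_Lam h1 hf)) h2
      rw [sub_sub_cancel] at h4
      exact h4
    refine ⟨h1, fun f hf => ?_, h3⟩
    -- 2η = 2(½ψψ* + η) - ψψ*, so the half-integrality of η is automatic.
    have h5 := sub_mem (D.I.smul_mem 2 (h3 f hf)) (h1 _ (D.adj_mem _ h1 f hf))
    convert h5 using 1
    module
  · rintro ⟨h1, _, h3⟩ x hx
    obtain ⟨f, hf, z, hz, rfl⟩ := H.exists_t_add hT hx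
    have h4 : (H.heis h).1.1 (H.t f) - H.t f ∈ D.L := by
      rw [ht]
      exact sub_mem (H.s_mem_L hT (D.adj_mem_Lam h1 hf)) (h3 f hf)
    have h5 : (H.heis h).1.1 z - z ∈ D.L := by
      rw [heis_apply_perp, sub_sub_cancel_left]
      exact neg_mem (h1 _ (D.toW_mem_LamDual hz))
    have h6 := add_mem h4 h5
    convert h6 using 1
    rw [map_add]
    abel

end Splitting

end IsotropicDatum

/-! ### The quotient by the center and the two exact sequences -/

namespace IsotropicDatum

variable {V : Type*} [AddCommGroup V] [Module ℚ V] {D : IsotropicDatum V}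

theorem center_apply_perp {c : D.P} (hc : c ∈ D.center) (z : D.Uperp) : c.1.1 z = z := by
  obtain ⟨η, _, h⟩ := hc
  rw [h, transEnd_apply, Splitting.star_perp]
  simp

theorem leviBar_mk (A : D.P) : D.leviBar (A : D.Pbar) = D.levi A := rfl

theorem mk_center_mul {c : D.P} (hc : c ∈ D.center) (A : D.P) :
    ((c * A : D.P) : D.Pbar) = (A : D.Pbar) := by
  rw [QuotientGroup.mk_mul, (QuotientGroup.eq_one_iff c).2 hc, one_mul]

theorem levi_eq_one_iff (A : D.P) : D.levi A = 1 ↔ A ∈ D.unipotentRadical := Iff.rfl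

theorem mem_unipotentRadical_of_apply_perp {A : D.P} (ψ : D.W →ₗ[ℚ] D.U)
    (h : ∀ z : D.Uperp, (z : V) - A.1.1 z = (ψ (D.toW z) : D.U)) : A ∈ D.unipotentRadical := by
  have h' : ∀ z : D.Uperp, A.1.1 z = z - (ψ (D.toW z) : D.U) := fun z => by
    rw [← h, sub_sub_cancel]
  refine (D.mem_unipotentRadical_iff A).2 ⟨(D.actU_eq_iff A 1).2 fun u => ?_,
    (D.actW_eq_iff A 1).2 fun z => ?_⟩
  · rw [h' ⟨u, D.isotropic u.2⟩, (D.toW_eq_zero_iff _).2 u.2, map_zero]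
    simp
  · refine (Submodule.Quotient.eq (D.U.submoduleOf D.Uperp)).2 ?_
    change A.1.1 z - z ∈ D.U
    rw [h', sub_sub_cancel_left]
    exact neg_mem (Subtype.property _)

variable [FiniteDimensional ℚ V] {T : Submodule ℤ V}

namespace Splitting

variable (H : D.Splitting T)

theorem mem_center_of_apply_perp (H : D.Splitting T) {A : D.P}
    (h : ∀ z : D.Uperp, A.1.1 z = z) : A ∈ D.center := by
  obtain ⟨k, rfl⟩ := H.exists_heis (mem_unipotentRadical_of_apply_perp 0 fun z => by
    rw [h]; simp)
  have h1 : k.fst = 0 := LinearMap.ext fun w => by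
    have h2 := h ⟨H.s w, H.s_perp w⟩
    rw [heis_apply_perp, H.toW_s] at h2
    simpa using h2
  have h2 : k = ⟨0, k.snd⟩ := Heisenberg.ext h1 rfl
  rw [h2]
  exact H.heis_zero_mem_center _

/-- The center is exactly the kernel of restriction to U^⊥: a unipotent element that is trivial
there has ψ = 0. -/
theorem mk_eq_mk_iff (H : D.Splitting T) (A B : D.P) :
    (A : D.Pbar) = (B : D.Pbar) ↔ ∀ z : D.Uperp, A.1.1 z = B.1.1 z := by
  rw [QuotientGroup.eq]
  constructor
  · intro h z
    have h1 := congrArg A.1.1 (center_apply_perp h z)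
    change A.1.1 (A⁻¹.1.1 (B.1.1 z)) = A.1.1 z at h1
    rw [P_apply_inv] at h1
    exact h1.symm
  · intro h
    refine H.mem_center_of_apply_perp fun z => ?_
    change A⁻¹.1.1 (B.1.1 z) = z
    rw [← h, P_inv_apply]

theorem leviLift_apply_perp (M : GeneralLinearGroup ℚ D.U) (γ : orthogonalGroup D.formW)
    (z : D.Uperp) : (H.leviLift M γ).1.1 z = (M.1 (H.a z) : D.U) + H.s (γ.1.1 (D.toW z)) := by
  rw [leviLift_apply, leviEnd_apply, star_perp, H.p_perp, LinearMap.zero_comp, map_zero, add_zero]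

theorem leviLift_mul (M M' : GeneralLinearGroup ℚ D.U) (γ γ' : orthogonalGroup D.formW) :
    H.leviLift (M * M') (γ * γ') = H.leviLift M γ * H.leviLift M' γ' := by
  refine D.P_ext fun v => ?_
  change H.leviEnd (M * M') (γ * γ') v = H.leviEnd M γ (H.leviEnd M' γ' v)
  refine H.ext_coord ?_ ?_ ?_
  · rw [H.a_leviEnd, H.a_leviEnd, H.a_leviEnd]; rfl
  · rw [H.p_leviEnd, H.p_leviEnd, H.p_leviEnd]; rfl
  · rw [H.star_leviEnd, H.star_leviEnd, H.star_leviEnd, mul_inv_rev]; rfl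

/-- γ moves the W-component by an element of Λ, whose copy in W̃ lies in L; only the U-component can
obstruct. Here `u` is a correction: a value of ψ for general M, zero for M ∈ SL(I_ι, I). -/
theorem leviLift_sub_mem_L (hT : D.IsUnimodularComplement T) {M : GeneralLinearGroup ℚ D.U}
    {γ : orthogonalGroup D.formW} (hγ : γ ∈ D.GamLam) {z : D.Uperp} (hz : (z : V) ∈ D.Ldual)
    {u : D.U} (hu : H.a z - M.1 (H.a z) - u ∈ D.I) :
    (H.leviLift M γ).1.1 z + u - z ∈ D.L := by
  have h1 : H.s (γ.1.1 (D.toW z) - D.toW z) ∈ D.L :=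
    H.s_mem_L hT (hγ.1.2.2 _ (D.toW_mem_LamDual hz))
  have h2 : ((H.a z - M.1 (H.a z) - u : D.U) : V) ∈ D.L := hu
  have h3 := sub_mem h1 h2
  convert h3 using 1
  rw [leviLift_apply_perp]
  conv_lhs => rw [← H.decomp_perp z]
  rw [map_sub]
  push_cast
  have h4 := H.decomp_perp z
  rw [h4]
  nth_rewrite 2 [← h4]
  abel

/-- The class of the Levi lift is characterized by preserving `U ⊕ Ũ`. -/
theorem mk_leviLift_eq_iff (M : GeneralLinearGroup ℚ D.U) (γ : orthogonalGroup D.formW)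
    (A : D.P) : (H.leviLift M γ : D.Pbar) = (A : D.Pbar) ↔
      D.levi A = (M, γ) ∧ ∀ v, A.1.1 v ∈ D.U ⊔ tildeU T ↔ v ∈ D.U ⊔ tildeU T := by
  constructor
  · intro h
    have h1 := congrArg D.leviBar h
    rw [leviBar_mk, leviBar_mk, levi_leviLift] at h1
    refine ⟨h1.symm, fun v => ?_⟩
    obtain ⟨η, _, hη⟩ := QuotientGroup.eq.1 h
    have h2 : A.1.1 v = (H.leviLift M γ).1.1 (v - (η (D.star v) : D.U)) := by
      rw [← transEnd_apply, ← hη]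
      change A.1.1 v = (H.leviLift M γ).1.1 ((H.leviLift M γ)⁻¹.1.1 (A.1.1 v))
      rw [P_apply_inv]
    rw [h2, H.leviLift_preserves, H.mem_sup_tildeU_iff, H.mem_sup_tildeU_iff, map_sub, H.p_U,
      sub_zero]
  · rintro ⟨h1, h2⟩
    obtain ⟨hU, hW⟩ := (D.levi_eq_iff _ _ _).1 h1
    rw [H.mk_eq_mk_iff]
    -- A preserves U ⊕ Ũ, hence also its orthogonal complement W̃; on W̃ it is then determined by γ.
    have hs : ∀ w, A.1.1 (H.s w) = H.s (γ.1.1 w) := fun w => by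
      refine H.ext_coord ?_ ?_ ?_
      · rw [H.a_s, ← Module.forall_dual_apply_eq_zero_iff ℚ]
        intro f
        have h3 : A⁻¹.1.1 (H.t f) ∈ D.U ⊔ tildeU T := by
          rw [← h2, P_apply_inv]
          exact (H.mem_sup_tildeU_iff _).2 (H.p_t f)
        rw [← H.form_t_perp f ⟨_, D.P_mem_Uperp A _ (H.s_perp w)⟩, ← P_inv_form, H.form_eq,
          (H.mem_sup_tildeU_iff _).1 h3, H.star_s, H.a_s]
        simp
      · rw [H.p_apply A ⟨_, H.s_perp w⟩, H.toW_s, H.p_s, hW]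
      · rw [H.star_s, star_P, H.star_s, LinearMap.zero_comp]
    intro z
    rw [leviLift_apply_perp]
    conv_rhs => rw [← H.decomp_perp z]
    rw [map_add, hs, (D.actU_eq_iff A M).1 hU]

/-- Every `(M, γ)` lifts to an element of the parabolic group that acts trivially on
`(L* ∩ U^⊥) / (L ∩ U^⊥)`. -/
theorem exists_levi_eq (H : D.Splitting T) (hT : D.IsUnimodularComplement T)
    {M : GeneralLinearGroup ℚ D.U}
    (hM : M ∈ D.SL D.ILdual) {γ : orthogonalGroup D.formW} (hγ : γ ∈ D.GamLam) :
    ∃ A : D.P, D.levi A = (M, γ) ∧ ∀ z : D.Uperp, (z : V) ∈ D.Ldual → A.1.1 z - z ∈ D.L := by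
  have := D.LamDual_isLattice
  have := Submodule.IsLattice.free ℚ D.LamDual
  let N : Submodule ℤ D.Uperp := D.Ldual.comap (D.Uperp.subtype.restrictScalars ℤ)
  let π : N →ₗ[ℤ] D.LamDual := (D.toW.restrictScalars ℤ).restrict
    fun z hz => D.toW_mem_LamDual hz
  have hπ : Function.Surjective π := fun x => by
    obtain ⟨z, hz, h⟩ := D.exists_lift_LamDual x.2
    exact ⟨⟨z, hz⟩, Subtype.ext h⟩
  -- Λ* is free, so L* ∩ U^⊥ → Λ* has a section. The defect u - Mu along it prescribes the
  -- correction on Λ*.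
  obtain ⟨σ, hσ⟩ := Module.projective_lifting_property π LinearMap.id hπ
  have hσ' : ∀ x, D.toW (σ x).1 = x.1 := fun x =>
    congrArg Subtype.val (LinearMap.congr_fun hσ x)
  let δ : V →ₗ[ℚ] D.U := (LinearMap.id - M.1) ∘ₗ H.a
  have hδ : ∀ v, δ v = H.a v - M.1 (H.a v) := fun v => rfl
  obtain ⟨F, hF⟩ := exists_extend_lattice D.LamDual
    ((δ ∘ₗ D.Uperp.subtype).restrictScalars ℤ ∘ₗ N.subtype ∘ₗ σ)
  -- The correction acts after the Levi lift, when the W-component is already γw, and Heisenberg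
  -- elements subtract ψ; hence γ⁻¹ and the sign.
  let ψ : D.W →ₗ[ℚ] D.U := -(F ∘ₗ (γ⁻¹).1.1)
  have hψ : ∀ w, ψ (γ.1.1 w) = - F w := fun w =>
    congrArg (fun x => - F x) (inv_apply_self γ.1 w)
  refine ⟨H.heis ⟨ψ, 0⟩ * H.leviLift M γ, ?_, fun z hz => ?_⟩
  · rw [map_mul, H.levi_leviLift, (levi_eq_one_iff _).2 (H.heis_mem _), one_mul]
  · let x : D.LamDual := ⟨D.toW z, D.toW_mem_LamDual hz⟩
    -- Replacing z by the chosen lift changes it by an element of I_{L*}, on which the defect u - Mu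
    -- is in I. This is where SL(I_{L*}, I) is used.
    have h1 : (z : V) - (σ x).1 ∈ D.U :=
      (Submodule.Quotient.eq (D.U.submoduleOf D.Uperp)).1 (hσ' x).symm
    have h2 := hM.2.2 ⟨_, h1⟩ (sub_mem hz (σ x).2)
    have h3 : H.a z - M.1 (H.a z) - F (D.toW z) ∈ D.I := by
      have h4 : F (D.toW z) = δ (σ x).1 := hF x
      rw [h4, ← hδ, ← map_sub, hδ]
      rw [← H.a_U ⟨_, h1⟩] at h2
      exact h2
    have h5 := H.leviLift_sub_mem_L hT hγ hz h3
    convert h5 using 2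
    change (H.heis ⟨ψ, 0⟩).1.1 ((H.leviLift M γ).1.1 z) = _
    rw [H.heis_apply_perp _ ⟨_, D.P_mem_Uperp _ z z.2⟩, ← actW_toW, H.actW_leviLift, hψ]
    simp

end Splitting

/-- The natural map `Γ_{L,I} → SL(I_{L*}, I) × Γ_Λ`. -/
noncomputable def gamHom (H : D.Splitting T) : D.Gam →* D.SL D.ILdual × D.GamLam :=
  ((D.actU.comp D.Gam.subtype).codRestrict _ fun A => actU_mem_SL A.2).prod
    (((D.actW.codRestrict _ D.actW_mem).comp D.Gam.subtype).codRestrict _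
      fun A => H.actW_mem_GamLam A.2)

theorem gamHom_eq_iff (H : D.Splitting T) (A : D.Gam) (g : D.SL D.ILdual × D.GamLam) :
    gamHom H A = g ↔ D.levi A.1 = (g.1.1, g.2.1) := by
  rw [Prod.ext_iff, Prod.ext_iff, Subtype.ext_iff, Subtype.ext_iff]
  rfl

theorem gamHom_surjective (H : D.Splitting T) (hT : D.IsUnimodularComplement T) :
    Function.Surjective (gamHom H) := by
  intro g
  obtain ⟨A, hA, hN⟩ := H.exists_levi_eq hT g.1.2 g.2.2
  obtain ⟨hU, hW⟩ := (D.levi_eq_iff _ _ _).1 hA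
  obtain ⟨c, hc, h⟩ := H.exists_center_mul_mem_Gam hT (A := A) (by rw [hU]; exact g.1.2)
    (by have e : (⟨D.actW A, D.actW_mem A⟩ : orthogonalGroup D.formW) = g.2.1 := Subtype.ext hW
        rw [e]; exact g.2.2) hN
  refine ⟨⟨c * A, h⟩, (gamHom_eq_iff H _ _).2 ?_⟩
  change D.levi (c * A) = _
  rw [map_mul, (levi_eq_one_iff _).2 (D.center_le hc), one_mul, hA]

/-- The first short exact sequence. -/
noncomputable def gamExtension (H : D.Splitting T) (hT : D.IsUnimodularComplement T) :
    GroupExtension D.integralHeis D.Gam (D.SL D.ILdual × D.GamLam) where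
  inl := MonoidHom.mk' (fun h => ⟨H.heis h.1, (H.heis_mem_Gam_iff hT h.1).2 h.2⟩)
    fun h k => Subtype.ext (H.heis_mul h.1 k.1)
  rightHom := gamHom H
  inl_injective := fun h k hhk => Subtype.ext (H.heis_injective (congrArg Subtype.val hhk))
  range_inl_eq_ker_rightHom := by
    ext A
    rw [MonoidHom.mem_ker, gamHom_eq_iff]
    constructor
    · rintro ⟨h, rfl⟩
      exact (levi_eq_one_iff _).2 (H.heis_mem h.1)
    · intro hA
      obtain ⟨h, hh⟩ := H.exists_heis ((levi_eq_one_iff _).1 hA)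
      exact ⟨⟨h, (H.heis_mem_Gam_iff hT h).1 (hh ▸ A.2)⟩, Subtype.ext hh⟩
  rightHom_surjective := gamHom_surjective H hT

/-- The natural map `Γ̄_{L,I} → SL(I_{L*}, I) × Γ_Λ`. -/
noncomputable def gamBarHom (H : D.Splitting T) : D.GamBar →* D.SL D.ILdual × D.GamLam :=
  (((MonoidHom.fst _ _).comp (D.leviBar.comp D.GamBar.subtype)).codRestrict _ fun x => by
      obtain ⟨_, A, hA, rfl⟩ := x
      exact actU_mem_SL hA).prod
    (((MonoidHom.snd _ _).comp (D.leviBar.comp D.GamBar.subtype)).codRestrict _ fun x => by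
      obtain ⟨_, A, hA, rfl⟩ := x
      exact H.actW_mem_GamLam hA)

theorem gamBarHom_eq_iff (H : D.Splitting T) (x : D.GamBar) (g : D.SL D.ILdual × D.GamLam) :
    gamBarHom H x = g ↔ D.leviBar x.1 = (g.1.1, g.2.1) := by
  rw [Prod.ext_iff, Prod.ext_iff, Subtype.ext_iff, Subtype.ext_iff]
  rfl

/-- The coordinates (ψ, 0) may be non-integral because of ½ψψ*; the central correction supplies a
suitable η without affecting U^⊥. -/
theorem exists_lift_homLattice (H : D.Splitting T) (hT : D.IsUnimodularComplement T)
    (ψ : D.homLattice) :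
    ∃ A ∈ D.Gam, ∀ z : D.Uperp, (z : V) - A.1.1 z = (ψ.1 (D.toW z) : D.U) := by
  have h1 := (D.mem_unipotentRadical_iff _).1 (H.heis_mem ⟨ψ.1, 0⟩)
  obtain ⟨c, hc, h⟩ := H.exists_center_mul_mem_Gam hT (A := H.heis ⟨ψ.1, 0⟩)
    (by rw [h1.1]; exact one_mem _)
    (by have e : (⟨D.actW (H.heis ⟨ψ.1, 0⟩), D.actW_mem _⟩ : orthogonalGroup D.formW) = 1 :=
          Subtype.ext h1.2
        rw [e]; exact one_mem _)
    (fun z hz => by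
      rw [H.heis_apply_perp, sub_sub_cancel_left]
      exact neg_mem (ψ.2 _ (D.toW_mem_LamDual hz)))
  refine ⟨_, h, fun z => ?_⟩
  change (z : V) - c.1.1 ((H.heis ⟨ψ.1, 0⟩).1.1 z) = _
  rw [center_apply_perp hc ⟨_, D.P_mem_Uperp _ z z.2⟩]
  change (z : V) - (H.heis ⟨ψ.1, 0⟩).1.1 z = _
  rw [H.heis_apply_perp, sub_sub_cancel]

/-- The second short exact sequence. -/
theorem exists_gamBarExtension (H : D.Splitting T) (hT : D.IsUnimodularComplement T) :
    ∃ S : GroupExtension (Multiplicative D.homLattice) D.GamBar (D.SL D.ILdual × D.GamLam),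
      (∀ x : D.GamBar, ((S.rightHom x).1.1, (S.rightHom x).2.1) = D.leviBar x.1) ∧
      ∀ (ψ : D.homLattice) (A : D.P),
        (S.inl (Multiplicative.ofAdd ψ)).1 = (A : D.Pbar) ↔
          A ∈ D.unipotentRadical ∧ ∀ z : D.Uperp, (z : V) - A.1.1 z = (ψ.1 (D.toW z) : D.U) := by
  choose A hA hψ using exists_lift_homLattice H hT
  -- The class of the chosen lift is determined by ψ alone, so the choices are multiplicative in
  -- P̄_U.
  have hchar : ∀ (ψ : D.homLattice) (B : D.P), (A ψ : D.Pbar) = (B : D.Pbar) ↔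
      ∀ z : D.Uperp, (z : V) - B.1.1 z = (ψ.1 (D.toW z) : D.U) := fun ψ B => by
    rw [H.mk_eq_mk_iff]
    refine forall_congr' fun z => ?_
    rw [← hψ, sub_right_inj, eq_comm]
  let i : Multiplicative D.homLattice →* D.GamBar :=
    MonoidHom.mk' (fun ψ => ⟨(A ψ.toAdd : D.Pbar), ⟨_, hA _, rfl⟩⟩) fun ψ φ => by
      apply Subtype.ext
      refine (hchar (ψ.toAdd + φ.toAdd) (A ψ.toAdd * A φ.toAdd)).2 fun z => ?_
      change (z : V) - (A ψ.toAdd).1.1 ((A φ.toAdd).1.1 z) = _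
      have h1 : (A φ.toAdd).1.1 z = z - (φ.toAdd.1 (D.toW z) : D.U) := by
        rw [← hψ, sub_sub_cancel]
      have h2 := (D.actU_eq_iff _ 1).1 ((D.mem_unipotentRadical_iff _).1
        (mem_unipotentRadical_of_apply_perp _ (hψ ψ.toAdd))).1 (φ.toAdd.1 (D.toW z))
      rw [h1, map_sub, h2, ← sub_add, hψ]
      rfl
  have hi : ∀ (ψ : Multiplicative D.homLattice) (B : D.P), (i ψ).1 = (B : D.Pbar) ↔
      ∀ z : D.Uperp, (z : V) - B.1.1 z = (ψ.toAdd.1 (D.toW z) : D.U) := fun ψ B =>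
    hchar ψ.toAdd B
  refine ⟨⟨i, gamBarHom H, fun ψ φ h => ?_, ?_, fun g => ?_⟩, fun x => ?_, fun ψ B => ?_⟩
  · refine Multiplicative.toAdd.injective (Subtype.ext (LinearMap.ext fun w => ?_))
    obtain ⟨z, rfl⟩ := D.toW_surjective w
    have h1 := (hi ψ (A φ.toAdd)).1 (congrArg Subtype.val h) z
    rw [hψ] at h1
    exact Subtype.ext h1.symm
  · ext x
    rw [MonoidHom.mem_ker, gamBarHom_eq_iff]
    constructor
    · rintro ⟨ψ, rfl⟩
      exact (levi_eq_one_iff _).2 (mem_unipotentRadical_of_apply_perp _ (hψ ψ.toAdd))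
    · obtain ⟨_, B, hB, rfl⟩ := x
      intro hx
      obtain ⟨h, rfl⟩ := H.exists_heis ((levi_eq_one_iff B).1 hx)
      have h1 := (H.heis_mem_Gam_iff hT h).1 hB
      refine ⟨Multiplicative.ofAdd ⟨h.fst, h1.1⟩, Subtype.ext ((hi _ _).2 fun z => ?_)⟩
      rw [H.heis_apply_perp, sub_sub_cancel]
      rfl
  · obtain ⟨B, hB⟩ := gamHom_surjective H hT g
    refine ⟨⟨(B.1 : D.Pbar), ⟨_, B.2, rfl⟩⟩, (gamBarHom_eq_iff H _ _).2 ?_⟩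
    exact (gamHom_eq_iff H _ _).1 hB
  · exact ((gamBarHom_eq_iff H x _).1 rfl).symm
  · refine (hi (Multiplicative.ofAdd ψ) B).trans ⟨fun h => ⟨?_, h⟩, fun h => h.2⟩
    exact mem_unipotentRadical_of_apply_perp _ h

end IsotropicDatum

/-! ### The splitting over SL(I_ι, I) × Γ_Λ -/

theorem _root_.SemidirectProduct.bijective_lift {N G K Q : Type*} [Group N] [Group G] [Group K]
    [Group Q] {φ : G →* MulAut N} (f₁ : N →* K) (f₂ : G →* K)
    (h : ∀ g, f₁.comp (φ g).toMonoidHom = (MulAut.conj (f₂ g)).toMonoidHom.comp f₁)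
    (r : K →* Q) (h₁ : Function.Injective f₁) (hr : ∀ k, k ∈ f₁.range ↔ r k = 1)
    (h₂ : ∀ g, r (f₂ g) = 1 → g = 1) (h₃ : ∀ k, ∃ g, r (f₂ g) = r k) :
    Function.Bijective (SemidirectProduct.lift f₁ f₂ h) := by
  constructor
  · refine (injective_iff_map_eq_one _).2 fun x hx => ?_
    change f₁ x.left * f₂ x.right = 1 at hx
    have h4 : x.right = 1 := h₂ _ <| by
      have h5 := congrArg r hx
      rwa [map_mul, (hr _).1 ⟨_, rfl⟩, one_mul, map_one] at h5
    rw [h4, map_one, mul_one] at hx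
    exact SemidirectProduct.ext ((injective_iff_map_eq_one f₁).1 h₁ _ hx) h4
  · intro k
    obtain ⟨g, hg⟩ := h₃ k
    obtain ⟨n, hn⟩ := (hr (k * (f₂ g)⁻¹)).2 (by rw [map_mul, map_inv, hg, mul_inv_cancel])
    refine ⟨⟨n, g⟩, ?_⟩
    change f₁ n * f₂ g = k
    rw [hn, inv_mul_cancel_right]

namespace IsotropicDatum

variable {V : Type*} [AddCommGroup V] [Module ℚ V] {D : IsotropicDatum V} {T : Submodule ℤ V}

theorem SL_anti {J J' : Submodule ℤ D.U} (h : J ≤ J') : D.SL J' ≤ D.SL J :=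
  fun _ hM => ⟨hM.1, hM.2.1, fun u hu => hM.2.2 u (h hu)⟩

/-- Source of the action ψ ↦ Mψγ⁻¹: A⁻¹ acts on W by γ⁻¹, and A acts on the resulting vector of U by
M. -/
theorem conj_apply_perp {A B : D.P} {M : GeneralLinearGroup ℚ D.U} {γ : orthogonalGroup D.formW}
    (hA : D.levi A = (M, γ)) {ψ : D.W →ₗ[ℚ] D.U}
    (hB : ∀ z : D.Uperp, (z : V) - B.1.1 z = (ψ (D.toW z) : D.U)) (z : D.Uperp) :
    (z : V) - (A * B * A⁻¹).1.1 z = (M.1 (ψ ((γ⁻¹).1.1 (D.toW z))) : D.U) := by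
  have hA' : D.levi A⁻¹ = (M⁻¹, γ⁻¹) := by rw [map_inv, hA]; rfl
  have h1 := hB ⟨_, D.P_mem_Uperp A⁻¹ z z.2⟩
  rw [(D.actW_eq_iff _ _).1 ((D.levi_eq_iff _ _ _).1 hA').2 z] at h1
  have h2 := congrArg A.1.1 h1
  rw [map_sub, P_apply_inv, (D.actU_eq_iff _ _).1 ((D.levi_eq_iff _ _ _).1 hA).1] at h2
  exact h2

namespace Splitting

variable (H : D.Splitting T)

theorem form_tildeU_perp {t : V} (ht : t ∈ tildeU T) (z : D.Uperp) :
    D.form t z = D.form t (H.a z) := by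
  have h := H.form_t_perp (D.star t) z
  rwa [t_apply, H.eq_of_mem_tildeU t ht] at h

theorem mem_tildeU_of_mem_tildeIL (t : D.tildeIL T) : (t : V) ∈ tildeU T :=
  Submodule.subset_span t.2.1

/-- Well-definedness of ι: the difference of the two lattice vectors lies in L ∩ U^⊥. -/
theorem tildeToW_sub_mem_Lam {u u' : D.U} {w w' : D.tildeW T} {t : V}
    (h : (u + w + t : V) ∈ D.L) (h' : (u' + w' + t : V) ∈ D.L) :
    D.tildeToW T w - D.tildeToW T w' ∈ D.Lam := by
  have h1 : ((u - u' : D.U) : V) + (w - w' : D.tildeW T) ∈ D.L := by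
    have h2 := sub_mem h h'
    convert h2 using 1
    push_cast
    abel
  rw [← map_sub]
  refine ⟨⟨_, add_mem (D.isotropic (u - u').2) (D.tildeW_le T (w - w').2)⟩, h1, ?_⟩
  refine (Submodule.Quotient.eq (D.U.submoduleOf D.Uperp)).2 ?_
  change ((u - u' : D.U) : V) + (w - w' : D.tildeW T) - (w - w' : D.tildeW T) ∈ D.U
  rw [add_sub_cancel_right]
  exact (u - u').2

variable [FiniteDimensional ℚ V]

/-- An element of L with the same pairing with I as t differs from t by a vector of U^⊥ = U ⊕ W̃. -/
theorem exists_add_mem_L (H : D.Splitting T) (t : D.tildeIL T) :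
    ∃ (u : D.U) (w : D.tildeW T), (u + w + t : V) ∈ D.L := by
  obtain ⟨ν, hν, h⟩ := t.2.2
  have hs : D.star t = D.star ν := D.eq_of_eqOn_I h
  refine ⟨H.a ν - H.σ (D.star ν), ⟨H.s (H.p ν), H.s_mem _⟩, ?_⟩
  suffices h1 : ((H.a ν - H.σ (D.star ν) : D.U) : V) + H.s (H.p ν) + t = ν by rwa [← h1] at hν
  refine Eq.trans ?_ (H.decomp ν)
  rw [← H.eq_of_mem_tildeU t (mem_tildeU_of_mem_tildeIL t), hs]
  push_cast
  abel

theorem tildeToW_mem_LamDual (H : D.Splitting T) (hT : D.IsUnimodularComplement T)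
    {u : D.U} {w : D.tildeW T}
    {t : D.tildeIL T} (h : (u + w + t : V) ∈ D.L) : D.tildeToW T w ∈ D.LamDual := by
  intro y hy
  have h1 := D.L_le_Ldual h _ (H.s_mem_L hT hy)
  convert h1 using 1
  have h2 := H.form_tildeU_perp (mem_tildeU_of_mem_tildeIL t) ⟨_, H.s_perp y⟩
  have h3 : D.form u (H.s y) = 0 := H.s_perp y u u.2
  rw [map_add, map_add, LinearMap.add_apply, LinearMap.add_apply, h2, h3, H.a_s]
  change _ = 0 + D.form w (H.s y) + D.form t ((0 : D.U) : V)
  rw [Submodule.coe_zero, map_zero, zero_add, add_zero]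
  nth_rewrite 1 [← H.toW_s y]
  rfl

theorem existsUnique_isIota (H : D.Splitting T) (hT : D.IsUnimodularComplement T) :
    ∃! ι : D.tildeIL T →ₗ[ℤ] D.Disc, D.IsIota T ι := by
  choose u w h using H.exists_add_mem_L
  have hcls : ∀ (t : D.tildeIL T) (u' : D.U) (w' : D.tildeW T) (h' : (u' + w' + t : V) ∈ D.L),
      (Submodule.Quotient.mk ⟨_, H.tildeToW_mem_LamDual hT (h t)⟩ : D.Disc) =
        Submodule.Quotient.mk ⟨_, H.tildeToW_mem_LamDual hT h'⟩ := fun t u' w' h' =>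
    (Submodule.Quotient.eq _).2 (tildeToW_sub_mem_Lam (h t) h')
  let ι : D.tildeIL T →+ D.Disc :=
    AddMonoidHom.mk' (fun t => Submodule.Quotient.mk ⟨_, H.tildeToW_mem_LamDual hT (h t)⟩)
      fun t t' => by
        have h1 : ((u t + u t' : D.U) + (w t + w t' : D.tildeW T) + (t + t' : D.tildeIL T) : V) ∈
            D.L := by
          have h2 := add_mem (h t) (h t')
          rw [add_add_add_comm, add_add_add_comm (u t : V)] at h2
          exact h2
        rw [hcls (t + t') _ _ h1, ← Submodule.Quotient.mk_add]
        congr 1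
  refine ⟨ι.toIntLinearMap, fun u' w' t h' => ⟨H.tildeToW_mem_LamDual hT h', hcls t u' w' h'⟩,
    fun κ hκ => LinearMap.ext fun t => ?_⟩
  obtain ⟨_, h1⟩ := hκ (u t) (w t) t (h t)
  exact h1

/-- For u + w + t ∈ L the integer (z, u + w + t) equals (z, w) plus the pairing of the U-component
of z with t. So that component represents ι* of minus the class of z in Δ_Λ. -/
theorem a_mem_Iiota (H : D.Splitting T) {ι : D.tildeIL T →ₗ[ℤ] D.Disc} (hι : D.IsIota T ι)
    {z : D.Uperp} (hz : (z : V) ∈ D.Ldual) : H.a z ∈ D.Iiota ι := by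
  refine ⟨-⟨_, D.toW_mem_LamDual hz⟩, fun t y hy => ?_⟩
  obtain ⟨u, w, h⟩ := H.exists_add_mem_L t
  obtain ⟨h1, h2⟩ := hι u w t h
  have h3 : (y : D.W) - D.tildeToW T w ∈ D.Lam :=
    (Submodule.Quotient.eq (D.Lam.submoduleOf D.LamDual)).1 (hy.symm.trans h2)
  have h4 := add_mem (hz _ h) (D.toW_mem_LamDual hz _ h3)
  convert h4 using 1
  have h5 : D.form z u = 0 := (D.form_comm _ _).trans (z.2 u u.2)
  have h6 : D.form z t = D.form (H.a z) t := by
    rw [D.form_comm, H.form_tildeU_perp (mem_tildeU_of_mem_tildeIL t), D.form_comm]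
  have h7 : D.form z w = D.formW (D.toW z) (D.tildeToW T w) := rfl
  rw [map_add, map_add, h5, h6, h7, map_sub, Submodule.coe_neg, map_neg, LinearMap.neg_apply]
  ring

end Splitting

variable [FiniteDimensional ℚ V]

/-- A choice of a splitting for a unimodular complement. -/
noncomputable def IsUnimodularComplement.splitting (hT : D.IsUnimodularComplement T) :
    D.Splitting T :=
  hT.exists_splitting.some

/-- Take δ = 0: an element of Ĩ_L pairs with U like an element of L. -/
theorem ILdual_le_Iiota (ι : D.tildeIL T →ₗ[ℤ] D.Disc) : D.ILdual ≤ D.Iiota ι := by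
  refine fun u hu => ⟨0, fun t y _ => ?_⟩
  obtain ⟨ν, hν, h⟩ := t.2.2
  have hs : D.star t = D.star ν := D.eq_of_eqOn_I h
  have h1 : D.form u t = D.form u ν := by
    rw [D.form_comm, D.form_comm u]
    exact LinearMap.congr_fun hs u
  rw [h1, Submodule.coe_zero, map_zero, LinearMap.zero_apply, sub_zero]
  exact hu ν hν

namespace Splitting

variable (H : D.Splitting T)

/-- M is trivial modulo I on the U-components of L* ∩ U^⊥, so no ψ is needed and a central
correction suffices; it vanishes in P̄_U. -/
theorem mk_leviLift_mem_GamBar (H : D.Splitting T) (hT : D.IsUnimodularComplement T)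
    {ι : D.tildeIL T →ₗ[ℤ] D.Disc} (hι : D.IsIota T ι) {M : GeneralLinearGroup ℚ D.U}
    (hM : M ∈ D.SL (D.Iiota ι)) {γ : orthogonalGroup D.formW} (hγ : γ ∈ D.GamLam) :
    (H.leviLift M γ : D.Pbar) ∈ D.GamBar := by
  obtain ⟨c, hc, h⟩ := H.exists_center_mul_mem_Gam hT (A := H.leviLift M γ)
    (by rw [H.actU_leviLift]; exact SL_anti (ILdual_le_Iiota ι) hM)
    (by have e : (⟨D.actW (H.leviLift M γ), D.actW_mem _⟩ : orthogonalGroup D.formW) = γ :=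
          Subtype.ext (H.actW_leviLift M γ)
        rw [e]; exact hγ)
    (fun z hz => by
      have h1 : H.a z - M.1 (H.a z) - 0 ∈ D.I := by
        rw [sub_zero]
        exact hM.2.2 _ (H.a_mem_Iiota hι hz)
      have h2 := H.leviLift_sub_mem_L hT hγ hz h1
      rwa [Submodule.coe_zero, add_zero] at h2)
  exact ⟨_, h, mk_center_mul hc _⟩

/-- The Levi lift as a homomorphism `SL(I_ι, I) × Γ_Λ → Γ̄_{L,I}`, with values in the pre-image
of `SL(I_ι, I) × Γ_Λ`. -/
noncomputable def leviHom (hT : D.IsUnimodularComplement T) {ι : D.tildeIL T →ₗ[ℤ] D.Disc}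
    (hι : D.IsIota T ι) : D.SL (D.Iiota ι) × D.GamLam →*
      ((D.SL (D.Iiota ι)).prod D.GamLam).comap (D.leviBar.comp D.GamBar.subtype) :=
  MonoidHom.mk'
    (fun g => ⟨⟨(H.leviLift g.1.1 g.2.1 : D.Pbar),
        H.mk_leviLift_mem_GamBar hT hι g.1.2 g.2.2⟩, by
      rw [Subgroup.mem_comap]
      change D.leviBar (H.leviLift g.1.1 g.2.1 : D.Pbar) ∈ _
      rw [leviBar_mk, H.levi_leviLift]
      exact ⟨g.1.2, g.2.2⟩⟩)
    fun g g' => Subtype.ext <| Subtype.ext <|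
      (congrArg (QuotientGroup.mk' D.center) (H.leviLift_mul g.1.1 g'.1.1 g.2.1 g'.2.1)).trans
        (map_mul _ _ _)

theorem exists_semidirect (H : D.Splitting T) (hT : D.IsUnimodularComplement T)
    (S : GroupExtension (Multiplicative D.homLattice) D.GamBar (D.SL D.ILdual × D.GamLam))
    (hS : ∀ x : D.GamBar, ((S.rightHom x).1.1, (S.rightHom x).2.1) = D.leviBar x.1)
    (hS' : ∀ (ψ : D.homLattice) (A : D.P),
      (S.inl (Multiplicative.ofAdd ψ)).1 = (A : D.Pbar) ↔
        A ∈ D.unipotentRadical ∧ ∀ z : D.Uperp, (z : V) - A.1.1 z = (ψ.1 (D.toW z) : D.U))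
    {ι : D.tildeIL T →ₗ[ℤ] D.Disc} (hι : D.IsIota T ι) :
    ∃ e : Multiplicative D.homLattice ⋊[D.actHomAut (D.Iiota ι)]
          (D.SL (D.Iiota ι) × D.GamLam) ≃*
        ((D.SL (D.Iiota ι)).prod D.GamLam).comap (D.leviBar.comp D.GamBar.subtype),
      (∀ x, D.leviBar (e x).1.1 = (x.right.1.1, x.right.2.1)) ∧
      (∀ ψ, (e (SemidirectProduct.inl ψ)).1 = S.inl ψ) ∧
      ∀ (g : D.SL (D.Iiota ι) × D.GamLam) (A : D.P),
        (e (SemidirectProduct.inr g)).1.1 = (A : D.Pbar) ↔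
          D.levi A = (g.1.1, g.2.1) ∧ ∀ v, A.1.1 v ∈ D.U ⊔ tildeU T ↔ v ∈ D.U ⊔ tildeU T := by
  have hinl : ∀ ψ, D.leviBar (S.inl ψ).1 = 1 := fun ψ => by
    rw [← hS, S.rightHom_inl]
    rfl
  let i : Multiplicative D.homLattice →*
      ((D.SL (D.Iiota ι)).prod D.GamLam).comap (D.leviBar.comp D.GamBar.subtype) :=
    S.inl.codRestrict _ fun ψ => by
      rw [Subgroup.mem_comap]
      change D.leviBar (S.inl ψ).1 ∈ _
      rw [hinl]
      exact one_mem _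
  have hconj : ∀ g, i.comp (D.actHomAut (D.Iiota ι) g).toMonoidHom =
      (MulAut.conj (H.leviHom hT hι g)).toMonoidHom.comp i := fun g => by
    refine MonoidHom.ext fun ψ => Subtype.ext (Subtype.ext ?_)
    obtain ⟨B, hB⟩ := QuotientGroup.mk_surjective (S.inl ψ).1
    obtain ⟨hB1, hB2⟩ := (hS' ψ.toAdd B).1 hB.symm
    have h1 := (hS' (D.actHom g ψ.toAdd) (H.leviLift g.1.1 g.2.1 * B *
      (H.leviLift g.1.1 g.2.1)⁻¹)).2 ⟨(MonoidHom.normal_ker D.levi).conj_mem _ hB1 _,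
        conj_apply_perp (H.levi_leviLift _ _) hB2⟩
    rw [QuotientGroup.mk_mul, QuotientGroup.mk_mul, hB] at h1
    exact h1
  let F := SemidirectProduct.lift i (H.leviHom hT hι) hconj
  have hF : ∀ x, D.leviBar (F x).1.1 = (x.right.1.1, x.right.2.1) := fun x => by
    change D.leviBar ((S.inl x.left).1 * (H.leviLift x.right.1.1 x.right.2.1 : D.Pbar)) = _
    rw [map_mul, hinl, one_mul, leviBar_mk, H.levi_leviLift]
  have hbij : Function.Bijective F := by
    refine SemidirectProduct.bijective_lift i (H.leviHom hT hι) hconj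
      ((D.leviBar.comp D.GamBar.subtype).comp (Subgroup.subtype _))
      (fun ψ φ h => S.inl_injective (congrArg Subtype.val h)) (fun k => ?_) (fun g hg => ?_)
      fun k => ⟨(⟨_, k.2.1⟩, ⟨_, k.2.2⟩), ?_⟩
    · constructor
      · rintro ⟨ψ, rfl⟩
        exact hinl ψ
      · intro hk
        have h1 : S.rightHom k.1 = 1 := by
          obtain ⟨h2, h3⟩ := Prod.ext_iff.1 ((hS k.1).trans hk)
          exact Prod.ext (Subtype.ext h2) (Subtype.ext h3)
        rw [← MonoidHom.mem_ker, ← S.range_inl_eq_ker_rightHom] at h1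
        obtain ⟨ψ, hψ⟩ := h1
        exact ⟨ψ, Subtype.ext hψ⟩
    · obtain ⟨h1, h2⟩ := Prod.ext_iff.1 ((H.levi_leviLift g.1.1 g.2.1).symm.trans hg)
      exact Prod.ext (Subtype.ext h1) (Subtype.ext h2)
    · exact H.levi_leviLift _ _
  refine ⟨MulEquiv.ofBijective F hbij, hF, fun ψ => ?_, fun g A => ?_⟩
  · exact congrArg Subtype.val (SemidirectProduct.lift_inl i _ hconj ψ)
  · have h := congrArg (fun x => x.1.1) (SemidirectProduct.lift_inr i _ hconj g)
    exact (Eq.congr_left h).trans (H.mk_leviLift_eq_iff g.1.1 g.2.1 A)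

end Splitting

end IsotropicDatum

end IntegralParabolic

/-! ### The theorem -/

theorem theorem3p4 {V : Type*} [AddCommGroup V] [Module ℚ V] [FiniteDimensional ℚ V]
    (D : IsotropicDatum V) :
    -- unimodular complements exist
    (∃ T : Submodule ℤ V, D.IsUnimodularComplement T) ∧
    -- the first short exact sequence, in the coordinates of any unimodular complement
    (∀ T : Submodule ℤ V, D.IsUnimodularComplement T →
      ∃ S : GroupExtension D.integralHeis D.Gam (D.SL D.ILdual × D.GamLam),
        (∀ A : D.Gam, ((S.rightHom A).1.1, (S.rightHom A).2.1) = D.levi A.1) ∧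
        S.inl.range = D.unipotentRadical.subgroupOf D.Gam ∧
        ∀ (h : D.integralHeis) (A : D.P), (S.inl h).1 = A ↔ D.HasHeisCoord T A h.1) ∧
    -- the kernel of the map to the quotient by `Hom^{as}(U*, U)` is `Hom^{as}(I*, I)`
    (∀ η ∈ D.homAs, ∀ A : D.P, A.1.1 = D.transEnd η →
      (A ∈ D.Gam ↔ ∀ f ∈ D.Idual, η f ∈ D.I)) ∧
    -- the second short exact sequence
    ∃ S : GroupExtension (Multiplicative D.homLattice) D.GamBar (D.SL D.ILdual × D.GamLam),
      (∀ x : D.GamBar, ((S.rightHom x).1.1, (S.rightHom x).2.1) = D.leviBar x.1) ∧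
      (∀ (ψ : D.homLattice) (A : D.P),
        (S.inl (Multiplicative.ofAdd ψ)).1 = (A : D.Pbar) ↔
          A ∈ D.unipotentRadical ∧ ∀ z : D.Uperp, (z : V) - A.1.1 z = (ψ.1 (D.toW z) : D.U)) ∧
      -- its splitting over `SL(I_ι, I) × Γ_Λ`
      ∀ T : Submodule ℤ V, D.IsUnimodularComplement T →
        (∃! ι : D.tildeIL T →ₗ[ℤ] D.Disc, D.IsIota T ι) ∧
        ∀ ι : D.tildeIL T →ₗ[ℤ] D.Disc, D.IsIota T ι →
          D.SL (D.Iiota ι) ≤ D.SL D.ILdual ∧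
          ∃ e : Multiplicative D.homLattice ⋊[D.actHomAut (D.Iiota ι)]
                (D.SL (D.Iiota ι) × D.GamLam) ≃*
              ((D.SL (D.Iiota ι)).prod D.GamLam).comap (D.leviBar.comp D.GamBar.subtype),
            (∀ x, D.leviBar (e x).1.1 = (x.right.1.1, x.right.2.1)) ∧
            (∀ ψ, (e (SemidirectProduct.inl ψ)).1 = S.inl ψ) ∧
            ∀ (g : D.SL (D.Iiota ι) × D.GamLam) (A : D.P),
              (e (SemidirectProduct.inr g)).1.1 = (A : D.Pbar) ↔
                D.levi A = (g.1.1, g.2.1) ∧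
                ∀ v, A.1.1 v ∈ D.U ⊔ IsotropicDatum.tildeU T ↔
                  v ∈ D.U ⊔ IsotropicDatum.tildeU T := by
  have hT₀ := D.exists_isUnimodularComplement.choose_spec
  refine ⟨⟨_, hT₀⟩, fun T hT => ?_, fun η hη A hA => ?_, ?_⟩
  · let H := hT.splitting
    refine ⟨IsotropicDatum.gamExtension H hT,
      fun A => ((IsotropicDatum.gamHom_eq_iff H A _).1 rfl).symm, ?_,
      fun h A => H.eq_heis_iff A h.1⟩
    rw [GroupExtension.range_inl_eq_ker_rightHom]
    ext A
    exact IsotropicDatum.gamHom_eq_iff H A 1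
  · have h1 : A = hT₀.splitting.heis ⟨0, ⟨η, hη⟩⟩ :=
      D.P_ext fun v => by rw [hA, IsotropicDatum.Splitting.heis_zero_apply]
    rw [h1, IsotropicDatum.Splitting.heis_mem_Gam_iff _ hT₀]
    constructor
    · intro h f hf
      simpa using h.2.2 f hf
    · intro h
      refine ⟨zero_mem _, fun f hf => D.I.smul_mem 2 (h f hf), fun f hf => ?_⟩
      simpa using h f hf
  -- One auxiliary complement builds the second sequence. Its maps are characterized without
  -- reference to a complement, so the same sequence can be split by means of any other one.
  · have hS := (IsotropicDatum.exists_gamBarExtension hT₀.splitting hT₀).choose_spec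
    exact ⟨_, hS.1, hS.2, fun T hT => ⟨hT.splitting.existsUnique_isIota hT, fun ι hι =>
      ⟨IsotropicDatum.SL_anti (IsotropicDatum.ILdual_le_Iiota ι),
        hT.splitting.exists_semidirect hT _ hS.1 hS.2 hι⟩⟩⟩
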